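/- Let $p>1$ and $q=p/(p-1)$. Let $(M,g)$ be an $n$-dimensional complete connected Riemannian manifold (smooth, without boundary, $\sigma$-compact), with volume measure $dv$ and distance $d$. Let $S=[s_0-\epsilon,s_0+\epsilon]$ with $\epsilon>0$, and let $\rho,\phi:S\times[0,1]\times M\to\mathbb R$ be smooth with $\rho>0$. Derivatives in $s$ and $t$ at end points of $S$ and $[0,1]$ are one-sided. Assume: (a) for all $(s,t)\in S\times[0,1]$ the measure $\rho(s,t)\,dv$ lies in $P_q(M)$, i.e. $\int_M\rho(s,t)\,dv=1$ and $\int_M d^q(o,x)\rho(s,t,x)\,dv(x)<\infty$ for every $o\in M$; (b) for every $s\in S$ the nonlinear transport equation $$\frac{\partial\rho}{\partial t}+\nabla\cdot\left(\rho|\nabla\phi|^{p-2}\nabla\phi\right)=0\quad\text{on }[0,1]\times M$$ holds, the divergence being taken in the sense of distributions on $M$, i.e. $\int_M h\,\partial_t\rho\,dv=\int_M\rho|\nabla\phi|^{p-2}\langle\nabla\phi,\nabla h\rangle\,dv$ for all $h\in C_c^\infty(M)$ and all $t\in[0,1]$ (this is the classical equation whenever the flux is $C^1$, in particular for $p\ge2$);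 (c) (growth condition, automatic if $M$ is compact) there is $G\in L^1(M,dv)$ such that for all $s,s'\in S$, $t\in[0,1]$, $x\in M$ $$\Big(1+|\phi|^p+|\partial_t\phi|+|\nabla\phi|^p+|\nabla\partial_s\phi|^p\Big)(s,t,x)\,\Big(\rho+|\partial_s\rho|\Big)(s',t,x)\le G(x).$$ Put $$E(s)=\frac1p\int_0^1\int_M|\nabla\phi(s,t)|^p\rho(s,t)\,dv\,dt .$$ (1) For every $s\in S$ and $t\in[0,1]$ the functions $|\nabla\phi|^p\rho$, $\phi\,\partial_s\rho$ and $(\partial_t\phi+\frac1p|\nabla\phi|^p)\partial_s\rho$ are integrable on $M$, and the first and the third are integrable on $[0,1]\times M$. The function $E$ is differentiable on $S$ (one-sidedly at the end points), and for every $s\in S$ $$\frac{d}{ds}E(s)=\frac1{p-1}\int_M\phi\,\frac{\partial\rho}{\partial s}\,dv\,\Big|_{t=0}^{1}-\frac1{p-1}\int_0^1\int_M\left(\frac{\partial\phi}{\partial t}+\frac1p|\nabla\phi|^p\right)\frac{\partial\rho}{\partial s}\,dv\,dt .$$ (2) The associated Euler–Lagrange equation is the $p$-Hamilton–Jacobi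 equation, in the following sense. For $s\in S$ and $\sigma\in C_c^\infty((0,1)\times M)$ let $\delta E_s(\sigma)$ be the right-hand side above with $\partial\rho/\partial s$ replaced by $\sigma$. Then $\delta E_s(\sigma)=0$ for all such $\sigma$ if and only if $$\frac{\partial\phi}{\partial t}+\frac1p|\nabla\phi|^p=0\quad\text{on }[0,1]\times M$$ for this $s$. Moreover, $\delta E_s(\sigma)=0$ for all such $\sigma$ with $\int_M\sigma(t)\,dv=0$ for every $t$ if and only if there is $c\in C^1([0,1])$ such that $\phi(s,t,x)-c(t)$ solves this equation. In the latter case, if in addition $\partial_s\rho(s,0,\cdot)=\partial_s\rho(s,1,\cdot)=0$, then $\frac{d}{ds}E(s)=0$. -/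

import Mathlib

open Set MeasureTheory Bundle
open scoped Manifold ContDiff ENNReal

noncomputable section

/-! ### Riemannian manifolds: volume, gradient, divergence

`M` is a smooth manifold without boundary modelled on `EuclideanSpace ℝ (Fin n)`, with a smooth
Riemannian metric on its tangent bundle. -/

namespace PWasserstein

section Geometry

variable (n : ℕ) {M : Type*} [MetricSpace M] [ChartedSpace (EuclideanSpace ℝ (Fin n)) M]
  [RiemannianBundle (fun x : M => TangentSpace (𝓡 n) x)]

/-- The `i`-th coordinate vector field `∂/∂yᵢ` of the chart at `c`, at the point of coordinates
`y`. -/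
def coordVec (c : M) (y : EuclideanSpace ℝ (Fin n)) (i : Fin n) :
    TangentSpace (𝓡 n) ((extChartAt (𝓡 n) c).symm y) :=
  mfderiv (𝓡 n) (𝓡 n) (extChartAt (𝓡 n) c).symm y (EuclideanSpace.single i (1 : ℝ))

/-- The matrix `gᵢⱼ(y) = ⟨∂/∂yᵢ, ∂/∂yⱼ⟩` of the metric in the chart at `c`. -/
def metricMatrix (c : M) (y : EuclideanSpace ℝ (Fin n)) : Matrix (Fin n) (Fin n) ℝ :=
  Matrix.of fun i j => inner ℝ (coordVec n c y i) (coordVec n c y j)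

/-- The measure `√(det g) dy` of the domain of the chart at `c`, as a measure on `M`. -/
def chartVolume [MeasurableSpace M] (c : M) : Measure M :=
  Measure.map (extChartAt (𝓡 n) c).symm
    ((volume.restrict (extChartAt (𝓡 n) c).target).withDensity
      fun y => ENNReal.ofReal (Real.sqrt (metricMatrix n c y).det))

variable (M) in
/-- A smooth partition of unity subordinate to the domains of the charts. -/
def chartPartition [SigmaCompactSpace M] [IsManifold (𝓡 n) ∞ M] :
    SmoothPartitionOfUnity M (𝓡 n) M univ :=
  (SmoothPartitionOfUnity.exists_isSubordinate_chartAt_source (𝓡 n) M).choose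

variable (M) in
/-- The Riemannian volume measure `dv`, given by `√(det g) dy` in charts and glued with a
partition of unity: `∫ f dv = ∑ᵢ ∫ χᵢ f √(det g) dy`. -/
def riemannianVolume [MeasurableSpace M] [SigmaCompactSpace M] [IsManifold (𝓡 n) ∞ M] :
    Measure M :=
  Measure.sum fun c : M =>
    (chartVolume n c).withDensity fun x => ENNReal.ofReal (chartPartition n M c x)

/-- The differential of `f` at `x`, as a continuous linear form on the tangent space. -/
def differential (f : M → ℝ) (x : M) : TangentSpace (𝓡 n) x →L[ℝ] ℝ :=
  mfderiv (𝓡 n) 𝓘(ℝ, ℝ) f x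

/-- The Riemannian gradient: `⟨∇f(x), v⟩ = df(x) v`. -/
def grad (f : M → ℝ) (x : M) : TangentSpace (𝓡 n) x :=
  haveI : FiniteDimensional ℝ (TangentSpace (𝓡 n) x) :=
    inferInstanceAs (FiniteDimensional ℝ (EuclideanSpace ℝ (Fin n)))
  haveI : CompleteSpace (TangentSpace (𝓡 n) x) := FiniteDimensional.complete ℝ _
  (InnerProductSpace.toDual ℝ (TangentSpace (𝓡 n) x)).symm (differential n f x)

theorem inner_grad (f : M → ℝ) (x : M) (v : TangentSpace (𝓡 n) x) :
    inner ℝ (grad n f x) v = differential n f x v := by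
  have : FiniteDimensional ℝ (TangentSpace (𝓡 n) x) :=
    inferInstanceAs (FiniteDimensional ℝ (EuclideanSpace ℝ (Fin n)))
  have : CompleteSpace (TangentSpace (𝓡 n) x) := FiniteDimensional.complete ℝ _
  exact InnerProductSpace.toDual_symm_apply

/-- `∇·X = f` on `M` in the sense of distributions. For a `C¹` field `X` and continuous `f` this is
the classical identity. -/
def HasDivergence [MeasurableSpace M] [SigmaCompactSpace M] [IsManifold (𝓡 n) ∞ M]
    (X : ∀ x : M, TangentSpace (𝓡 n) x) (f : M → ℝ) : Prop :=
  ∀ h : M → ℝ, ContMDiff (𝓡 n) 𝓘(ℝ, ℝ) ∞ h → HasCompactSupport h →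
    ∫ x, h x * f x ∂(riemannianVolume n M) =
      -∫ x, inner ℝ (X x) (grad n h x) ∂(riemannianVolume n M)

end Geometry

/-! ### Time-dependent functions, families of curves -/

/-- `∂u/∂t` for `t ∈ [0,1]` (one-sided at the end points). -/
def dt {M : Type*} (u : ℝ → M → ℝ) (t : ℝ) (x : M) : ℝ :=
  derivWithin (fun τ => u τ x) (Icc 0 1) t

/-- `∂u/∂s` for `s` in the interval `S` (one-sided at the end points). -/
def ds {M : Type*} (S : Set ℝ) (u : ℝ → ℝ → M → ℝ) (s t : ℝ) (x : M) : ℝ :=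
  derivWithin (fun σ => u σ t x) S s

section Families

variable (n : ℕ) {M : Type*} [MetricSpace M] [ChartedSpace (EuclideanSpace ℝ (Fin n)) M]

/-- `u : S × [0,1] → C^∞(M)` is smooth, i.e. `(s,t,x) ↦ u s t x` is smooth on `S × [0,1] × M`. -/
def IsSmoothFamily (S : Set ℝ) (u : ℝ → ℝ → M → ℝ) : Prop :=
  ContMDiffOn (𝓘(ℝ, ℝ × ℝ).prod (𝓡 n)) 𝓘(ℝ, ℝ) ∞
    (fun z : (ℝ × ℝ) × M => u z.1.1 z.1.2 z.2) ((S ×ˢ Icc (0 : ℝ) 1) ×ˢ (univ : Set M))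

/-- `σ` belongs to `C_c^∞((0,1) × M)`. -/
def IsTestDensity (σ : ℝ → M → ℝ) : Prop :=
  ContMDiff (𝓘(ℝ, ℝ).prod (𝓡 n)) 𝓘(ℝ, ℝ) ∞ (fun z : ℝ × M => σ z.1 z.2) ∧
    HasCompactSupport (fun z : ℝ × M => σ z.1 z.2) ∧
    tsupport (fun z : ℝ × M => σ z.1 z.2) ⊆ Ioo (0 : ℝ) 1 ×ˢ (univ : Set M)

variable [RiemannianBundle (fun x : M => TangentSpace (𝓡 n) x)]

/-- `∂ψ/∂t + |∇ψ|^p / p`. -/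
def hamiltonJacobi (p : ℝ) (ψ : ℝ → M → ℝ) (t : ℝ) (x : M) : ℝ :=
  dt ψ t x + 1 / p * ‖grad n (ψ t) x‖ ^ p

/-- `ψ` solves the `p`-Hamilton–Jacobi equation `∂ψ/∂t + |∇ψ|^p / p = 0` on `[0,1] × M`. -/
def SolvesHamiltonJacobi (p : ℝ) (ψ : ℝ → M → ℝ) : Prop :=
  ∀ t ∈ Icc (0 : ℝ) 1, ∀ x, hamiltonJacobi n p ψ t x = 0

variable [MeasurableSpace M] [SigmaCompactSpace M] [IsManifold (𝓡 n) ∞ M]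

/-- The measure `r dv` belongs to the `L^q`-Wasserstein space `P_q(M)`. -/
structure IsWassersteinDensity (q : ℝ) (r : M → ℝ) : Prop where
  nonneg : ∀ x, 0 ≤ r x
  integrable : Integrable r (riemannianVolume n M)
  integral_eq_one : ∫ x, r x ∂(riemannianVolume n M) = 1
  moment : ∀ o : M, Integrable (fun x => dist o x ^ q * r x) (riemannianVolume n M)

/-- The nonlinear transport equation `∂ρ/∂t + ∇·(ρ |∇φ|^{p-2} ∇φ) = 0` on `[0,1] × M`. The
divergence is distributional: for `1 < p < 2` the flux need not be differentiable at critical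
points of `φ`. -/
def SolvesTransport (p : ℝ) (ρ φ : ℝ → M → ℝ) : Prop :=
  ∀ t ∈ Icc (0 : ℝ) 1, HasDivergence n
    (fun x => (ρ t x * ‖grad n (φ t) x‖ ^ (p - 2)) • grad n (φ t) x) (fun x => -dt ρ t x)

/-- The energy `(1/p) ∫₀¹ ∫_M |∇φ|^p ρ dv dt`. -/
def energy (p : ℝ) (ρ φ : ℝ → M → ℝ) : ℝ :=
  1 / p * ∫ t in (0 : ℝ)..1, ∫ x, ‖grad n (φ t) x‖ ^ p * ρ t x ∂(riemannianVolume n M)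

/-- The functional
`σ ↦ (1/(p-1)) ∫_M φ σ dv |_{t=0}^{t=1} - (1/(p-1)) ∫₀¹ ∫_M (∂φ/∂t + |∇φ|^p / p) σ dv dt`. -/
def firstVariation (p : ℝ) (φ σ : ℝ → M → ℝ) : ℝ :=
  1 / (p - 1) * ((∫ x, φ 1 x * σ 1 x ∂(riemannianVolume n M)) -
      ∫ x, φ 0 x * σ 0 x ∂(riemannianVolume n M)) -
    1 / (p - 1) *
      ∫ t in (0 : ℝ)..1, ∫ x, hamiltonJacobi n p φ t x * σ t x ∂(riemannianVolume n M)

/-- Growth condition at infinity (automatic when `M` is compact): the products of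
`1 + |φ|^p + |∂φ/∂t| + |∇φ|^p + |∇∂φ/∂s|^p` and `ρ + |∂ρ/∂s|`, at parameters `s, s'`, are dominated
by an integrable function of `x` alone. -/
def SuitableGrowth (p : ℝ) (S : Set ℝ) (ρ φ : ℝ → ℝ → M → ℝ) : Prop :=
  ∃ G : M → ℝ, Integrable G (riemannianVolume n M) ∧
    ∀ s ∈ S, ∀ s' ∈ S, ∀ t ∈ Icc (0 : ℝ) 1, ∀ x,
      (1 + |φ s t x| ^ p + |dt (φ s) t x| + ‖grad n (φ s t) x‖ ^ p +
          ‖grad n (ds S φ s t) x‖ ^ p) * (ρ s' t x + |ds S ρ s' t x|) ≤ G x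

end Families

end PWasserstein

end

/-!
The energy `E(s) = (1/p) ∫₀¹ ∫ |∇φ|^p ρ` is differentiated in two ways. Write
`F(s) = ∫₀¹ ∫ |∇φ_s|^p ρ_s`.

* Under the integral sign, `F' = p K + N` with `K = ∫₀¹ ∫ ρ ⟨|∇φ|^{p-2} ∇φ, ∇∂_sφ⟩` and
  `N = ∫₀¹ ∫ |∇φ|^p ∂_sρ`.
* For fixed `s`, testing the transport equation at the parameter `s'` with `φ_s` and integrating by
  parts in time expresses `Q(s') = ∫₀¹ ∫ ρ_{s'} ⟨|∇φ_{s'}|^{p-2} ∇φ_{s'}, ∇φ_s⟩` through integrals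
  which contain `s'` in the undifferentiated density `ρ_{s'}` only
  (`IsTransportFamily.integral_density_mul_pPairing`). Hence
  `Q'(s) = L := [∫ φ ∂_sρ]₀¹ - ∫₀¹ ∫ ∂_tφ ∂_sρ`. The integrand of
  `F(s') - Q(s')` is `ρ_{s'} ⟨|∇φ_{s'}|^{p-2} ∇φ_{s'}, ∇φ_{s'} - ∇φ_s⟩`, so that
  `(F - Q)'(s) = K` (`IsTransportFamily.hasDerivWithinAt_integral_sub`), without any mixed
  derivative `∂_s∂_tρ`, which the growth condition does not control.

Eliminating `K` from `F' = p K + N = L + K` gives `E' = (L - N / p) / (p - 1)`, which is the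
asserted formula (`IsTransportFamily.hasDerivWithinAt_energy`).

The potential is not an admissible test function on a noncompact manifold. It is multiplied by
smooth cutoff functions `χ_k → 1` with `|∇χ_k| ≤ 3 / (k + 1)` (`exists_cutoff_seq`), and the errors
are absorbed by the growth condition. Such functions exist because the manifold is complete: closed
balls are compact (`isCompact_closedBall_of_complete`), and Lipschitz functions with compact support
can be smoothed with control of the gradient (`exists_smooth_approx`), by mollification in charts in
which the metric is almost constant.

For the Euler–Lagrange equation the function `H = ∂_tφ + |∇φ|^p / p` is continuous and the volume
charges open sets, so product densities `a(t) b(x)` suffice: if `H` is orthogonal to all of them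
then `H = 0`, and if it is orthogonal to those with `∫ b = 0` then `H` depends on `t` only. In the
second case subtracting a primitive of `H` from `φ` produces a solution, and `∫ H ∂_sρ = 0` at each
time because the mass of `ρ` does not depend on `s`.
-/


namespace PWasserstein

/-! ### Charts, the metric in coordinates and the Riemannian volume -/

section Volume

open Topology

variable (n : ℕ) {M : Type*} [MetricSpace M] [ChartedSpace (EuclideanSpace ℝ (Fin n)) M]
  [IsManifold (𝓡 n) ∞ M]

theorem contMDiffOn_chart_symm (c : M) :
    ContMDiffOn 𝓘(ℝ, EuclideanSpace ℝ (Fin n)) (𝓡 n) ∞ (extChartAt (𝓡 n) c).symm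
      (extChartAt (𝓡 n) c).target :=
  contMDiffOn_extChartAt_symm c

theorem mdifferentiableAt_chart_symm (c : M) {y : EuclideanSpace ℝ (Fin n)}
    (hy : y ∈ (extChartAt (𝓡 n) c).target) :
    MDifferentiableAt (𝓡 n) (𝓡 n) (extChartAt (𝓡 n) c).symm y :=
  ((contMDiffOn_chart_symm n c).contMDiffAt
    ((isOpen_extChartAt_target (I := 𝓡 n) c).mem_nhds hy)).mdifferentiableAt (by simp)

theorem isInvertible_mfderiv_chart_symm (c : M) {y : EuclideanSpace ℝ (Fin n)}
    (hy : y ∈ (extChartAt (𝓡 n) c).target) :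
    (mfderiv (𝓡 n) (𝓡 n) (extChartAt (𝓡 n) c).symm y).IsInvertible := by
  have h := isInvertible_mfderivWithin_extChartAt_symm (I := 𝓡 n) hy
  have : range (𝓡 n) = univ := by simp
  rw [this] at h
  rwa [mfderivWithin_univ] at h

variable [RiemannianBundle (fun x : M => TangentSpace (𝓡 n) x)]

omit [RiemannianBundle (fun x : M => TangentSpace (𝓡 n) x)] in
theorem linearIndependent_coordVec (c : M) {y : EuclideanSpace ℝ (Fin n)}
    (hy : y ∈ (extChartAt (𝓡 n) c).target) :
    LinearIndependent ℝ (coordVec n c y) := by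
  have h0 : LinearIndependent ℝ fun i : Fin n => (EuclideanSpace.single i (1 : ℝ) :
      EuclideanSpace ℝ (Fin n)) := by
    have h : (fun i : Fin n => (EuclideanSpace.single i (1 : ℝ) : EuclideanSpace ℝ (Fin n))) =
        EuclideanSpace.basisFun (Fin n) ℝ := by
      funext i
      simp
    rw [h]
    exact (EuclideanSpace.basisFun (Fin n) ℝ).orthonormal.linearIndependent
  have h0' : LinearIndependent (M := TangentSpace (𝓡 n) y) ℝ
      fun i : Fin n => (EuclideanSpace.single i (1 : ℝ) : EuclideanSpace ℝ (Fin n)) := h0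
  exact h0'.map' (mfderiv (𝓡 n) (𝓡 n) (extChartAt (𝓡 n) c).symm y).toLinearMap
    (LinearMap.ker_eq_bot.2 (isInvertible_mfderiv_chart_symm n c hy).injective)

theorem metricMatrix_posDef (c : M) {y : EuclideanSpace ℝ (Fin n)}
    (hy : y ∈ (extChartAt (𝓡 n) c).target) : (metricMatrix n c y).PosDef :=
  Matrix.posDef_gram_of_linearIndependent (linearIndependent_coordVec n c hy)

theorem metricMatrix_det_pos (c : M) {y : EuclideanSpace ℝ (Fin n)}
    (hy : y ∈ (extChartAt (𝓡 n) c).target) : 0 < (metricMatrix n c y).det :=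
  (metricMatrix_posDef n c hy).det_pos

omit [RiemannianBundle (fun x : M => TangentSpace (𝓡 n) x)] in
theorem continuousOn_coordVec (c : M) (i : Fin n) :
    ContinuousOn (fun y => (⟨(extChartAt (𝓡 n) c).symm y, coordVec n c y i⟩ :
      TotalSpace (EuclideanSpace ℝ (Fin n)) (fun x : M => TangentSpace (𝓡 n) x)))
      (extChartAt (𝓡 n) c).target := by
  have h := (contMDiffOn_chart_symm n c).continuousOn_tangentMapWithin (by simp)
    (isOpen_extChartAt_target (I := 𝓡 n) c).uniqueMDiffOn
  have h2 : Continuous (fun y : EuclideanSpace ℝ (Fin n) =>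
      (⟨y, EuclideanSpace.single i (1 : ℝ)⟩ :
        TangentBundle 𝓘(ℝ, EuclideanSpace ℝ (Fin n)) (EuclideanSpace ℝ (Fin n)))) :=
    (tangentBundleModelSpaceHomeomorph (𝓡 n)).symm.continuous.comp
      (by fun_prop : Continuous (fun y : EuclideanSpace ℝ (Fin n) =>
        (⟨y, EuclideanSpace.single i (1 : ℝ)⟩ : ModelProd _ _)))
  refine (h.comp h2.continuousOn (fun y hy => hy)).congr ?_
  intro y hy
  simp only [Function.comp, tangentMapWithin, coordVec]
  rw [mfderivWithin_of_isOpen (isOpen_extChartAt_target (I := 𝓡 n) c) hy]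

theorem isContinuousRiemannianBundle
    [IsContMDiffRiemannianBundle (𝓡 n) ∞ (EuclideanSpace ℝ (Fin n))
      (fun x : M => TangentSpace (𝓡 n) x)] :
    IsContinuousRiemannianBundle (EuclideanSpace ℝ (Fin n))
      (fun x : M => TangentSpace (𝓡 n) x) := by
  obtain ⟨g, hg, h⟩ := IsContMDiffRiemannianBundle.exists_contMDiff (IB := 𝓡 n) (n := ∞)
    (F := EuclideanSpace ℝ (Fin n)) (E := fun x : M => TangentSpace (𝓡 n) x)
  exact ⟨g, hg.continuous, h⟩

variable [IsContinuousRiemannianBundle (EuclideanSpace ℝ (Fin n))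
      (fun x : M => TangentSpace (𝓡 n) x)]

theorem continuousOn_metricMatrix (c : M) :
    ContinuousOn (metricMatrix n c) (extChartAt (𝓡 n) c).target := by
  refine continuousOn_pi.2 fun i => continuousOn_pi.2 fun j => ?_
  exact (continuousOn_coordVec n c i).inner_bundle (continuousOn_coordVec n c j)

theorem continuousOn_metricMatrix_inv (c : M) :
    ContinuousOn (fun y => (metricMatrix n c y)⁻¹) (extChartAt (𝓡 n) c).target := by
  have h : ContinuousOn (fun y => (metricMatrix n c y).det⁻¹ • (metricMatrix n c y).adjugate)
      (extChartAt (𝓡 n) c).target := by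
    have h1 : ContinuousOn (fun y => (metricMatrix n c y).det) (extChartAt (𝓡 n) c).target :=
      (continuous_id.matrix_det).comp_continuousOn (continuousOn_metricMatrix n c)
    refine (h1.inv₀ fun y hy => (metricMatrix_det_pos n c hy).ne').smul ?_
    exact (continuous_id.matrix_adjugate).comp_continuousOn (continuousOn_metricMatrix n c)
  refine h.congr fun y hy => ?_
  rw [Matrix.inv_def, Ring.inverse_eq_inv']

variable [MeasurableSpace M] [BorelSpace M]

omit
  [IsContinuousRiemannianBundle (EuclideanSpace ℝ (Fin n)) (fun x : M => TangentSpace (𝓡 n) x)] in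
theorem aemeasurable_chart_symm (c : M) :
    AEMeasurable (extChartAt (𝓡 n) c).symm
      ((volume.restrict (extChartAt (𝓡 n) c).target).withDensity
        fun y => ENNReal.ofReal (Real.sqrt (metricMatrix n c y).det)) :=
  ((contMDiffOn_chart_symm n c).continuousOn.aemeasurable
    (isOpen_extChartAt_target (I := 𝓡 n) c).measurableSet).mono_ac
      (withDensity_absolutelyContinuous _ _)

omit [MeasurableSpace M] [BorelSpace M] in
theorem continuousOn_sqrt_det (c : M) :
    ContinuousOn (fun y => Real.sqrt (metricMatrix n c y).det) (extChartAt (𝓡 n) c).target :=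
  ((continuous_id.matrix_det).comp_continuousOn (continuousOn_metricMatrix n c)).sqrt

/-- The chart volume is finite near the points of the chart domain; it need not be locally finite at
the boundary of that domain, where only the partition of unity keeps the total volume finite. -/
theorem exists_nhds_chartVolume_lt_top (c x : M) (hx : x ∈ (extChartAt (𝓡 n) c).source) :
    ∃ N ∈ 𝓝 x, chartVolume n c N < ⊤ := by
  set e := extChartAt (𝓡 n) c with he
  obtain ⟨K, hK, hxK, hKT⟩ := exists_compact_subset
    (isOpen_extChartAt_target (I := 𝓡 n) c) (e.map_source hx)
  have hNK : e.symm '' K = e.source ∩ e ⁻¹' K := by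
    rw [e.symm_image_eq_source_inter_preimage hKT]
  refine ⟨e.symm '' K, ?_, ?_⟩
  · rw [hNK]
    exact Filter.inter_mem ((isOpen_extChartAt_source (I := 𝓡 n) c).mem_nhds hx)
      ((continuousAt_extChartAt' (I := 𝓡 n) hx).preimage_mem_nhds
        (mem_interior_iff_mem_nhds.1 hxK))
  · have hm : MeasurableSet (e.symm '' K) :=
      (hK.image_of_continuousOn ((contMDiffOn_chart_symm n c).continuousOn.mono hKT)).measurableSet
    have hint : IntegrableOn (fun y => Real.sqrt (metricMatrix n c y).det) K :=
      ((continuousOn_sqrt_det n c).mono hKT).integrableOn_compact hK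
    have hsub : e.symm ⁻¹' (e.symm '' K) ∩ e.target ⊆ K := by
      rintro y ⟨⟨z, hz, hzy⟩, hy⟩
      rwa [← e.symm.injOn (hKT hz) hy hzy]
    rw [chartVolume, Measure.map_apply_of_aemeasurable (aemeasurable_chart_symm n c) hm]
    refine lt_of_le_of_lt ?_ hint.lintegral_lt_top
    rw [withDensity_apply', Measure.restrict_restrict'
      (isOpen_extChartAt_target (I := 𝓡 n) c).measurableSet]
    exact lintegral_mono_set hsub

variable [SigmaCompactSpace M]

omit [RiemannianBundle (fun x : M => TangentSpace (𝓡 n) x)]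
  [IsContinuousRiemannianBundle (EuclideanSpace ℝ (Fin n)) (fun x : M => TangentSpace (𝓡 n) x)] in
theorem measurable_chartPartition (c : M) :
    Measurable fun x => ENNReal.ofReal (chartPartition n M c x) :=
  (chartPartition n M c).contMDiff.continuous.measurable.ennreal_ofReal

instance isLocallyFiniteMeasure_riemannianVolume :
    IsLocallyFiniteMeasure (riemannianVolume n M) := by
  refine ⟨fun x => ?_⟩
  obtain ⟨t, ht, hfin⟩ := (chartPartition n M).locallyFinite x
  have hsubord : (chartPartition n M).IsSubordinate fun c : M => (chartAt _ c).source :=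
    (SmoothPartitionOfUnity.exists_isSubordinate_chartAt_source (𝓡 n) M).choose_spec
  have key : ∀ c : M, ∃ N ∈ 𝓝 x, ((chartVolume n c).withDensity
      fun x => ENNReal.ofReal (chartPartition n M c x)) N < ⊤ := by
    intro c
    by_cases hx : x ∈ tsupport (chartPartition n M c)
    · obtain ⟨N, hN, hlt⟩ := exists_nhds_chartVolume_lt_top n c x
        (by simpa using hsubord c hx)
      refine ⟨N, hN, lt_of_le_of_lt ?_ hlt⟩
      have : (chartVolume n c).withDensity (fun x => ENNReal.ofReal (chartPartition n M c x)) ≤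
          (chartVolume n c).withDensity 1 := by
        refine withDensity_mono (Filter.Eventually.of_forall fun y => ?_)
        simpa using (chartPartition n M).le_one c y
      rw [withDensity_one] at this
      exact this N
    · refine ⟨(tsupport (chartPartition n M c))ᶜ,
        (isClosed_tsupport _).isOpen_compl.mem_nhds hx, ?_⟩
      rw [(withDensity_apply_eq_zero' (measurable_chartPartition n c).aemeasurable).2]
      · simp
      · convert measure_empty (μ := chartVolume n c)
        refine eq_empty_of_forall_notMem fun y hy => hy.2 (subset_tsupport _ fun h => hy.1 ?_)
        rw [h, ENNReal.ofReal_zero]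
  choose N hN hlt using key
  set A := interior (t ∩ ⋂ c ∈ hfin.toFinset, N c) with hA
  have hAsub : A ⊆ t ∩ ⋂ c ∈ hfin.toFinset, N c := interior_subset
  refine ⟨A, interior_mem_nhds.2 (Filter.inter_mem ht
    ((Filter.biInter_finset_mem _).2 fun c _ => hN c)), ?_⟩
  rw [riemannianVolume, Measure.sum_apply _ isOpen_interior.measurableSet,
    tsum_eq_sum (s := hfin.toFinset)]
  · refine ENNReal.sum_lt_top.2 fun c hc => lt_of_le_of_lt (measure_mono ?_) (hlt c)
    exact fun y hy => mem_iInter₂.1 (hAsub hy).2 c hc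
  · intro c hc
    rw [withDensity_apply_eq_zero' (measurable_chartPartition n c).aemeasurable]
    convert measure_empty (μ := chartVolume n c)
    refine eq_empty_of_forall_notMem fun y hy => hc ?_
    rw [Finite.mem_toFinset]
    refine ⟨y, fun h => hy.1 ?_, (hAsub hy.2).1⟩
    rw [h, ENNReal.ofReal_zero]

instance isOpenPosMeasure_riemannianVolume :
    (riemannianVolume n M).IsOpenPosMeasure := by
  refine ⟨fun U hU ⟨x, hx⟩ h0 => ?_⟩
  have hsubord : (chartPartition n M).IsSubordinate fun c : M => (chartAt _ c).source :=
    (SmoothPartitionOfUnity.exists_isSubordinate_chartAt_source (𝓡 n) M).choose_spec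
  obtain ⟨c, hc⟩ : ∃ c, 0 < chartPartition n M c x :=
    (chartPartition n M).exists_pos_of_mem (mem_univ x)
  have hxs : x ∈ (extChartAt (𝓡 n) c).source := by
    simpa using hsubord c (subset_tsupport _ hc.ne')
  have h1 := (Measure.le_sum (fun c : M => (chartVolume n c).withDensity
    fun x => ENNReal.ofReal (chartPartition n M c x)) c) U
  have h2 := (withDensity_apply_eq_zero' (measurable_chartPartition n c).aemeasurable).1
    (le_antisymm (h1.trans h0.le) bot_le)
  set W := {x | ENNReal.ofReal (chartPartition n M c x) ≠ 0} ∩ U with hW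
  have hWo : IsOpen W := by
    refine IsOpen.inter ?_ hU
    simpa using isOpen_lt continuous_const (chartPartition n M c).contMDiff.continuous
  rw [chartVolume, Measure.map_apply_of_aemeasurable (aemeasurable_chart_symm n c)
    hWo.measurableSet, withDensity_apply_eq_zero'] at h2
  · have ho : IsOpen ((extChartAt (𝓡 n) c).target ∩ (extChartAt (𝓡 n) c).symm ⁻¹' W) :=
      (contMDiffOn_chart_symm n c).continuousOn.isOpen_inter_preimage
        (isOpen_extChartAt_target (I := 𝓡 n) c) hWo
    refine (ho.measure_pos volume ⟨extChartAt (𝓡 n) c x,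
      (extChartAt (𝓡 n) c).map_source hxs, ?_⟩).ne' (le_antisymm ?_ bot_le)
    · rw [mem_preimage, (extChartAt (𝓡 n) c).left_inv hxs]
      refine ⟨?_, hx⟩
      simpa using hc
    · rw [Measure.restrict_apply' (isOpen_extChartAt_target (I := 𝓡 n) c).measurableSet] at h2
      refine (measure_mono ?_).trans h2.le
      rintro y ⟨hy, hyW⟩
      refine ⟨⟨?_, hyW⟩, hy⟩
      simpa using metricMatrix_det_pos n c hy
  · exact ((continuousOn_sqrt_det n c).aemeasurable
      (isOpen_extChartAt_target (I := 𝓡 n) c).measurableSet).ennreal_ofReal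

end Volume

/-! ### The gradient in coordinates -/

section Gradient

open Topology Matrix

variable (n : ℕ) {M : Type*} [MetricSpace M] [ChartedSpace (EuclideanSpace ℝ (Fin n)) M]
  [RiemannianBundle (fun x : M => TangentSpace (𝓡 n) x)]

theorem grad_eq_of_inner {f : M → ℝ} {x : M} {w : TangentSpace (𝓡 n) x}
    (h : ∀ v, inner ℝ w v = differential n f x v) : grad n f x = w :=
  ext_inner_right ℝ fun v => by rw [inner_grad, h]

theorem norm_grad (f : M → ℝ) (x : M) : ‖grad n f x‖ = ‖differential n f x‖ :=
  haveI : FiniteDimensional ℝ (TangentSpace (𝓡 n) x) :=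
    inferInstanceAs (FiniteDimensional ℝ (EuclideanSpace ℝ (Fin n)))
  haveI : CompleteSpace (TangentSpace (𝓡 n) x) := FiniteDimensional.complete ℝ _
  (InnerProductSpace.toDual ℝ (TangentSpace (𝓡 n) x)).symm.norm_map _

theorem grad_sub_const {f : M → ℝ} {x : M} (hf : MDifferentiableAt (𝓡 n) 𝓘(ℝ, ℝ) f x) (k : ℝ) :
    grad n (fun y => f y - k) x = grad n f x := by
  refine grad_eq_of_inner n fun v => ?_
  have h := (hf.hasMFDerivAt.sub (hasMFDerivAt_const k x)).mfderiv
  rw [inner_grad]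
  exact (congrArg (fun L => L v) (h.trans (sub_zero _))).symm

theorem grad_mul {f g : M → ℝ} {x : M} (hf : MDifferentiableAt (𝓡 n) 𝓘(ℝ, ℝ) f x)
    (hg : MDifferentiableAt (𝓡 n) 𝓘(ℝ, ℝ) g x) :
    grad n (fun y => f y * g y) x = f x • grad n g x + g x • grad n f x := by
  refine grad_eq_of_inner n fun v => ?_
  have h := (hf.hasMFDerivAt.mul hg.hasMFDerivAt).mfderiv
  rw [inner_add_left, real_inner_smul_left, real_inner_smul_left, inner_grad, inner_grad]
  exact (congrArg (fun L => L v) h).symm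

theorem grad_eq_zero_of_eventuallyEq_const {f : M → ℝ} {x : M} {k : ℝ} (h : f =ᶠ[𝓝 x] fun _ => k) :
    grad n f x = 0 := by
  refine grad_eq_of_inner n fun v => ?_
  have := h.mfderiv_eq (I := 𝓡 n) (I' := 𝓘(ℝ, ℝ))
  rw [mfderiv_const] at this
  rw [differential, this, inner_zero_left]
  rfl

theorem grad_eq_zero_of_notMem_tsupport {f : M → ℝ} {x : M} (h : x ∉ tsupport f) :
    grad n f x = 0 :=
  grad_eq_zero_of_eventuallyEq_const n (notMem_tsupport_iff_eventuallyEq.1 h)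

theorem grad_add {f g : M → ℝ} {x : M} (hf : MDifferentiableAt (𝓡 n) 𝓘(ℝ, ℝ) f x)
    (hg : MDifferentiableAt (𝓡 n) 𝓘(ℝ, ℝ) g x) :
    grad n (fun y => f y + g y) x = grad n f x + grad n g x := by
  refine grad_eq_of_inner n fun v => ?_
  have h := (hf.hasMFDerivAt.add hg.hasMFDerivAt).mfderiv
  rw [inner_add_left, inner_grad, inner_grad]
  exact (congrArg (fun L => L v) h).symm

theorem grad_sum {ι : Type*} (s : Finset ι) {f : ι → M → ℝ} {x : M}
    (hf : ∀ i ∈ s, ContMDiff (𝓡 n) 𝓘(ℝ, ℝ) ∞ (f i)) :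
    grad n (fun y => ∑ i ∈ s, f i y) x = ∑ i ∈ s, grad n (f i) x := by
  classical
  induction s using Finset.induction_on with
  | empty =>
    simp only [Finset.sum_empty]
    exact grad_eq_zero_of_eventuallyEq_const n (Filter.EventuallyEq.refl _ _)
  | insert i s hi ih =>
    simp only [Finset.sum_insert hi]
    rw [grad_add n ((hf i (Finset.mem_insert_self i s)).mdifferentiableAt (by simp)),
      ih fun j hj => hf j (Finset.mem_insert_of_mem hj)]
    exact (contMDiff_finsetSum fun j hj => hf j (Finset.mem_insert_of_mem hj)).mdifferentiableAt
      (by simp)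

variable [IsManifold (𝓡 n) ∞ M]

/-- The basis of coordinate vectors of the tangent space at a point of a chart domain. -/
noncomputable def coordBasis (c : M) {y : EuclideanSpace ℝ (Fin n)}
    (hy : y ∈ (extChartAt (𝓡 n) c).target) :
    Module.Basis (Fin n) ℝ (TangentSpace (𝓡 n) ((extChartAt (𝓡 n) c).symm y)) :=
  haveI : FiniteDimensional ℝ (TangentSpace (𝓡 n) ((extChartAt (𝓡 n) c).symm y)) :=
    inferInstanceAs (FiniteDimensional ℝ (EuclideanSpace ℝ (Fin n)))
  Module.Basis.mk (linearIndependent_coordVec n c hy)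
    ((linearIndependent_coordVec n c hy).span_eq_top_of_card_eq_finrank'
      (by
        rw [Fintype.card_fin]
        exact finrank_euclideanSpace_fin.symm)).ge

omit [RiemannianBundle (fun x : M => TangentSpace (𝓡 n) x)] in
theorem coordBasis_apply (c : M) {y : EuclideanSpace ℝ (Fin n)}
    (hy : y ∈ (extChartAt (𝓡 n) c).target) (i : Fin n) :
    coordBasis n c hy i = coordVec n c y i :=
  Module.Basis.mk_apply _ _ i

/-- The partial derivatives `∂f/∂yᵢ` in the chart at `c`. -/
noncomputable def partials (c : M) (f : M → ℝ) (y : EuclideanSpace ℝ (Fin n)) : Fin n → ℝ :=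
  fun i => differential n f ((extChartAt (𝓡 n) c).symm y) (coordVec n c y i)

omit [RiemannianBundle (fun x : M => TangentSpace (𝓡 n) x)] in
theorem partials_eq_fderiv (c : M) {f : M → ℝ} {y : EuclideanSpace ℝ (Fin n)}
    (hy : y ∈ (extChartAt (𝓡 n) c).target)
    (hf : MDifferentiableAt (𝓡 n) 𝓘(ℝ, ℝ) f ((extChartAt (𝓡 n) c).symm y)) (i : Fin n) :
    partials n c f y i =
      fderiv ℝ (fun y => f ((extChartAt (𝓡 n) c).symm y)) y (EuclideanSpace.single i 1) := by
  have h := mfderiv_comp y hf (mdifferentiableAt_chart_symm n c hy)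
  rw [mfderiv_eq_fderiv] at h
  exact (congrArg (fun L => L (EuclideanSpace.single i (1 : ℝ))) h).symm

/-- `∇f = ∑ᵢⱼ gⁱʲ ∂ⱼf ∂ᵢ`. -/
theorem grad_eq_sum (c : M) (f : M → ℝ) {y : EuclideanSpace ℝ (Fin n)}
    (hy : y ∈ (extChartAt (𝓡 n) c).target) :
    grad n f ((extChartAt (𝓡 n) c).symm y) =
      ∑ i, ((metricMatrix n c y)⁻¹ *ᵥ partials n c f y) i • coordVec n c y i := by
  refine InnerProductSpace.ext_inner_right_basis (𝕜 := ℝ) (coordBasis n c hy) fun j => ?_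
  rw [coordBasis_apply, inner_grad, sum_inner]
  have hdet : IsUnit (metricMatrix n c y).det := (metricMatrix_det_pos n c hy).ne'.isUnit
  have h : (metricMatrix n c y *ᵥ ((metricMatrix n c y)⁻¹ *ᵥ partials n c f y)) j =
      partials n c f y j := by
    rw [mulVec_mulVec, mul_nonsing_inv _ hdet, one_mulVec]
  rw [← partials, ← h]
  simp only [mulVec, dotProduct, real_inner_smul_left]
  refine Finset.sum_congr rfl fun i _ => ?_
  rw [mul_comm, metricMatrix, of_apply, real_inner_comm]

theorem inner_grad_grad_eq (c : M) (f g : M → ℝ) {y : EuclideanSpace ℝ (Fin n)}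
    (hy : y ∈ (extChartAt (𝓡 n) c).target) :
    inner ℝ (grad n f ((extChartAt (𝓡 n) c).symm y)) (grad n g ((extChartAt (𝓡 n) c).symm y)) =
      ((metricMatrix n c y)⁻¹ *ᵥ partials n c f y) ⬝ᵥ partials n c g y := by
  rw [grad_eq_sum n c f hy, sum_inner]
  refine Finset.sum_congr rfl fun i _ => ?_
  rw [real_inner_smul_left, real_inner_comm, inner_grad]
  rfl

end Gradient

/-! ### Smooth families read in charts -/

section SmoothFamilies

open Topology Matrix

variable (n : ℕ) {M : Type*} [MetricSpace M] [ChartedSpace (EuclideanSpace ℝ (Fin n)) M]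

/-- A family `u : S × [0,1] → C^∞(M)` read in the chart at `c`. -/
noncomputable def localForm (u : ℝ → ℝ → M → ℝ) (c : M)
    (z : (ℝ × ℝ) × EuclideanSpace ℝ (Fin n)) : ℝ :=
  u z.1.1 z.1.2 ((extChartAt (𝓡 n) c).symm z.2)

/-- The domain `S × [0,1] × e(U)` on which a family is read in the chart `e : U → ℝⁿ` at `c`. -/
def localDomain (S : Set ℝ) (c : M) : Set ((ℝ × ℝ) × EuclideanSpace ℝ (Fin n)) :=
  (S ×ˢ Icc (0 : ℝ) 1) ×ˢ (extChartAt (𝓡 n) c).target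

theorem uniqueDiffOn_localDomain {a b : ℝ} (hab : a < b) (c : M) :
    UniqueDiffOn ℝ (localDomain n (Icc a b) c) :=
  ((uniqueDiffOn_Icc hab).prod (uniqueDiffOn_Icc zero_lt_one)).prod
    (isOpen_extChartAt_target (I := 𝓡 n) c).uniqueDiffOn

/-- This makes second derivatives symmetric up to the boundary of the parameter domain. -/
theorem localDomain_subset_closure_interior {a b : ℝ} (hab : a < b) (c : M) :
    localDomain n (Icc a b) c ⊆ closure (interior (localDomain n (Icc a b) c)) := by
  rw [localDomain, interior_prod_eq, interior_prod_eq, closure_prod_eq, closure_prod_eq,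
    interior_Icc, interior_Icc, closure_Ioo hab.ne, closure_Ioo zero_lt_one.ne,
    (isOpen_extChartAt_target (I := 𝓡 n) c).interior_eq]
  exact prod_mono le_rfl subset_closure

variable [IsManifold (𝓡 n) ∞ M]

theorem IsSmoothFamily.contDiffOn_localForm {S : Set ℝ} {u : ℝ → ℝ → M → ℝ}
    (hu : IsSmoothFamily n S u) (c : M) :
    ContDiffOn ℝ ∞ (localForm n u c) (localDomain n S c) := by
  have h1 : ContMDiffOn 𝓘(ℝ, (ℝ × ℝ) × EuclideanSpace ℝ (Fin n)) (𝓘(ℝ, ℝ × ℝ).prod (𝓡 n)) ∞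
      (fun z : (ℝ × ℝ) × EuclideanSpace ℝ (Fin n) => (z.1, (extChartAt (𝓡 n) c).symm z.2))
      (localDomain n S c) :=
    (contDiff_fst.contMDiff.contMDiffOn).prodMk
      ((contMDiffOn_chart_symm n c).comp contDiff_snd.contMDiff.contMDiffOn fun z hz => hz.2)
  exact (hu.comp h1 fun z hz => ⟨hz.1, mem_univ _⟩).contDiffOn

theorem isSmoothFamily_of_localForm {S : Set ℝ} {u : ℝ → ℝ → M → ℝ}
    (hu : ∀ c : M, ContDiffOn ℝ ∞ (localForm n u c) (localDomain n S c)) :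
    IsSmoothFamily n S u := by
  rintro ⟨p, x⟩ ⟨hp, -⟩
  have h1 : ContMDiffOn (𝓘(ℝ, ℝ × ℝ).prod (𝓡 n)) 𝓘(ℝ, (ℝ × ℝ) × EuclideanSpace ℝ (Fin n)) ∞
      (fun z : (ℝ × ℝ) × M => (z.1, extChartAt (𝓡 n) x z.2))
      ((S ×ˢ Icc (0 : ℝ) 1) ×ˢ (extChartAt (𝓡 n) x).source) := by
    have h1 : ContMDiff (𝓘(ℝ, ℝ × ℝ).prod (𝓡 n)) 𝓘(ℝ, ℝ × ℝ) ∞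
        (Prod.fst : (ℝ × ℝ) × M → ℝ × ℝ) :=
      contMDiff_fst
    have h2 : ContMDiff (𝓘(ℝ, ℝ × ℝ).prod (𝓡 n)) (𝓡 n) ∞ (Prod.snd : (ℝ × ℝ) × M → M) :=
      contMDiff_snd
    refine h1.contMDiffOn.prodMk_space
      ((contMDiffOn_extChartAt (I := 𝓡 n) (n := ∞) (x := x)).comp h2.contMDiffOn ?_)
    intro z hz
    simpa using hz.2
  have h2 := (hu x).contMDiffOn.comp h1 fun z hz => ⟨hz.1, (extChartAt (𝓡 n) x).map_source hz.2⟩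
  have hx : (p, x) ∈ (S ×ˢ Icc (0 : ℝ) 1) ×ˢ (extChartAt (𝓡 n) x).source :=
    ⟨hp, mem_extChartAt_source x⟩
  have h3 : ContMDiffOn (𝓘(ℝ, ℝ × ℝ).prod (𝓡 n)) 𝓘(ℝ, ℝ) ∞
      (fun z : (ℝ × ℝ) × M => u z.1.1 z.1.2 z.2)
      ((S ×ˢ Icc (0 : ℝ) 1) ×ˢ (extChartAt (𝓡 n) x).source) := by
    refine h2.congr fun z hz => ?_
    simp only [Function.comp, localForm, (extChartAt (𝓡 n) x).left_inv hz.2]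
  refine (h3 _ hx).mono_of_mem_nhdsWithin ?_
  refine mem_nhdsWithin.2 ⟨univ ×ˢ (extChartAt (𝓡 n) x).source,
    isOpen_univ.prod (isOpen_extChartAt_source (I := 𝓡 n) x), ⟨mem_univ _, hx.2⟩, ?_⟩
  rintro z ⟨hz1, hz2⟩
  exact ⟨hz2.1, hz1.2⟩

omit [IsManifold (𝓡 n) ∞ M] in
theorem isSmoothFamily_const (S : Set ℝ) {χ : M → ℝ} (hχ : ContMDiff (𝓡 n) 𝓘(ℝ, ℝ) ∞ χ) :
    IsSmoothFamily n S fun _ _ => χ :=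
  (hχ.comp contMDiff_snd).contMDiffOn

namespace IsSmoothFamily

variable {n} {a b : ℝ} {u v : ℝ → ℝ → M → ℝ}

omit [IsManifold (𝓡 n) ∞ M] in
theorem contMDiff_slice {S : Set ℝ} (hu : IsSmoothFamily n S u) {s t : ℝ} (hs : s ∈ S)
    (ht : t ∈ Icc (0 : ℝ) 1) : ContMDiff (𝓡 n) 𝓘(ℝ, ℝ) ∞ (u s t) := by
  rw [← contMDiffOn_univ]
  have h : ContMDiffOn (𝓡 n) (𝓘(ℝ, ℝ × ℝ).prod (𝓡 n)) ∞ (fun x : M => ((s, t), x)) univ :=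
    contMDiffOn_const.prodMk contMDiffOn_id
  unfold IsSmoothFamily at hu
  exact hu.comp h fun x _ => ⟨⟨hs, ht⟩, mem_univ x⟩

omit [IsManifold (𝓡 n) ∞ M] in
theorem mdifferentiableAt {S : Set ℝ} (hu : IsSmoothFamily n S u) {s t : ℝ} (hs : s ∈ S)
    (ht : t ∈ Icc (0 : ℝ) 1) (x : M) : MDifferentiableAt (𝓡 n) 𝓘(ℝ, ℝ) (u s t) x :=
  (hu.contMDiff_slice hs ht).mdifferentiableAt (by simp)

omit [IsManifold (𝓡 n) ∞ M] in
theorem continuousOn {S : Set ℝ} (hu : IsSmoothFamily n S u) {s : ℝ} (hs : s ∈ S) :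
    ContinuousOn (fun z : ℝ × M => u s z.1 z.2) (Icc (0 : ℝ) 1 ×ˢ (univ : Set M)) := by
  have h := ContMDiffOn.continuousOn hu
  exact h.comp (f := fun z : ℝ × M => ((s, z.1), z.2)) (by fun_prop) fun z hz => ⟨⟨hs, hz.1⟩, hz.2⟩

theorem hasFDerivWithinAt (hu : IsSmoothFamily n (Icc a b) u) (c : M)
    {z : (ℝ × ℝ) × EuclideanSpace ℝ (Fin n)} (hz : z ∈ localDomain n (Icc a b) c) :
    HasFDerivWithinAt (localForm n u c)
      (fderivWithin ℝ (localForm n u c) (localDomain n (Icc a b) c) z)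
      (localDomain n (Icc a b) c) z :=
  ((hu.contDiffOn_localForm n c).differentiableOn (by simp) z hz).hasFDerivWithinAt

theorem hasDerivWithinAt_ds_localForm (hu : IsSmoothFamily n (Icc a b) u) (c : M)
    {s t : ℝ} {y : EuclideanSpace ℝ (Fin n)} (hs : s ∈ Icc a b) (ht : t ∈ Icc (0 : ℝ) 1)
    (hy : y ∈ (extChartAt (𝓡 n) c).target) :
    HasDerivWithinAt (fun s => u s t ((extChartAt (𝓡 n) c).symm y))
      (fderivWithin ℝ (localForm n u c) (localDomain n (Icc a b) c) ((s, t), y) ((1, 0), 0))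
      (Icc a b) s := by
  have h := hu.hasFDerivWithinAt c (z := ((s, t), y)) ⟨⟨hs, ht⟩, hy⟩
  exact h.comp_hasDerivWithinAt s (f := fun s => ((s, t), y))
    (((hasDerivWithinAt_id s _).prodMk (hasDerivWithinAt_const s _ t)).prodMk
      (hasDerivWithinAt_const s _ y)) fun s' hs' => ⟨⟨hs', ht⟩, hy⟩

theorem hasDerivWithinAt_dt_localForm (hu : IsSmoothFamily n (Icc a b) u) (c : M)
    {s t : ℝ} {y : EuclideanSpace ℝ (Fin n)} (hs : s ∈ Icc a b) (ht : t ∈ Icc (0 : ℝ) 1)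
    (hy : y ∈ (extChartAt (𝓡 n) c).target) :
    HasDerivWithinAt (fun t => u s t ((extChartAt (𝓡 n) c).symm y))
      (fderivWithin ℝ (localForm n u c) (localDomain n (Icc a b) c) ((s, t), y) ((0, 1), 0))
      (Icc (0 : ℝ) 1) t := by
  have h := hu.hasFDerivWithinAt c (z := ((s, t), y)) ⟨⟨hs, ht⟩, hy⟩
  exact h.comp_hasDerivWithinAt t (f := fun t => ((s, t), y))
    (((hasDerivWithinAt_const t _ s).prodMk (hasDerivWithinAt_id t _)).prodMk
      (hasDerivWithinAt_const t _ y)) fun t' ht' => ⟨⟨hs, ht'⟩, hy⟩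

theorem hasDerivWithinAt_ds (hu : IsSmoothFamily n (Icc a b) u)
    {s t : ℝ} (hs : s ∈ Icc a b) (ht : t ∈ Icc (0 : ℝ) 1) (x : M) :
    HasDerivWithinAt (fun s => u s t x) (ds (Icc a b) u s t x) (Icc a b) s := by
  have h := hu.hasDerivWithinAt_ds_localForm x hs ht (mem_extChartAt_target x)
  rw [extChartAt_to_inv] at h
  exact h.differentiableWithinAt.hasDerivWithinAt

theorem hasDerivWithinAt_dt (hu : IsSmoothFamily n (Icc a b) u)
    {s t : ℝ} (hs : s ∈ Icc a b) (ht : t ∈ Icc (0 : ℝ) 1) (x : M) :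
    HasDerivWithinAt (fun t => u s t x) (dt (u s) t x) (Icc (0 : ℝ) 1) t := by
  have h := hu.hasDerivWithinAt_dt_localForm x hs ht (mem_extChartAt_target x)
  rw [extChartAt_to_inv] at h
  exact h.differentiableWithinAt.hasDerivWithinAt

theorem localForm_ds (hab : a < b) (hu : IsSmoothFamily n (Icc a b) u) (c : M)
    {z : (ℝ × ℝ) × EuclideanSpace ℝ (Fin n)} (hz : z ∈ localDomain n (Icc a b) c) :
    localForm n (ds (Icc a b) u) c z =
      fderivWithin ℝ (localForm n u c) (localDomain n (Icc a b) c) z ((1, 0), 0) :=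
  (hu.hasDerivWithinAt_ds_localForm c hz.1.1 hz.1.2 hz.2).derivWithin
    (uniqueDiffOn_Icc hab _ hz.1.1)

theorem localForm_dt (hu : IsSmoothFamily n (Icc a b) u) (c : M)
    {z : (ℝ × ℝ) × EuclideanSpace ℝ (Fin n)} (hz : z ∈ localDomain n (Icc a b) c) :
    localForm n (fun s => dt (u s)) c z =
      fderivWithin ℝ (localForm n u c) (localDomain n (Icc a b) c) z ((0, 1), 0) :=
  (hu.hasDerivWithinAt_dt_localForm c hz.1.1 hz.1.2 hz.2).derivWithin
    (uniqueDiffOn_Icc zero_lt_one _ hz.1.2)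

theorem contDiffOn_fderivWithin (hab : a < b) (hu : IsSmoothFamily n (Icc a b) u) (c : M) :
    ContDiffOn ℝ ∞ (fderivWithin ℝ (localForm n u c) (localDomain n (Icc a b) c))
      (localDomain n (Icc a b) c) :=
  (hu.contDiffOn_localForm n c).fderivWithin (uniqueDiffOn_localDomain n hab c) (by simp)

theorem isSmoothFamily_ds (hab : a < b) (hu : IsSmoothFamily n (Icc a b) u) :
    IsSmoothFamily n (Icc a b) (ds (Icc a b) u) :=
  isSmoothFamily_of_localForm n fun c =>
    ((hu.contDiffOn_fderivWithin hab c).clm_apply contDiffOn_const).congr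
      fun _ hz => hu.localForm_ds hab c hz

theorem isSmoothFamily_dt (hab : a < b) (hu : IsSmoothFamily n (Icc a b) u) :
    IsSmoothFamily n (Icc a b) (fun s => dt (u s)) :=
  isSmoothFamily_of_localForm n fun c =>
    ((hu.contDiffOn_fderivWithin hab c).clm_apply contDiffOn_const).congr
      fun _ hz => hu.localForm_dt c hz

variable [RiemannianBundle (fun x : M => TangentSpace (𝓡 n) x)]

omit [RiemannianBundle (fun x : M => TangentSpace (𝓡 n) x)] in
theorem partials_eq (hu : IsSmoothFamily n (Icc a b) u) (c : M)
    {s t : ℝ} {y : EuclideanSpace ℝ (Fin n)} (hs : s ∈ Icc a b) (ht : t ∈ Icc (0 : ℝ) 1)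
    (hy : y ∈ (extChartAt (𝓡 n) c).target) (i : Fin n) :
    partials n c (u s t) y i =
      fderivWithin ℝ (localForm n u c) (localDomain n (Icc a b) c) ((s, t), y)
        ((0, 0), EuclideanSpace.single i 1) := by
  rw [partials_eq_fderiv n c hy (hu.mdifferentiableAt hs ht _)]
  have h := hu.hasFDerivWithinAt c (z := ((s, t), y)) ⟨⟨hs, ht⟩, hy⟩
  have h2 : HasFDerivWithinAt (fun y : EuclideanSpace ℝ (Fin n) => ((s, t), y))
      (ContinuousLinearMap.inr ℝ (ℝ × ℝ) (EuclideanSpace ℝ (Fin n)))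
      (extChartAt (𝓡 n) c).target y :=
    (hasFDerivAt_prodMk_right (s, t) y).hasFDerivWithinAt
  have h3 := (h.comp y h2 fun y' hy' => ⟨⟨hs, ht⟩, hy'⟩).hasFDerivAt
    ((isOpen_extChartAt_target (I := 𝓡 n) c).mem_nhds hy)
  have h4 := h3.fderiv
  exact congrArg (fun L => L (EuclideanSpace.single i (1 : ℝ))) h4

omit [RiemannianBundle (fun x : M => TangentSpace (𝓡 n) x)] in
/-- `∂ₛ∂ᵢu = ∂ᵢ∂ₛu`, by symmetry of the second derivative of the local form. -/
theorem hasDerivWithinAt_partials (hab : a < b) (hu : IsSmoothFamily n (Icc a b) u) (c : M)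
    {s t : ℝ} {y : EuclideanSpace ℝ (Fin n)} (hs : s ∈ Icc a b) (ht : t ∈ Icc (0 : ℝ) 1)
    (hy : y ∈ (extChartAt (𝓡 n) c).target) :
    HasDerivWithinAt (fun s => partials n c (u s t) y) (partials n c (ds (Icc a b) u s t) y)
      (Icc a b) s := by
  refine hasDerivWithinAt_pi.2 fun i => ?_
  set D := localDomain n (Icc a b) c
  set U := localForm n u c
  set e : (ℝ × ℝ) × EuclideanSpace ℝ (Fin n) := ((0, 0), EuclideanSpace.single i 1)
  have hz : ((s, t), y) ∈ D := ⟨⟨hs, ht⟩, hy⟩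
  have hD : UniqueDiffOn ℝ D := uniqueDiffOn_localDomain n hab c
  have hF : HasFDerivWithinAt (fderivWithin ℝ U D)
      (fderivWithin ℝ (fderivWithin ℝ U D) D ((s, t), y))
      D ((s, t), y) :=
    ((hu.contDiffOn_fderivWithin hab c).differentiableOn (by simp) _ hz).hasFDerivWithinAt
  have hcurve : HasDerivWithinAt (fun s : ℝ => ((s, t), y)) ((1, 0), 0) (Icc a b) s :=
    ((hasDerivWithinAt_id s _).prodMk (hasDerivWithinAt_const s _ t)).prodMk
      (hasDerivWithinAt_const s _ y)
  have h1 := (hF.comp_hasDerivWithinAt s (f := fun s => ((s, t), y)) hcurve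
    fun s' hs' => ⟨⟨hs', ht⟩, hy⟩).clm_apply (hasDerivWithinAt_const s _ e)
  have hsymm : IsSymmSndFDerivWithinAt ℝ U D ((s, t), y) :=
    ((hu.contDiffOn_localForm n c) _ hz).isSymmSndFDerivWithinAt
      (by
        rw [minSmoothness_of_isRCLikeNormedField]
        exact ENat.LEInfty.out) hD
      (localDomain_subset_closure_interior n hab c hz) hz
  have h2 : partials n c (ds (Icc a b) u s t) y i =
      fderivWithin ℝ (fderivWithin ℝ U D) D ((s, t), y) ((1, 0), 0) e := by
    rw [(hu.isSmoothFamily_ds hab).partials_eq c hs ht hy, hsymm,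
      fderivWithin_congr (fun z hz => hu.localForm_ds hab c hz) (hu.localForm_ds hab c hz)]
    have h := (hF.clm_apply (hasFDerivWithinAt_const ((1, 0), 0) ((s, t), y) D)).fderivWithin
      (hD _ hz)
    rw [h]
    simp [e]
  rw [h2]
  refine HasDerivWithinAt.congr (f := fun s => fderivWithin ℝ U D ((s, t), y) e) ?_
    (fun s' hs' => hu.partials_eq c hs' ht hy i)
    (hu.partials_eq c hs ht hy i)
  rw [map_zero, add_zero] at h1
  exact h1

/-- `∂ₛ∇u = ∇∂ₛu`, as a derivative of a curve in a fixed tangent space. -/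
theorem hasDerivWithinAt_grad (hab : a < b) (hu : IsSmoothFamily n (Icc a b) u)
    {s t : ℝ} (hs : s ∈ Icc a b) (ht : t ∈ Icc (0 : ℝ) 1) (x : M) :
    HasDerivWithinAt (fun s => grad n (u s t) x) (grad n (ds (Icc a b) u s t) x) (Icc a b) s := by
  have key : ∀ y ∈ (extChartAt (𝓡 n) x).target,
      HasDerivWithinAt (fun s => grad n (u s t) ((extChartAt (𝓡 n) x).symm y))
        (grad n (ds (Icc a b) u s t) ((extChartAt (𝓡 n) x).symm y)) (Icc a b) s := by
    intro y hy
    simp only [grad_eq_sum n x _ hy]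
    have h := hu.hasDerivWithinAt_partials hab x hs ht hy
    refine HasDerivWithinAt.fun_sum fun i _ => HasDerivWithinAt.smul_const ?_ _
    simp only [mulVec, dotProduct]
    exact HasDerivWithinAt.fun_sum fun j _ => (hasDerivWithinAt_pi.1 h j).const_mul _
  have h := key _ (mem_extChartAt_target x)
  rwa [extChartAt_to_inv] at h

omit [RiemannianBundle (fun x : M => TangentSpace (𝓡 n) x)] in
theorem continuousOn_partials (hab : a < b) (hu : IsSmoothFamily n (Icc a b) u) (c : M)
    {s : ℝ} (hs : s ∈ Icc a b) :
    ContinuousOn (fun z : ℝ × EuclideanSpace ℝ (Fin n) => partials n c (u s z.1) z.2)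
      (Icc (0 : ℝ) 1 ×ˢ (extChartAt (𝓡 n) c).target) := by
  refine continuousOn_pi.2 fun i => ?_
  have h := ((hu.contDiffOn_fderivWithin hab c).clm_apply
    (contDiffOn_const (c := (((0, 0), EuclideanSpace.single i 1) :
      (ℝ × ℝ) × EuclideanSpace ℝ (Fin n))))).continuousOn
  have h2 := h.comp (f := fun z : ℝ × EuclideanSpace ℝ (Fin n) => ((s, z.1), z.2))
    (s := Icc (0 : ℝ) 1 ×ˢ (extChartAt (𝓡 n) c).target) (by fun_prop)
    fun z hz => ⟨⟨hs, hz.1⟩, hz.2⟩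
  exact h2.congr fun z hz => hu.partials_eq c hs hz.1 hz.2 i

theorem continuousOn_inner_grad
    [IsContinuousRiemannianBundle (EuclideanSpace ℝ (Fin n)) (fun x : M => TangentSpace (𝓡 n) x)]
    (hab : a < b) (hu : IsSmoothFamily n (Icc a b) u) (hv : IsSmoothFamily n (Icc a b) v)
    {s s' : ℝ} (hs : s ∈ Icc a b) (hs' : s' ∈ Icc a b) :
    ContinuousOn (fun z : ℝ × M => inner ℝ (grad n (u s z.1) z.2) (grad n (v s' z.1) z.2))
      (Icc (0 : ℝ) 1 ×ˢ (univ : Set M)) := by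
  rintro ⟨t, x⟩ ⟨ht, -⟩
  have h1 : ContinuousOn (fun z : ℝ × EuclideanSpace ℝ (Fin n) =>
      ((metricMatrix n x z.2)⁻¹ *ᵥ partials n x (u s z.1) z.2) ⬝ᵥ partials n x (v s' z.1) z.2)
      (Icc (0 : ℝ) 1 ×ˢ (extChartAt (𝓡 n) x).target) := by
    have hG : ContinuousOn (fun z : ℝ × EuclideanSpace ℝ (Fin n) => (metricMatrix n x z.2)⁻¹)
        (Icc (0 : ℝ) 1 ×ˢ (extChartAt (𝓡 n) x).target) :=
      (continuousOn_metricMatrix_inv n x).comp continuousOn_snd fun z hz => hz.2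
    have hU := hu.continuousOn_partials hab x hs
    have hV := hv.continuousOn_partials hab x hs'
    simp only [mulVec, dotProduct]
    exact continuousOn_finsetSum _ fun i _ => (continuousOn_finsetSum _ fun j _ =>
      (continuousOn_pi.1 (continuousOn_pi.1 hG i) j).mul (continuousOn_pi.1 hU j)).mul
        (continuousOn_pi.1 hV i)
  have h2 : ContinuousOn (fun z : ℝ × M => (z.1, extChartAt (𝓡 n) x z.2))
      (Icc (0 : ℝ) 1 ×ˢ (extChartAt (𝓡 n) x).source) :=
    continuousOn_fst.prodMk
      ((continuousOn_extChartAt (I := 𝓡 n) x).comp continuousOn_snd fun z hz => hz.2)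
  have h3 := h1.comp h2 fun z hz => ⟨hz.1, (extChartAt (𝓡 n) x).map_source hz.2⟩
  have h4 : ContinuousOn (fun z : ℝ × M => inner ℝ (grad n (u s z.1) z.2) (grad n (v s' z.1) z.2))
      (Icc (0 : ℝ) 1 ×ˢ (extChartAt (𝓡 n) x).source) := by
    refine h3.congr fun z hz => ?_
    have h := inner_grad_grad_eq n x (u s z.1) (v s' z.1) ((extChartAt (𝓡 n) x).map_source hz.2)
    rw [(extChartAt (𝓡 n) x).left_inv hz.2] at h
    exact h
  have hx : (t, x) ∈ Icc (0 : ℝ) 1 ×ˢ (extChartAt (𝓡 n) x).source :=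
    ⟨ht, mem_extChartAt_source x⟩
  refine (h4 _ hx).mono_of_mem_nhdsWithin ?_
  refine mem_nhdsWithin.2 ⟨univ ×ˢ (extChartAt (𝓡 n) x).source,
    isOpen_univ.prod (isOpen_extChartAt_source (I := 𝓡 n) x), ⟨mem_univ _, hx.2⟩, ?_⟩
  rintro z ⟨hz1, hz2⟩
  exact ⟨hz2.1, hz1.2⟩

end IsSmoothFamily

end SmoothFamilies

/-! ### Compactness of closed balls -/

section HopfRinow

open Topology Metric Manifold

variable (n : ℕ) {M : Type*} [MetricSpace M] [ChartedSpace (EuclideanSpace ℝ (Fin n)) M]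
  [RiemannianBundle (fun x : M => TangentSpace (𝓡 n) x)] [IsRiemannianManifold (𝓡 n) M]

include n in
/-- Points of a Riemannian manifold are joined by curves of length close to their distance, so a
ball of radius `R + δ` is contained in the `δ`-neighbourhood of the ball of radius `R`. -/
theorem exists_dist_le_dist_lt {o x : M} {R δ : ℝ} (hR : 0 ≤ R) (hδ : 0 < δ)
    (h : dist o x < R + δ) : ∃ z, dist o z ≤ R ∧ dist z x < δ := by
  rcases le_or_gt (dist o x) R with hle | hlt
  · exact ⟨x, hle, by simpa using hδ⟩
  have h1 : riemannianEDist (𝓡 n) o x < ENNReal.ofReal (R + δ) := by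
    rw [← IsRiemannianManifold.out, edist_dist]
    exact (ENNReal.ofReal_lt_ofReal_iff (by linarith)).2 h
  obtain ⟨γ, h0, h1, hγ, hlen⟩ := exists_lt_of_riemannianEDist_lt h1
  have hf : ContinuousOn (fun t => dist o (γ t)) (Icc 0 1) :=
    (continuous_const.dist continuous_id).comp_continuousOn hγ.continuousOn
  obtain ⟨t, ht, hft⟩ := intermediate_value_Icc zero_le_one hf
    (show R ∈ Icc (dist o (γ 0)) (dist o (γ 1)) by
      rw [h0, h1, dist_self]
      exact ⟨hR, hlt.le⟩)
  change dist o (γ t) = R at hft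
  refine ⟨γ t, hft.le, ?_⟩
  have e1 : edist o (γ t) ≤ pathELength (𝓡 n) γ 0 t := by
    rw [IsRiemannianManifold.out (I := 𝓡 n) o (γ t)]
    exact riemannianEDist_le_pathELength (hγ.mono (Icc_subset_Icc le_rfl ht.2)) h0 rfl ht.1
  have e2 : edist (γ t) x ≤ pathELength (𝓡 n) γ t 1 := by
    rw [IsRiemannianManifold.out (I := 𝓡 n) (γ t) x]
    exact riemannianEDist_le_pathELength (hγ.mono (Icc_subset_Icc ht.1 le_rfl)) rfl h1 ht.2
  have e3 : edist o (γ t) + edist (γ t) x < ENNReal.ofReal (R + δ) :=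
    ((add_le_add e1 e2).trans_eq (pathELength_add ht.1 ht.2)).trans_lt hlen
  rw [edist_dist, edist_dist, ← ENNReal.ofReal_add dist_nonneg dist_nonneg,
    ENNReal.ofReal_lt_ofReal_iff (by linarith), hft] at e3
  linarith

include n in
/-- Hopf–Rinow: in a complete Riemannian manifold closed balls are compact. -/
theorem isCompact_closedBall_of_complete [CompleteSpace M] (o : M) (r : ℝ) :
    IsCompact (closedBall o r) := by
  have : LocallyCompactSpace M := ChartedSpace.locallyCompactSpace (EuclideanSpace ℝ (Fin n)) M
  rcases lt_or_ge r 0 with hr | hr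
  · rw [closedBall_eq_empty.2 hr]
    exact isCompact_empty
  -- Continuous induction on the radius: the set of good radii in `[0, r]` is closed, because closed
  -- balls of limit radius are totally bounded, and open to the right, by local compactness.
  set A : Set ℝ := {r | IsCompact (closedBall o r)} with hA
  suffices h : Icc 0 r ⊆ A from h ⟨hr, le_rfl⟩
  refine IsClosed.Icc_subset_of_forall_exists_gt ?_ ?_ ?_
  · refine isClosed_of_closure_subset fun r₁ hr₁ => ?_
    have hr₁I : r₁ ∈ Icc 0 r := isClosed_Icc.closure_subset (closure_mono inter_subset_right hr₁)
    refine ⟨TotallyBounded.isCompact_of_isClosed (totallyBounded_iff.2 fun δ hδ => ?_)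
      isClosed_closedBall, hr₁I⟩
    obtain ⟨r', ⟨hr'A, hr'I⟩, hd⟩ := Metric.mem_closure_iff.1 hr₁ (δ / 2) (half_pos hδ)
    obtain ⟨t, htf, ht⟩ := totallyBounded_iff.1 (IsCompact.totallyBounded hr'A) (δ / 2)
      (half_pos hδ)
    refine ⟨t, htf, fun x hx => ?_⟩
    rw [mem_closedBall, dist_comm] at hx
    rw [Real.dist_eq] at hd
    obtain ⟨z, hz, hzx⟩ := exists_dist_le_dist_lt n (o := o) (x := x) hr'I.1 (half_pos hδ)
      (by linarith [abs_lt.1 hd])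
    obtain ⟨w, hw, hzw⟩ := mem_iUnion₂.1 (ht (show z ∈ closedBall o r' by
      rwa [mem_closedBall, dist_comm]))
    refine mem_iUnion₂.2 ⟨w, hw, ?_⟩
    rw [mem_ball] at hzw ⊢
    linarith [dist_triangle x z w, dist_comm x z]
  · simp [hA]
  · rintro r₁ ⟨hr₁A, hr₁⟩ y hy
    obtain ⟨K', hK', hsub⟩ := exists_compact_superset (show IsCompact (closedBall o r₁) from hr₁A)
    obtain ⟨δ, hδ, hthick⟩ :=
      (show IsCompact (closedBall o r₁) from hr₁A).exists_thickening_subset_open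
      isOpen_interior hsub
    refine ⟨min y (r₁ + δ / 2), hK'.of_isClosed_subset isClosed_closedBall fun x hx => ?_,
      lt_min hy (by linarith), min_le_left _ _⟩
    rw [mem_closedBall, dist_comm] at hx
    obtain ⟨z, hz, hzx⟩ := exists_dist_le_dist_lt n (o := o) (x := x) hr₁.1 hδ
      (by linarith [min_le_right y (r₁ + δ / 2)])
    refine interior_subset (hthick (mem_thickening_iff.2 ⟨z, ?_, ?_⟩))
    · rwa [mem_closedBall, dist_comm]
    · rwa [dist_comm]

end HopfRinow

/-! ### Smoothing of Lipschitz functions in charts -/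

section Mollification

open Topology Metric
open scoped Convolution NNReal

/-- Convolution with a bump function approximates a Lipschitz function uniformly by smooth functions
with the same Lipschitz constant. -/
theorem exists_contDiff_lipschitz_approx {V : Type*} [NormedAddCommGroup V]
    [NormedSpace ℝ V] [FiniteDimensional ℝ V] {f : V → ℝ} {K : ℝ≥0} (hf : LipschitzWith K f)
    {ε : ℝ} (hε : 0 < ε) :
    ∃ g : V → ℝ, ContDiff ℝ ∞ g ∧ (∀ x, |g x - f x| ≤ ε) ∧ LipschitzWith K g := by
  borelize V
  set δ := ε / (K + 1) with hδ
  have hδ0 : 0 < δ := by positivity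
  set φ : ContDiffBump (0 : V) := ⟨δ / 2, δ, half_pos hδ0, half_lt_self hδ0⟩
  set μ : Measure V := Measure.addHaar
  set g : V → ℝ := φ.normed μ ⋆[ContinuousLinearMap.lsmul ℝ ℝ, μ] f with hg
  have hloc : LocallyIntegrable f μ := hf.continuous.locallyIntegrable
  refine ⟨g, φ.hasCompactSupport_normed.contDiff_convolution_left _ φ.contDiff_normed hloc,
    fun x => ?_, ?_⟩
  · refine φ.dist_normed_convolution_le hf.continuous.aestronglyMeasurable fun y hy => ?_
    have hy' : dist y x ≤ δ := (mem_ball.1 hy).le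
    calc dist (f y) (f x) ≤ K * dist y x := hf.dist_le_mul y x
      _ ≤ K * δ := by gcongr
      _ ≤ (K + 1) * δ := by gcongr; linarith
      _ = ε := by rw [hδ]; field_simp
  · refine LipschitzWith.of_dist_le_mul fun x y => ?_
    have hint : ∀ z, Integrable (fun t => φ.normed μ t * f (z - t)) μ := fun z =>
      ((φ.contDiff_normed (n := 0)).continuous.mul
        (hf.continuous.comp (continuous_const.sub continuous_id))).integrable_of_hasCompactSupport
        φ.hasCompactSupport_normed.mul_right
    have heq : g x - g y = ∫ t, φ.normed μ t * (f (x - t) - f (y - t)) ∂μ := by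
      simp only [hg, convolution_def, ContinuousLinearMap.lsmul_apply, smul_eq_mul]
      rw [← integral_sub (hint x) (hint y)]
      simp only [mul_sub]
    rw [Real.dist_eq, heq]
    calc |∫ t, φ.normed μ t * (f (x - t) - f (y - t)) ∂μ|
        ≤ ∫ t, φ.normed μ t * (K * dist x y) ∂μ := by
          rw [← Real.norm_eq_abs]
          refine norm_integral_le_of_norm_le
            ((φ.integrable_normed (μ := μ)).mul_const (K * dist x y))
            (Filter.Eventually.of_forall fun t => ?_)
          rw [norm_mul, Real.norm_of_nonneg (φ.nonneg_normed t)]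
          refine mul_le_mul_of_nonneg_left ?_ (φ.nonneg_normed t)
          have := hf.dist_le_mul (x - t) (y - t)
          rwa [dist_sub_right] at this
      _ = K * dist x y := by
          rw [integral_mul_const, φ.integral_normed, one_mul]

end Mollification

section LocalSmoothing

open Topology Metric Manifold
open scoped NNReal

variable (n : ℕ) {M : Type*} [MetricSpace M] [ChartedSpace (EuclideanSpace ℝ (Fin n)) M]
  [IsManifold (𝓡 n) ∞ M]
  [RiemannianBundle (fun x : M => TangentSpace (𝓡 n) x)] [IsRiemannianManifold (𝓡 n) M]

/-- If the parametrization `e⁻¹ ∘ (e c + A⁻¹ ·)` stretches vectors by a factor at most `r`, then it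
is `r`-Lipschitz on balls. -/
theorem dist_chart_symm_le {V : Type*} [NormedAddCommGroup V] [NormedSpace ℝ V]
    (A : EuclideanSpace ℝ (Fin n) ≃L[ℝ] V) (c : M) {r δ : ℝ} (hr : 0 ≤ r)
    (htarget : ∀ v ∈ ball (0 : V) δ, extChartAt (𝓡 n) c c + A.symm v ∈ (extChartAt (𝓡 n) c).target)
    (hstretch : ∀ v ∈ ball (0 : V) δ, ∀ w : V,
      ‖mfderiv (𝓡 n) (𝓡 n) (extChartAt (𝓡 n) c).symm (extChartAt (𝓡 n) c c + A.symm v)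
        (A.symm w)‖ ≤ r * ‖w‖)
    {v w : V} (hv : v ∈ ball (0 : V) δ) (hw : w ∈ ball (0 : V) δ) :
    dist ((extChartAt (𝓡 n) c).symm (extChartAt (𝓡 n) c c + A.symm v))
      ((extChartAt (𝓡 n) c).symm (extChartAt (𝓡 n) c c + A.symm w)) ≤ r * dist v w := by
  set e := extChartAt (𝓡 n) c with he
  set η : ℝ → EuclideanSpace ℝ (Fin n) := fun t => e c + A.symm (v + t • (w - v)) with hη
  have hηball : ∀ t ∈ Icc (0 : ℝ) 1, v + t • (w - v) ∈ ball (0 : V) δ := fun t ht =>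
    (convex_ball (0 : V) δ).add_smul_sub_mem hv hw ht
  have hηd : ∀ t, HasDerivAt η (A.symm (w - v)) t := by
    intro t
    have h1 : HasDerivAt (fun t : ℝ => v + t • (w - v)) (w - v) t := by
      simpa using ((hasDerivAt_id t).smul_const (w - v)).const_add v
    exact ((A.symm : V →L[ℝ] EuclideanSpace ℝ (Fin n)).hasFDerivAt.comp_hasDerivAt t h1).const_add _
  have hηs : ContDiff ℝ 1 η := by
    rw [hη]; fun_prop
  have hγ : ContMDiffOn 𝓘(ℝ, ℝ) (𝓡 n) 1 (e.symm ∘ η) (Icc 0 1) :=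
    ((contMDiffOn_chart_symm n c).of_le (by simp)).comp hηs.contMDiff.contMDiffOn
      fun t ht => htarget _ (hηball t ht)
  have hlen : edist (e.symm (e c + A.symm v)) (e.symm (e c + A.symm w)) ≤
      pathELength (𝓡 n) (e.symm ∘ η) 0 1 := by
    rw [IsRiemannianManifold.out (I := 𝓡 n) (e.symm (e c + A.symm v)) _]
    exact riemannianEDist_le_pathELength hγ (by simp [hη]) (by simp [hη]) zero_le_one
  have hbound : pathELength (𝓡 n) (e.symm ∘ η) 0 1 ≤ ENNReal.ofReal (r * dist v w) := by
    rw [pathELength_eq_lintegral_mfderiv_Icc]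
    calc ∫⁻ t in Icc (0 : ℝ) 1, ‖mfderiv 𝓘(ℝ, ℝ) (𝓡 n) (e.symm ∘ η) t 1‖ₑ
        ≤ ∫⁻ t in Icc (0 : ℝ) 1, ENNReal.ofReal (r * dist v w) := by
          refine setLIntegral_mono' measurableSet_Icc fun t ht => ?_
          have h1 := mfderiv_comp t (mdifferentiableAt_chart_symm n c (htarget _ (hηball t ht)))
            (hηd t).differentiableAt.mdifferentiableAt
          have h2 : mfderiv 𝓘(ℝ, ℝ) (𝓡 n) (e.symm ∘ η) t 1 =
              mfderiv (𝓡 n) (𝓡 n) e.symm (η t) (A.symm (w - v)) := by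
            refine (congrArg (fun L => L (1 : ℝ)) h1).trans ?_
            have h3 : mfderiv 𝓘(ℝ, ℝ) (𝓡 n) η t (1 : ℝ) = A.symm (w - v) := by
              rw [mfderiv_eq_fderiv]
              exact (hηd t).deriv ▸ fderiv_apply_one_eq_deriv
            exact congrArg (mfderiv (𝓡 n) (𝓡 n) e.symm (η t)) h3
          rw [h2, ← ofReal_norm, dist_comm, dist_eq_norm]
          exact ENNReal.ofReal_le_ofReal (hstretch _ (hηball t ht) _)
      _ = ENNReal.ofReal (r * dist v w) := by simp
  have h := hlen.trans hbound
  rwa [edist_dist, ENNReal.ofReal_le_ofReal_iff (by positivity)] at h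

/-- A Lipschitz function is approximated near `c` by smooth functions with almost the same Lipschitz
constant: read it in coordinates adapted to a norm which the metric distorts by at most `r`, extend
it and mollify. -/
theorem exists_local_smoothing_of_stretch {V : Type*} [NormedAddCommGroup V] [NormedSpace ℝ V]
    [FiniteDimensional ℝ V]
    (A : EuclideanSpace ℝ (Fin n) ≃L[ℝ] V) (c : M) {r : ℝ} (hr : 0 ≤ r)
    (h1 : ∀ᶠ y in 𝓝 (extChartAt (𝓡 n) c c), ∀ w : V,
      ‖mfderiv (𝓡 n) (𝓡 n) (extChartAt (𝓡 n) c).symm y (A.symm w)‖ ≤ r * ‖w‖)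
    (h2 : ∀ᶠ x in 𝓝 c, ∀ v : TangentSpace (𝓡 n) x,
      ‖A (mfderiv (𝓡 n) (𝓡 n) (extChartAt (𝓡 n) c) x v)‖ ≤ r * ‖v‖)
    {u : M → ℝ} {L : ℝ} (hL : 0 ≤ L) (hu : ∀ x y, |u x - u y| ≤ L * dist x y) :
    ∃ U : Set M, IsOpen U ∧ c ∈ U ∧ ∀ ε > 0, ∃ f : M → ℝ,
      ContMDiffOn (𝓡 n) 𝓘(ℝ, ℝ) ∞ f U ∧ ∀ x ∈ U, |f x - u x| ≤ ε ∧ ‖grad n f x‖ ≤ r * r * L := by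
  set e := extChartAt (𝓡 n) c with he
  have htgt : ∀ᶠ y in 𝓝 (e c), y ∈ e.target :=
    (isOpen_extChartAt_target (I := 𝓡 n) c).mem_nhds (mem_extChartAt_target c)
  have hcont : Filter.Tendsto (fun v : V => e c + A.symm v) (𝓝 0) (𝓝 (e c)) := by
    have : Continuous (fun v : V => e c + A.symm v) := by fun_prop
    simpa using this.tendsto 0
  obtain ⟨δ, hδ, hball⟩ := Metric.eventually_nhds_iff_ball.1 (hcont.eventually (htgt.and h1))
  obtain ⟨W, hWsub, hWo, hcW⟩ := _root_.eventually_nhds_iff.1 h2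
  have hΨ : ∀ v ∈ ball (0 : V) δ, ∀ w ∈ ball (0 : V) δ,
      |u (e.symm (e c + A.symm v)) - u (e.symm (e c + A.symm w))| ≤ (L * r) * dist v w := by
    intro v hv w hw
    refine (hu _ _).trans ?_
    rw [mul_assoc]
    exact mul_le_mul_of_nonneg_left (dist_chart_symm_le n A c hr (fun v hv => (hball v hv).1)
      (fun v hv => (hball v hv).2) hv hw) hL
  set K : ℝ≥0 := (L * r).toNNReal with hK
  have hKr : (K : ℝ) = L * r := Real.coe_toNNReal _ (by positivity)
  have hlip : LipschitzOnWith K (fun v : V => u (e.symm (e c + A.symm v))) (ball 0 δ) :=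
    LipschitzOnWith.of_dist_le_mul fun v hv w hw => by
      rw [hKr]
      exact hΨ v hv w hw
  obtain ⟨ũ, hũ, hũeq⟩ := hlip.extend_real
  set U : Set M := (e.source ∩ e ⁻¹' {y | A (y - e c) ∈ ball (0 : V) δ}) ∩ W with hU
  have hUo : IsOpen U := by
    refine IsOpen.inter ?_ hWo
    refine (continuousOn_extChartAt (I := 𝓡 n) c).isOpen_inter_preimage
      (isOpen_extChartAt_source (I := 𝓡 n) c) ?_
    exact isOpen_ball.preimage (by fun_prop : Continuous fun y => A (y - e c))
  refine ⟨U, hUo, ⟨⟨mem_extChartAt_source c, by simp [hδ]⟩, hcW⟩, fun ε hε => ?_⟩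
  obtain ⟨F, hF, hFε, hFK⟩ := exists_contDiff_lipschitz_approx hũ hε
  have hes : ContMDiffOn (𝓡 n) (𝓡 n) ∞ e U :=
    (contMDiffOn_extChartAt (I := 𝓡 n) (n := ∞) (x := c)).mono fun x hx => by
      simpa [he] using hx.1.1
  have hFA : ContDiff ℝ ∞ fun y : EuclideanSpace ℝ (Fin n) => F (A (y - e c)) := by fun_prop
  refine ⟨fun x => F (A (e x - e c)), hFA.contMDiff.comp_contMDiffOn hes, fun x hx => ⟨?_, ?_⟩⟩
  · have h := hFε (A (e x - e c))
    rw [← hũeq hx.1.2] at h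
    simpa [e.left_inv hx.1.1] using h
  · rw [norm_grad]
    refine ContinuousLinearMap.opNorm_le_bound _ (by positivity) fun v => ?_
    have hd1 : MDifferentiableAt (𝓡 n) (𝓡 n) e x :=
      (hes.contMDiffAt (hUo.mem_nhds hx)).mdifferentiableAt (by simp)
    have hd2 : DifferentiableAt ℝ F (A (e x - e c)) := (hF.differentiable (by simp)) _
    have hd3 : HasFDerivAt (fun y : EuclideanSpace ℝ (Fin n) => F (A (y - e c)))
        ((fderiv ℝ F (A (e x - e c))).comp (A : EuclideanSpace ℝ (Fin n) →L[ℝ] V)) (e x) :=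
      hd2.hasFDerivAt.comp (e x)
        ((A : EuclideanSpace ℝ (Fin n) →L[ℝ] V).hasFDerivAt.comp (e x)
          ((hasFDerivAt_id (e x)).sub_const (e c)))
    have hd4 := mfderiv_comp x hd3.differentiableAt.mdifferentiableAt hd1
    rw [mfderiv_eq_fderiv, hd3.fderiv] at hd4
    have hd5 : differential n (fun x => F (A (e x - e c))) x v =
        fderiv ℝ F (A (e x - e c)) (A (mfderiv (𝓡 n) (𝓡 n) e x v)) :=
      congrArg (fun L => L v) hd4
    rw [hd5]
    calc ‖fderiv ℝ F (A (e x - e c)) (A (mfderiv (𝓡 n) (𝓡 n) e x v))‖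
        ≤ K * ‖A (mfderiv (𝓡 n) (𝓡 n) e x v)‖ :=
          ContinuousLinearMap.le_of_opNorm_le _ (norm_fderiv_le_of_lipschitz ℝ hFK) _
      _ ≤ K * (r * ‖v‖) := by
          gcongr
          exact hWsub x hx.2 v
      _ = r * r * L * ‖v‖ := by
          rw [hKr]; ring

variable [IsContinuousRiemannianBundle (EuclideanSpace ℝ (Fin n))
      (fun x : M => TangentSpace (𝓡 n) x)]

/-- The norm used for local smoothing is that of the tangent space at `c`, which the metric distorts
little near `c` by continuity. -/
theorem exists_local_smoothing {u : M → ℝ} {L : ℝ} (hL : 0 ≤ L)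
    (hu : ∀ x y, |u x - u y| ≤ L * dist x y) (c : M) :
    ∃ U : Set M, IsOpen U ∧ c ∈ U ∧ ∀ ε > 0, ∃ f : M → ℝ,
      ContMDiffOn (𝓡 n) 𝓘(ℝ, ℝ) ∞ f U ∧ ∀ x ∈ U, |f x - u x| ≤ ε ∧ ‖grad n f x‖ ≤ 2 * L := by
  have : FiniteDimensional ℝ (TangentSpace (𝓡 n) c) :=
    inferInstanceAs (FiniteDimensional ℝ (EuclideanSpace ℝ (Fin n)))
  set T := trivializationAt (EuclideanSpace ℝ (Fin n)) (fun x : M => TangentSpace (𝓡 n) x) c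
    with hT
  have hc : c ∈ T.baseSet := FiberBundle.mem_baseSet_trivializationAt' c
  -- Any distortion `r > 1` with `r ^ 2 ≤ 2` would do.
  have hr : (1 : ℝ) < 7 / 5 := by norm_num
  let A : EuclideanSpace ℝ (Fin n) ≃L[ℝ] TangentSpace (𝓡 n) c :=
    (T.continuousLinearEquivAt ℝ c hc).symm
  have e1 := eventually_norm_symmL_trivializationAt_self_comp_lt (EuclideanSpace ℝ (Fin n))
    (fun x : M => TangentSpace (𝓡 n) x) c hr
  have e2 := eventually_norm_symmL_trivializationAt_comp_self_lt (EuclideanSpace ℝ (Fin n))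
    (fun x : M => TangentSpace (𝓡 n) x) c hr
  have hsrc : (chartAt (EuclideanSpace ℝ (Fin n)) c).source ∈ 𝓝 c := chart_source_mem_nhds _ c
  have hcont : Filter.Tendsto (extChartAt (𝓡 n) c).symm (𝓝 (extChartAt (𝓡 n) c c)) (𝓝 c) := by
    have := continuousAt_extChartAt_symm (I := 𝓡 n) c
    rwa [ContinuousAt, extChartAt_to_inv] at this
  have h1 : ∀ᶠ y in 𝓝 (extChartAt (𝓡 n) c c), ∀ w : TangentSpace (𝓡 n) c,
      ‖mfderiv (𝓡 n) (𝓡 n) (extChartAt (𝓡 n) c).symm y (A.symm w)‖ ≤ 7 / 5 * ‖w‖ := by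
    filter_upwards [hcont.eventually e2, (isOpen_extChartAt_target (I := 𝓡 n) c).mem_nhds
      (mem_extChartAt_target c)] with y hy hyt w
    have hys : (extChartAt (𝓡 n) c).symm y ∈ (chartAt (EuclideanSpace ℝ (Fin n)) c).source := by
      simpa using (extChartAt (𝓡 n) c).map_target hyt
    have h1 := TangentBundle.symmL_trivializationAt (I := 𝓡 n) hys
    have h3 : T.symmL ℝ ((extChartAt (𝓡 n) c).symm y) =
        mfderiv (𝓡 n) (𝓡 n) (extChartAt (𝓡 n) c).symm y := by
      refine h1.trans ?_
      have : range (𝓡 n) = univ := by simp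
      rw [this, mfderivWithin_univ]
      congr 1
      exact (extChartAt (𝓡 n) c).right_inv hyt
    have h4 : A.symm w = T.continuousLinearMapAt ℝ c w :=
      congrFun (T.coe_continuousLinearEquivAt_eq (R := ℝ) hc) w
    rw [← h3, h4]
    exact ContinuousLinearMap.le_of_opNorm_le _ hy.le w
  have h2 : ∀ᶠ x in 𝓝 c, ∀ v : TangentSpace (𝓡 n) x,
      ‖A (mfderiv (𝓡 n) (𝓡 n) (extChartAt (𝓡 n) c) x v)‖ ≤ 7 / 5 * ‖v‖ := by
    filter_upwards [e1, hsrc] with x hx hxs v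
    have h1 := TangentBundle.continuousLinearMapAt_trivializationAt (I := 𝓡 n) hxs
    have h4 : ∀ w, A w = T.symmL ℝ c w :=
      congrFun (T.symm_continuousLinearEquivAt_eq (R := ℝ) hc)
    rw [← h1]
    exact (congrArg norm (h4 _)).trans_le (ContinuousLinearMap.le_of_opNorm_le _ hx.le v)
  obtain ⟨U, hU, hcU, h⟩ := exists_local_smoothing_of_stretch n A c (by norm_num) h1 h2 hL hu
  refine ⟨U, hU, hcU, fun ε hε => ?_⟩
  obtain ⟨f, hf, hfb⟩ := h ε hε
  refine ⟨f, hf, fun x hx => ⟨(hfb x hx).1, (hfb x hx).2.trans ?_⟩⟩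
  linarith

end LocalSmoothing

/-! ### Smooth cutoff functions -/

section Cutoff

open Topology Metric

variable (n : ℕ) {M : Type*} [MetricSpace M] [ChartedSpace (EuclideanSpace ℝ (Fin n)) M]
  [IsManifold (𝓡 n) ∞ M]
  [RiemannianBundle (fun x : M => TangentSpace (𝓡 n) x)]
  [IsContinuousRiemannianBundle (EuclideanSpace ℝ (Fin n))
      (fun x : M => TangentSpace (𝓡 n) x)]

theorem continuous_inner_grad {f g : M → ℝ} (hf : ContMDiff (𝓡 n) 𝓘(ℝ, ℝ) ∞ f)
    (hg : ContMDiff (𝓡 n) 𝓘(ℝ, ℝ) ∞ g) :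
    Continuous fun x => inner ℝ (grad n f x) (grad n g x) := by
  have h := (isSmoothFamily_const n (Icc (0 : ℝ) 1) hf).continuousOn_inner_grad zero_lt_one
    (isSmoothFamily_const n (Icc (0 : ℝ) 1) hg) (left_mem_Icc.2 zero_le_one)
    (left_mem_Icc.2 zero_le_one)
  exact h.comp_continuous (f := fun x : M => ((0 : ℝ), x)) (by fun_prop)
    fun x => ⟨left_mem_Icc.2 zero_le_one, mem_univ x⟩

theorem continuous_norm_grad {f : M → ℝ} (hf : ContMDiff (𝓡 n) 𝓘(ℝ, ℝ) ∞ f) :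
    Continuous fun x => ‖grad n f x‖ := by
  simp only [norm_eq_sqrt_real_inner]
  exact (continuous_inner_grad n hf hf).sqrt

theorem exists_bound_norm_grad {f : M → ℝ} (hf : ContMDiff (𝓡 n) 𝓘(ℝ, ℝ) ∞ f)
    (hc : HasCompactSupport f) : ∃ C, 0 ≤ C ∧ ∀ x, ‖grad n f x‖ ≤ C := by
  obtain ⟨C, hC⟩ := IsCompact.exists_bound_of_continuousOn hc
    (continuous_norm_grad n hf).continuousOn
  refine ⟨max C 0, le_max_right _ _, fun x => ?_⟩
  by_cases hx : x ∈ tsupport f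
  · exact (le_abs_self _).trans ((hC x hx).trans (le_max_left _ _))
  · rw [grad_eq_zero_of_notMem_tsupport n hx, norm_zero]
    exact le_max_right _ _

variable [SigmaCompactSpace M] [IsRiemannianManifold (𝓡 n) M]

/-- A compactly supported Lipschitz function on a Riemannian manifold is a uniform limit of smooth
compactly supported functions with controlled gradient. Local approximations are glued with a finite
partition of unity `ψ`; since `∑ᵢ ∇ψᵢ = 0` where the function does not vanish, the gluing only adds
`∑ᵢ (fᵢ - u) ∇ψᵢ` to the gradient. -/
theorem exists_smooth_approx {u : M → ℝ} {L : ℝ} (hL : 0 ≤ L)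
    (hu : ∀ x y, |u x - u y| ≤ L * dist x y) (hsupp : HasCompactSupport u) {ε : ℝ} (hε : 0 < ε) :
    ∃ χ : M → ℝ, ContMDiff (𝓡 n) 𝓘(ℝ, ℝ) ∞ χ ∧ HasCompactSupport χ ∧
      ∀ x, |χ x - u x| ≤ ε ∧ ‖grad n χ x‖ ≤ 2 * L + ε := by
  have : LocallyCompactSpace M := ChartedSpace.locallyCompactSpace (EuclideanSpace ℝ (Fin n)) M
  choose U hUo hcU hU using exists_local_smoothing n hL hu
  choose N hN hcN using fun c : M => exists_compact_mem_nhds c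
  obtain ⟨K, hK, hKsub⟩ := exists_compact_superset hsupp
  set W : M → Set M := fun c => U c ∩ interior (N c) with hW
  have hWo : ∀ c, IsOpen (W c) := fun c => (hUo c).inter isOpen_interior
  obtain ⟨t, ht⟩ := hK.elim_finite_subcover W hWo fun x _ =>
    mem_iUnion.2 ⟨x, hcU x, mem_interior_iff_mem_nhds.2 (hcN x)⟩
  obtain ⟨ψ, hψ⟩ := SmoothPartitionOfUnity.exists_isSubordinate (𝓡 n) hK.isClosed
    (fun c : t => W c) (fun c => hWo c) fun x hx => by
      obtain ⟨c, hc, hx⟩ := mem_iUnion₂.1 (ht hx)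
      exact mem_iUnion.2 ⟨⟨c, hc⟩, hx⟩
  have hψs : ∀ c, ContMDiff (𝓡 n) 𝓘(ℝ, ℝ) ∞ (ψ c) := fun c => (ψ c).contMDiff
  have hψc : ∀ c, HasCompactSupport (ψ c) := fun c =>
    (hN c).of_isClosed_subset (isClosed_tsupport _) fun x hx => interior_subset (hψ c hx).2
  choose C hC0 hC using fun c => exists_bound_norm_grad n (hψs c) (hψc c)
  set δ := ε / (1 + ∑ c, C c) with hδ
  have hsum : 0 ≤ ∑ c, C c := Finset.sum_nonneg fun c _ => hC0 c
  have hδ0 : 0 < δ := by positivity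
  choose f hfs hf using fun c : t => hU c δ hδ0
  have hle : ∀ x, ∑ c, ψ c x ≤ 1 := fun x => by
    rw [← finsum_eq_sum_of_fintype]
    exact ψ.sum_le_one x
  have hone : ∀ x ∈ K, ∑ c, ψ c x = 1 := fun x hx => by
    rw [← finsum_eq_sum_of_fintype]
    exact ψ.sum_eq_one hx
  have hprod : ∀ c, ContMDiff (𝓡 n) 𝓘(ℝ, ℝ) ∞ fun x => ψ c x * f c x := fun c =>
    ψ.contMDiff_smul fun x hx => (hfs c).contMDiffAt ((hUo c).mem_nhds (hψ c hx).1)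
  have hχs : ContMDiff (𝓡 n) 𝓘(ℝ, ℝ) ∞ fun x => ∑ c, ψ c x * f c x :=
    contMDiff_finsetSum fun c _ => hprod c
  have hnotin : ∀ {x}, x ∉ tsupport u → u x = 0 := image_eq_zero_of_notMem_tsupport
  have hfu : ∀ c x, ψ c x * |f c x - u x| ≤ ψ c x * δ := by
    intro c x
    rcases eq_or_ne (ψ c x) 0 with h | h
    · simp [h]
    · exact mul_le_mul_of_nonneg_left (hf c x (hψ c (subset_tsupport _ h)).1).1 (ψ.nonneg c x)
  refine ⟨fun x => ∑ c, ψ c x * f c x, hχs, ?_, fun x => ⟨?_, ?_⟩⟩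
  · refine HasCompactSupport.intro (isCompact_iUnion fun c => hψc c) fun x hx => ?_
    refine Finset.sum_eq_zero fun c _ => ?_
    rw [image_eq_zero_of_notMem_tsupport fun h => hx (mem_iUnion.2 ⟨c, h⟩), zero_mul]
  · have h1 : ∑ c, ψ c x * f c x - u x = ∑ c, ψ c x * (f c x - u x) := by
      simp only [mul_sub, Finset.sum_sub_distrib, ← Finset.sum_mul]
      by_cases hx : x ∈ tsupport u
      · rw [hone x (interior_subset (hKsub hx)), one_mul]
      · rw [hnotin hx, mul_zero]
    rw [h1]
    calc |∑ c, ψ c x * (f c x - u x)| ≤ ∑ c, |ψ c x * (f c x - u x)| :=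
          Finset.abs_sum_le_sum_abs _ _
      _ ≤ ∑ c, ψ c x * δ := Finset.sum_le_sum fun c _ => by
          rw [abs_mul, abs_of_nonneg (ψ.nonneg c x)]
          exact hfu c x
      _ ≤ 1 * δ := by
          rw [← Finset.sum_mul]
          exact mul_le_mul_of_nonneg_right (hle x) hδ0.le
      _ ≤ ε := by
          rw [one_mul]
          exact div_le_self hε.le (by linarith)
  · have hterm : ∀ c, grad n (fun x => ψ c x * f c x) x =
        ψ c x • grad n (f c) x + f c x • grad n (ψ c) x := by
      intro c
      by_cases hx : x ∈ tsupport (ψ c)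
      · exact grad_mul n ((hψs c).mdifferentiableAt (by simp))
          (((hfs c).contMDiffAt ((hUo c).mem_nhds (hψ c hx).1)).mdifferentiableAt (by simp))
      · rw [image_eq_zero_of_notMem_tsupport hx, grad_eq_zero_of_notMem_tsupport n hx, zero_smul,
          smul_zero, add_zero]
        exact grad_eq_zero_of_notMem_tsupport n fun h => hx (tsupport_mul_subset_left h)
    have hzero : u x • ∑ c, grad n (ψ c) x = 0 := by
      by_cases hx : x ∈ tsupport u
      · have h2 : grad n (fun y => ∑ c, ψ c y) x = 0 := by
          refine grad_eq_zero_of_eventuallyEq_const n (k := 1) ?_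
          filter_upwards [isOpen_interior.mem_nhds (hKsub hx)] with y hy
          exact hone y (interior_subset hy)
        rw [grad_sum n _ fun c _ => hψs c] at h2
        rw [h2, smul_zero]
      · rw [hnotin hx, zero_smul]
    have hgrad : grad n (fun x => ∑ c, ψ c x * f c x) x =
        ∑ c, (ψ c x • grad n (f c) x + (f c x - u x) • grad n (ψ c) x) := by
      rw [grad_sum n _ fun c _ => hprod c]
      simp only [hterm, sub_smul]
      rw [Finset.sum_add_distrib, Finset.sum_add_distrib, Finset.sum_sub_distrib,
        ← Finset.smul_sum, hzero, sub_zero]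
    rw [hgrad]
    calc ‖∑ c, (ψ c x • grad n (f c) x + (f c x - u x) • grad n (ψ c) x)‖
        ≤ ∑ c, (ψ c x * (2 * L) + δ * C c) := by
          refine norm_sum_le_of_le _ fun c _ => (norm_add_le _ _).trans (add_le_add ?_ ?_)
          · rw [norm_smul, Real.norm_of_nonneg (ψ.nonneg c x)]
            rcases eq_or_ne (ψ c x) 0 with h | h
            · simp [h]
            · exact mul_le_mul_of_nonneg_left (hf c x (hψ c (subset_tsupport _ h)).1).2
                (ψ.nonneg c x)
          · rw [norm_smul]
            by_cases hx : x ∈ tsupport (ψ c)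
            · exact mul_le_mul (hf c x (hψ c hx).1).1 (hC c x) (norm_nonneg _) hδ0.le
            · rw [grad_eq_zero_of_notMem_tsupport n hx, norm_zero, mul_zero]
              exact mul_nonneg hδ0.le (hC0 c)
      _ = (∑ c, ψ c x) * (2 * L) + δ * ∑ c, C c := by
          rw [Finset.sum_add_distrib, Finset.sum_mul, Finset.mul_sum]
      _ ≤ 1 * (2 * L) + ε := by
          refine add_le_add (mul_le_mul_of_nonneg_right (hle x) (by positivity)) ?_
          rw [hδ, div_mul_eq_mul_div, div_le_iff₀ (by positivity)]
          nlinarith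
      _ = 2 * L + ε := by rw [one_mul]

/-- On a complete Riemannian manifold there are smooth cutoff functions whose gradients tend to `0`
uniformly: smooth `min 1 (2 - d(o, ·) / k)⁺`, which is compactly supported since closed balls are
compact. -/
theorem exists_cutoff_seq [CompleteSpace M] [Nonempty M] :
    ∃ χ : ℕ → M → ℝ, (∀ k, ContMDiff (𝓡 n) 𝓘(ℝ, ℝ) ∞ (χ k) ∧ HasCompactSupport (χ k) ∧
      ∀ x, |χ k x| ≤ 2 ∧ ‖grad n (χ k) x‖ ≤ 3 / (k + 1)) ∧
      ∀ x, Filter.Tendsto (fun k => χ k x) Filter.atTop (𝓝 1) := by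
  obtain ⟨o⟩ := ‹Nonempty M›
  set u : ℕ → M → ℝ := fun k x => max 0 (min 1 (2 - dist o x / (k + 1))) with hu
  have hpos : ∀ k : ℕ, (0 : ℝ) < k + 1 := fun k => by positivity
  have hlip : ∀ k x y, |u k x - u k y| ≤ 1 / (k + 1) * dist x y := by
    intro k x y
    have h1 : |u k x - u k y| ≤ |(2 - dist o x / (k + 1)) - (2 - dist o y / (k + 1))| :=
      (abs_max_sub_max_le_max 0 _ 0 _).trans (by
        rw [sub_self, abs_zero]
        refine max_le (abs_nonneg _) ((abs_min_sub_min_le_max 1 _ 1 _).trans ?_)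
        rw [sub_self, abs_zero]
        exact max_le (abs_nonneg _) le_rfl)
    refine h1.trans ?_
    have h2 : (2 - dist o x / (k + 1)) - (2 - dist o y / (k + 1)) =
        1 / ((k : ℝ) + 1) * (dist o y - dist o x) := by ring
    rw [h2, abs_mul, abs_of_pos (one_div_pos.2 (hpos k))]
    refine mul_le_mul_of_nonneg_left ?_ (one_div_pos.2 (hpos k)).le
    rw [abs_sub_comm, dist_comm o x, dist_comm o y]
    exact abs_dist_sub_le x y o
  have hcs : ∀ k, HasCompactSupport (u k) := by
    intro k
    refine HasCompactSupport.intro (isCompact_closedBall_of_complete n o (2 * (k + 1)))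
      fun x hx => ?_
    rw [mem_closedBall, dist_comm, not_le] at hx
    refine max_eq_left ((min_le_right _ _).trans ?_)
    rw [sub_nonpos, le_div_iff₀ (hpos k)]
    exact hx.le
  choose χ hχs hχc hχ using fun k : ℕ => exists_smooth_approx n (one_div_pos.2 (hpos k)).le (hlip k)
    (hcs k) (one_div_pos.2 (hpos k))
  refine ⟨χ, fun k => ⟨hχs k, hχc k, fun x => ⟨?_, ?_⟩⟩, fun x => ?_⟩
  · have h1 : |u k x| ≤ 1 := by
      rw [abs_of_nonneg (le_max_left _ _)]
      exact max_le zero_le_one (min_le_left _ _)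
    have h2 : 1 / ((k : ℝ) + 1) ≤ 1 := by
      rw [div_le_one (hpos k)]
      linarith [(Nat.cast_nonneg k : (0 : ℝ) ≤ k)]
    have h3 := (hχ k x).1
    rw [abs_le] at *
    constructor <;> linarith
  · refine (hχ k x).2.trans (le_of_eq ?_)
    ring
  · have h1 : ∀ᶠ k : ℕ in Filter.atTop, ‖χ k x - 1‖ ≤ 1 / ((k : ℝ) + 1) := by
      filter_upwards [Filter.eventually_ge_atTop ⌈dist o x⌉₊] with k hk
      have h2 : dist o x ≤ k := Nat.ceil_le.1 hk
      have h3 : u k x = 1 := by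
        have h4 : dist o x / (k + 1) ≤ 1 := by
          rw [div_le_one (hpos k)]
          linarith
        have h5 : min 1 (2 - dist o x / ((k : ℝ) + 1)) = 1 := min_eq_left (by linarith)
        simp only [hu, h5]
        exact max_eq_right zero_le_one
      have := (hχ k x).1
      rwa [h3] at this
    have h2 := squeeze_zero_norm' h1 tendsto_one_div_add_atTop_nhds_zero_nat
    simpa using h2.add_const 1

end Cutoff

/-! ### The pairing `⟨|v|^{p-2} v, w⟩`, dominated convergence and integration over `[0,1] × M` -/

section DualityMap

open Topology Filter

variable {V : Type*} [NormedAddCommGroup V] [InnerProductSpace ℝ V]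

/-- The pairing `⟨|v|^{p-2} v, w⟩` of the duality map of exponent `p` with a vector. -/
noncomputable def pPairing (p : ℝ) (v w : V) : ℝ :=
  ‖v‖ ^ (p - 2) * inner ℝ v w

variable {p : ℝ}

theorem pPairing_self (hp : 1 < p) (v : V) : pPairing p v v = ‖v‖ ^ p := by
  rw [pPairing, real_inner_self_eq_norm_sq]
  rcases eq_or_ne v 0 with rfl | hv
  · rw [norm_zero, Real.zero_rpow (show p ≠ 0 by linarith)]
    simp
  · rw [← Real.rpow_natCast, ← Real.rpow_add (norm_pos_iff.2 hv)]
    norm_num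

theorem pPairing_sub (p : ℝ) (v w w' : V) :
    pPairing p v (w - w') = pPairing p v w - pPairing p v w' := by
  rw [pPairing, inner_sub_right, mul_sub]; rfl

theorem pPairing_smul (p : ℝ) (v w : V) (k : ℝ) :
    pPairing p v (k • w) = k * pPairing p v w := by
  rw [pPairing, real_inner_smul_right, pPairing]; ring

theorem abs_pPairing_le (hp : 1 < p) (v w : V) : |pPairing p v w| ≤ ‖v‖ ^ (p - 1) * ‖w‖ := by
  rw [pPairing, abs_mul, abs_of_nonneg (Real.rpow_nonneg (norm_nonneg v) _)]
  have h : ‖v‖ ^ (p - 1) = ‖v‖ ^ (p - 2) * ‖v‖ := by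
    rw [← Real.rpow_add_one' (norm_nonneg v) (by linarith)]
    ring_nf
  rw [h, mul_assoc]
  exact mul_le_mul_of_nonneg_left (abs_real_inner_le_norm v w)
    (Real.rpow_nonneg (norm_nonneg v) _)

theorem rpow_sub_one_mul_le (hp : 1 < p) {a b : ℝ} (ha : 0 ≤ a) (hb : 0 ≤ b) :
    a ^ (p - 1) * b ≤ a ^ p + b ^ p := by
  have h : ∀ c : ℝ, 0 ≤ c → c ^ (p - 1) * c = c ^ p := fun c hc => by
    rw [← Real.rpow_add_one' hc (by linarith)]
    ring_nf
  have ha' := Real.rpow_nonneg ha p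
  have hb' := Real.rpow_nonneg hb p
  rcases le_total a b with hab | hab
  · calc a ^ (p - 1) * b ≤ b ^ (p - 1) * b :=
        mul_le_mul_of_nonneg_right (Real.rpow_le_rpow ha hab (by linarith)) hb
      _ ≤ a ^ p + b ^ p := by rw [h b hb]; linarith
  · calc a ^ (p - 1) * b ≤ a ^ (p - 1) * a :=
        mul_le_mul_of_nonneg_left hab (Real.rpow_nonneg ha _)
      _ ≤ a ^ p + b ^ p := by rw [h a ha]; linarith

theorem abs_pPairing_le_add (hp : 1 < p) (v w : V) : |pPairing p v w| ≤ ‖v‖ ^ p + ‖w‖ ^ p :=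
  (abs_pPairing_le hp v w).trans (rpow_sub_one_mul_le hp (norm_nonneg v) (norm_nonneg w))

theorem abs_le_one_add_rpow (hp : 1 < p) (a : ℝ) : |a| ≤ 1 + |a| ^ p := by
  rcases le_total |a| 1 with h | h
  · linarith [Real.rpow_nonneg (abs_nonneg a) p]
  · linarith [Real.self_le_rpow_of_one_le h hp.le]

/-- The chain rule for `|v|^p`, valid where `v` vanishes since `p > 1`. -/
theorem hasDerivWithinAt_norm_rpow (hp : 1 < p) {v : ℝ → V} {w : V} {S : Set ℝ} {s : ℝ}
    (hv : HasDerivWithinAt v w S s) :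
    HasDerivWithinAt (fun s => ‖v s‖ ^ p) (p * pPairing p (v s) w) S s := by
  refine ((hasFDerivAt_norm_rpow (v s) hp).comp_hasDerivWithinAt s hv).congr_deriv ?_
  simp [pPairing, mul_assoc]

/-- Continuity of the pairing, also at `v = 0` when `p < 2`: it is the derivative of `|v|^p / p`,
which is `C¹`. -/
theorem tendsto_pPairing (hp : 1 < p) {ι : Type*} {l : Filter ι} {v w : ι → V} {v₀ w₀ : V}
    (hv : Tendsto v l (𝓝 v₀)) (hw : Tendsto w l (𝓝 w₀)) :
    Tendsto (fun i => pPairing p (v i) (w i)) l (𝓝 (pPairing p v₀ w₀)) := by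
  have h : ∀ v w : V, pPairing p v w = p⁻¹ * fderiv ℝ (fun x : V => ‖x‖ ^ p) v w := fun v w => by
    rw [fderiv_norm_rpow v hp]
    simp only [pPairing, _root_.smul_apply, innerSL_apply_apply, smul_eq_mul]
    field_simp
  simp only [h]
  have hc : Continuous (fderiv ℝ (fun x : V => ‖x‖ ^ p)) :=
    (contDiff_norm_rpow hp).continuous_fderiv (by simp)
  have h2 : Tendsto (fun i => fderiv ℝ (fun x : V => ‖x‖ ^ p) (v i)) l
      (𝓝 (fderiv ℝ (fun x : V => ‖x‖ ^ p) v₀)) := (hc.tendsto v₀).comp hv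
  exact ((isBoundedBilinearMap_apply.continuous.tendsto (_, w₀)).comp
    (h2.prodMk_nhds hw)).const_mul _

end DualityMap

section DominatedConvergence

open Topology Filter

variable {α : Type*} [MeasurableSpace α] {μ : Measure α}

/-- Differentiation under the integral sign, one-sidedly at the end points of an interval. -/
theorem hasDerivWithinAt_integral_of_dominated {a b : ℝ} {f f' : ℝ → α → ℝ} {g : α → ℝ}
    (hf : ∀ s ∈ Icc a b, Integrable (f s) μ) (hg : Integrable g μ)
    (hderiv : ∀ᵐ z ∂μ, ∀ s ∈ Icc a b, HasDerivWithinAt (fun s => f s z) (f' s z) (Icc a b) s)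
    (hbound : ∀ᵐ z ∂μ, ∀ s ∈ Icc a b, |f' s z| ≤ g z) {s : ℝ} (hs : s ∈ Icc a b) :
    HasDerivWithinAt (fun s => ∫ z, f s z ∂μ) (∫ z, f' s z ∂μ) (Icc a b) s := by
  rw [hasDerivWithinAt_iff_tendsto_slope]
  have hmem : ∀ᶠ s' in 𝓝[Icc a b \ {s}] s, s' ∈ Icc a b \ {s} := self_mem_nhdsWithin
  have heq : (fun s' => ∫ z, slope (fun s => f s z) s s' ∂μ) =ᶠ[𝓝[Icc a b \ {s}] s]
      slope (fun s => ∫ z, f s z ∂μ) s := by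
    filter_upwards [hmem] with s' hs'
    simp only [slope, vsub_eq_sub, smul_eq_mul]
    rw [integral_const_mul, integral_sub (hf s' hs'.1) (hf s hs)]
  refine Tendsto.congr' heq (tendsto_integral_filter_of_dominated_convergence g ?_ ?_ hg ?_)
  · filter_upwards [hmem] with s' hs'
    exact (((hf s' hs'.1).sub (hf s hs)).const_mul _).aestronglyMeasurable
  · filter_upwards [hmem] with s' hs'
    filter_upwards [hderiv, hbound] with z hz hbz
    have h := (convex_Icc a b).norm_image_sub_le_of_norm_hasDerivWithin_le hz hbz hs hs'.1
    rw [slope, norm_smul, norm_inv, vsub_eq_sub,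
      inv_mul_le_iff₀ (norm_pos_iff.2 (sub_ne_zero.2 hs'.2)), mul_comm]
    exact h
  · filter_upwards [hderiv] with z hz
    exact hasDerivWithinAt_iff_tendsto_slope.1 (hz s hs)

theorem tendsto_integral_mul_of_tendsto_one {χ : ℕ → α → ℝ} {f : α → ℝ} (hf : Integrable f μ)
    (hχ : ∀ k, AEStronglyMeasurable (χ k) μ) (hbound : ∀ k z, |χ k z| ≤ 2)
    (hlim : ∀ z, Tendsto (fun k => χ k z) atTop (𝓝 1)) :
    Tendsto (fun k => ∫ z, χ k z * f z ∂μ) atTop (𝓝 (∫ z, f z ∂μ)) := by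
  refine tendsto_integral_of_dominated_convergence (fun z => 2 * |f z|)
    (fun k => (hχ k).mul hf.aestronglyMeasurable) (hf.abs.const_mul 2)
    (fun k => Eventually.of_forall fun z => ?_) (Eventually.of_forall fun z => ?_)
  · rw [norm_mul]
    exact mul_le_mul_of_nonneg_right (hbound k z) (norm_nonneg _)
  · simpa using (hlim z).mul_const (f z)

end DominatedConvergence

section SpaceTime

variable {M : Type*} [MeasurableSpace M]

/-- The product of Lebesgue measure on `[0,1]` and of a measure `μ` on `M`. -/
noncomputable abbrev spaceTime (μ : Measure M) : Measure (ℝ × M) :=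
  (volume.restrict (Icc (0 : ℝ) 1)).prod μ

variable {μ : Measure M} [SFinite μ]

theorem spaceTime_eq_restrict :
    spaceTime μ = (volume.prod μ).restrict (Icc (0 : ℝ) 1 ×ˢ (univ : Set M)) := by
  rw [← Measure.prod_restrict, Measure.restrict_univ]

theorem ae_spaceTime_mem : ∀ᵐ z ∂(spaceTime μ), z.1 ∈ Icc (0 : ℝ) 1 := by
  rw [spaceTime_eq_restrict]
  filter_upwards [ae_restrict_mem (measurableSet_Icc.prod MeasurableSet.univ)] with z hz
  exact hz.1

theorem intervalIntegral_integral_eq {f : ℝ → M → ℝ}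
    (hf : Integrable (fun z : ℝ × M => f z.1 z.2) (spaceTime μ)) :
    ∫ t in (0 : ℝ)..1, ∫ x, f t x ∂μ = ∫ z, f z.1 z.2 ∂(spaceTime μ) := by
  rw [intervalIntegral.integral_of_le zero_le_one, ← integral_Icc_eq_integral_Ioc,
    integral_prod _ hf]

variable [TopologicalSpace M] [SecondCountableTopology M] [BorelSpace M]

theorem aestronglyMeasurable_spaceTime {f : ℝ × M → ℝ}
    (hf : ContinuousOn f (Icc (0 : ℝ) 1 ×ˢ (univ : Set M))) :
    AEStronglyMeasurable f (spaceTime μ) := by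
  rw [spaceTime_eq_restrict]
  exact hf.aestronglyMeasurable (measurableSet_Icc.prod MeasurableSet.univ)

omit [TopologicalSpace M] [SecondCountableTopology M] [BorelSpace M] in
/-- A measurable function dominated by an integrable function of the space variable is integrable on
`[0,1] × M`. -/
theorem integrable_spaceTime_of_le {f : ℝ × M → ℝ} (hf : AEStronglyMeasurable f (spaceTime μ))
    {G : M → ℝ} (hG : Integrable G μ) (C : ℝ)
    (hfG : ∀ z : ℝ × M, z.1 ∈ Icc (0 : ℝ) 1 → |f z| ≤ C * G z.2) :
    Integrable f (spaceTime μ) := by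
  refine ((hG.comp_snd _).const_mul C).mono' hf ?_
  filter_upwards [ae_spaceTime_mem] with z hz using hfG z hz

omit [MeasurableSpace M] [SecondCountableTopology M] [BorelSpace M] in
theorem continuous_slice {f : ℝ × M → ℝ} (hf : ContinuousOn f (Icc (0 : ℝ) 1 ×ˢ (univ : Set M)))
    {t : ℝ} (ht : t ∈ Icc (0 : ℝ) 1) : Continuous fun x => f (t, x) :=
  hf.comp_continuous (by fun_prop) fun x => ⟨ht, mem_univ x⟩

omit [SecondCountableTopology M] [SFinite μ] in
theorem integrable_slice_of_le {f : ℝ × M → ℝ}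
    (hf : ContinuousOn f (Icc (0 : ℝ) 1 ×ˢ (univ : Set M))) {t : ℝ} (ht : t ∈ Icc (0 : ℝ) 1)
    {G : M → ℝ} (hG : Integrable G μ) (hfG : ∀ x, |f (t, x)| ≤ G x) :
    Integrable (fun x => f (t, x)) μ :=
  hG.mono' (continuous_slice hf ht).aestronglyMeasurable (Filter.Eventually.of_forall hfG)

variable [IsLocallyFiniteMeasure μ] [T2Space M]

theorem integrable_spaceTime_of_hasCompactSupport {χ : M → ℝ} (hχ : Continuous χ)
    (hc : HasCompactSupport χ) {f : ℝ × M → ℝ}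
    (hf : ContinuousOn f (Icc (0 : ℝ) 1 ×ˢ (univ : Set M))) :
    Integrable (fun z : ℝ × M => χ z.2 * f z) (spaceTime μ) := by
  rw [spaceTime_eq_restrict]
  have hcont : ContinuousOn (fun z : ℝ × M => χ z.2 * f z) (Icc (0 : ℝ) 1 ×ˢ (univ : Set M)) :=
    (hχ.comp continuous_snd).continuousOn.mul hf
  have hK : IsCompact (Icc (0 : ℝ) 1 ×ˢ tsupport χ) := isCompact_Icc.prod hc
  have h := (hcont.mono (prod_mono le_rfl (subset_univ _))).integrableOn_compact
    (μ := volume.prod μ) hK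
  refine IntegrableOn.of_forall_sdiff_eq_zero h (measurableSet_Icc.prod MeasurableSet.univ) ?_
  rintro z ⟨hz1, hz2⟩
  rw [image_eq_zero_of_notMem_tsupport fun h => hz2 ⟨hz1.1, h⟩, zero_mul]

/-- The fundamental theorem of calculus in time, integrated in space against a compactly supported
function. -/
theorem integral_mul_deriv_eq {χ : M → ℝ} (hχ : Continuous χ)
    (hc : HasCompactSupport χ) {f f' : ℝ × M → ℝ}
    (hf' : ContinuousOn f' (Icc (0 : ℝ) 1 ×ˢ (univ : Set M)))
    (hderiv : ∀ t ∈ Icc (0 : ℝ) 1, ∀ x,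
      HasDerivWithinAt (fun t => f (t, x)) (f' (t, x)) (Icc 0 1) t) :
    ∫ z, χ z.2 * f' z ∂(spaceTime μ) = ∫ x, χ x * (f (1, x) - f (0, x)) ∂μ := by
  rw [integral_prod_symm _ (integrable_spaceTime_of_hasCompactSupport hχ hc hf')]
  refine integral_congr_ae (Filter.Eventually.of_forall fun x => ?_)
  have hcont : ContinuousOn (fun t => f' (t, x)) (Icc (0 : ℝ) 1) :=
    hf'.comp (by fun_prop) fun t ht => ⟨ht, mem_univ x⟩
  simp only
  rw [integral_const_mul, integral_Icc_eq_integral_Ioc,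
    ← intervalIntegral.integral_of_le zero_le_one,
    intervalIntegral.integral_eq_sub_of_hasDerivAt_of_le (f := fun t => f (t, x)) zero_le_one
      (fun t ht => (hderiv t ht x).continuousWithinAt)
      (fun t ht => (hderiv t (Ioo_subset_Icc_self ht) x).hasDerivAt (Icc_mem_nhds ht.1 ht.2))
      (hcont.intervalIntegrable_of_Icc zero_le_one)]

end SpaceTime

/-! ### Families of solutions of the transport equation -/

section FirstVariation

open Topology Filter

variable (n : ℕ) {M : Type*} [MetricSpace M] [SigmaCompactSpace M]
  [ChartedSpace (EuclideanSpace ℝ (Fin n)) M] [IsManifold (𝓡 n) ∞ M]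
  [RiemannianBundle (fun x : M => TangentSpace (𝓡 n) x)] [MeasurableSpace M]

/-- A smooth family, over `s ∈ [a, b]`, of solutions of the transport equation with positive
densities, with the growth condition for the dominating function `G`. -/
structure IsTransportFamily (p a b : ℝ) (ρ φ : ℝ → ℝ → M → ℝ) (G : M → ℝ) : Prop where
  lt : a < b
  one_lt : 1 < p
  smooth_density : IsSmoothFamily n (Icc a b) ρ
  smooth_potential : IsSmoothFamily n (Icc a b) φ
  pos : ∀ s ∈ Icc a b, ∀ t ∈ Icc (0 : ℝ) 1, ∀ x, 0 < ρ s t x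
  transport : ∀ s ∈ Icc a b, SolvesTransport n p (ρ s) (φ s)
  integrable : Integrable G (riemannianVolume n M)
  growth : ∀ s ∈ Icc a b, ∀ s' ∈ Icc a b, ∀ t ∈ Icc (0 : ℝ) 1, ∀ x,
      (1 + |φ s t x| ^ p + |dt (φ s) t x| + ‖grad n (φ s t) x‖ ^ p +
          ‖grad n (ds (Icc a b) φ s t) x‖ ^ p) *
        (ρ s' t x + |ds (Icc a b) ρ s' t x|) ≤ G x

variable {n}

omit [SigmaCompactSpace M] [MeasurableSpace M] in
theorem IsSmoothFamily.continuousOn_norm_grad_rpow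
    [IsContinuousRiemannianBundle (EuclideanSpace ℝ (Fin n)) (fun x : M => TangentSpace (𝓡 n) x)]
    {a b p : ℝ} (hab : a < b) (hp : 0 ≤ p) {u : ℝ → ℝ → M → ℝ}
    (hu : IsSmoothFamily n (Icc a b) u) {s : ℝ} (hs : s ∈ Icc a b) :
    ContinuousOn (fun z : ℝ × M => ‖grad n (u s z.1) z.2‖ ^ p)
      (Icc (0 : ℝ) 1 ×ˢ (univ : Set M)) := by
  simp only [norm_eq_sqrt_real_inner]
  exact (hu.continuousOn_inner_grad hab hu hs hs).sqrt.rpow_const fun z _ => Or.inr hp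

/-- Only measurability is claimed, since `|∇u|^{p-2}` is discontinuous at critical points of `u`
when `p < 2`. -/
theorem IsSmoothFamily.aestronglyMeasurable_pPairing [BorelSpace M] [SecondCountableTopology M]
    [IsContinuousRiemannianBundle (EuclideanSpace ℝ (Fin n)) (fun x : M => TangentSpace (𝓡 n) x)]
    {a b p : ℝ} (hab : a < b) {u v : ℝ → ℝ → M → ℝ}
    (hu : IsSmoothFamily n (Icc a b) u) (hv : IsSmoothFamily n (Icc a b) v) {s s' : ℝ}
    (hs : s ∈ Icc a b) (hs' : s' ∈ Icc a b) :
    AEStronglyMeasurable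
      (fun z : ℝ × M => pPairing p (grad n (u s z.1) z.2) (grad n (v s' z.1) z.2))
      (spaceTime (riemannianVolume n M)) := by
  have h1 := aestronglyMeasurable_spaceTime (μ := riemannianVolume n M)
    (hu.continuousOn_norm_grad_rpow (p := 1) hab zero_le_one hs)
  have h2 := aestronglyMeasurable_spaceTime (μ := riemannianVolume n M)
    (hu.continuousOn_inner_grad hab hv hs hs')
  simp only [Real.rpow_one] at h1
  exact (h1.aemeasurable.pow_const (p - 2)).aestronglyMeasurable.mul h2

namespace IsTransportFamily

variable {p a b : ℝ} {ρ φ : ℝ → ℝ → M → ℝ} {G : M → ℝ}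

section Growth

variable (h : IsTransportFamily n p a b ρ φ G) {s s' t : ℝ} (hs : s ∈ Icc a b)
  (hs' : s' ∈ Icc a b) (ht : t ∈ Icc (0 : ℝ) 1) (x : M)

include h hs hs' ht

/-- The shape in which the growth condition is used: `X Y ≤ G` as soon as `X` and `Y` are below its
two factors. -/
theorem mul_le {X Y : ℝ} (hY0 : 0 ≤ Y)
    (hX : X ≤ 1 + |φ s t x| ^ p + |dt (φ s) t x| + ‖grad n (φ s t) x‖ ^ p +
          ‖grad n (ds (Icc a b) φ s t) x‖ ^ p)
    (hY : Y ≤ ρ s' t x + |ds (Icc a b) ρ s' t x|) : X * Y ≤ G x := by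
  refine le_trans ?_ (h.growth s hs s' hs' t ht x)
  have h1 := Real.rpow_nonneg (abs_nonneg (φ s t x)) p
  have h2 := Real.rpow_nonneg (norm_nonneg (grad n (φ s t) x)) p
  have h3 := Real.rpow_nonneg (norm_nonneg (grad n (ds (Icc a b) φ s t) x)) p
  exact mul_le_mul hX hY hY0 (by positivity)

/-- The five terms of the growth condition, against a weight `Y` below `ρ + |∂ρ/∂s|`. -/
theorem growth_bounds {Y : ℝ} (hY0 : 0 ≤ Y) (hY : Y ≤ ρ s' t x + |ds (Icc a b) ρ s' t x|) :
    Y ≤ G x ∧ |φ s t x| * Y ≤ G x ∧ |φ s t x| ^ p * Y ≤ G x ∧ |dt (φ s) t x| * Y ≤ G x ∧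
      ‖grad n (φ s t) x‖ ^ p * Y ≤ G x ∧ ‖grad n (ds (Icc a b) φ s t) x‖ ^ p * Y ≤ G x ∧
      |hamiltonJacobi n p (φ s) t x| * Y ≤ G x := by
  have h0 := abs_le_one_add_rpow h.one_lt (φ s t x)
  have h1 := Real.rpow_nonneg (abs_nonneg (φ s t x)) p
  have h2 := Real.rpow_nonneg (norm_nonneg (grad n (φ s t) x)) p
  have h3 := Real.rpow_nonneg (norm_nonneg (grad n (ds (Icc a b) φ s t) x)) p
  have h4 := abs_nonneg (dt (φ s) t x)
  have h5 : |hamiltonJacobi n p (φ s) t x| ≤ |dt (φ s) t x| + ‖grad n (φ s t) x‖ ^ p := by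
    refine (abs_add_le _ _).trans (add_le_add le_rfl ?_)
    have hp := h.one_lt
    rw [abs_of_nonneg (by positivity)]
    refine mul_le_of_le_one_left h2 ?_
    rw [div_le_one (by linarith)]
    exact hp.le
  refine ⟨?_, ?_, ?_, ?_, ?_, ?_, ?_⟩
  · rw [← one_mul Y]
    exact h.mul_le hs hs' ht x hY0 (by linarith) hY
  all_goals exact h.mul_le hs hs' ht x hY0 (by linarith) hY

omit hs in
theorem density_growth : 0 ≤ ρ s' t x ∧ ρ s' t x ≤ ρ s' t x + |ds (Icc a b) ρ s' t x| :=
  ⟨(h.pos s' hs' t ht x).le, le_add_of_nonneg_right (abs_nonneg _)⟩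

omit hs in
theorem ds_density_growth :
    |ds (Icc a b) ρ s' t x| ≤ ρ s' t x + |ds (Icc a b) ρ s' t x| :=
  le_add_of_nonneg_left (h.pos s' hs' t ht x).le

end Growth

variable [BorelSpace M] [SecondCountableTopology M]
  [IsContinuousRiemannianBundle (EuclideanSpace ℝ (Fin n)) (fun x : M => TangentSpace (𝓡 n) x)]

section Integrability

variable (h : IsTransportFamily n p a b ρ φ G) {s s' : ℝ} (hs : s ∈ Icc a b) (hs' : s' ∈ Icc a b)

include h hs hs'

theorem integrable_dt_mul_density : Integrable (fun z : ℝ × M => dt (φ s) z.1 z.2 * ρ s' z.1 z.2)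
    (spaceTime (riemannianVolume n M)) := by
  refine integrable_spaceTime_of_le (aestronglyMeasurable_spaceTime
    (((h.smooth_potential.isSmoothFamily_dt h.lt).continuousOn hs).mul
      (h.smooth_density.continuousOn hs'))) h.integrable 1 fun z hz => ?_
  obtain ⟨h0, h1⟩ := h.density_growth hs' hz z.2
  rw [abs_mul, abs_of_nonneg h0, one_mul]
  exact (h.growth_bounds hs hs' hz z.2 h0 h1).2.2.2.1

theorem integrable_dt_mul_ds_density :
    Integrable (fun z : ℝ × M => dt (φ s) z.1 z.2 * ds (Icc a b) ρ s' z.1 z.2)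
    (spaceTime (riemannianVolume n M)) := by
  refine integrable_spaceTime_of_le (aestronglyMeasurable_spaceTime
    (((h.smooth_potential.isSmoothFamily_dt h.lt).continuousOn hs).mul
      ((h.smooth_density.isSmoothFamily_ds h.lt).continuousOn hs'))) h.integrable 1 fun z hz => ?_
  rw [abs_mul, one_mul]
  exact (h.growth_bounds hs hs' hz z.2 (abs_nonneg _) (h.ds_density_growth hs' hz z.2)).2.2.2.1

theorem integrable_norm_grad_mul_density :
    Integrable (fun z : ℝ × M => ‖grad n (φ s z.1) z.2‖ ^ p * ρ s' z.1 z.2)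
    (spaceTime (riemannianVolume n M)) := by
  have hp := h.one_lt
  refine integrable_spaceTime_of_le (aestronglyMeasurable_spaceTime
    ((h.smooth_potential.continuousOn_norm_grad_rpow h.lt (by linarith) hs).mul
      (h.smooth_density.continuousOn hs'))) h.integrable 1 fun z hz => ?_
  obtain ⟨h0, h1⟩ := h.density_growth hs' hz z.2
  rw [abs_mul, abs_of_nonneg h0, one_mul, abs_of_nonneg (Real.rpow_nonneg (norm_nonneg _) _)]
  exact (h.growth_bounds hs hs' hz z.2 h0 h1).2.2.2.2.1

theorem integrable_norm_grad_mul_ds_density :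
    Integrable (fun z : ℝ × M => ‖grad n (φ s z.1) z.2‖ ^ p * ds (Icc a b) ρ s' z.1 z.2)
    (spaceTime (riemannianVolume n M)) := by
  have hp := h.one_lt
  refine integrable_spaceTime_of_le (aestronglyMeasurable_spaceTime
    ((h.smooth_potential.continuousOn_norm_grad_rpow h.lt (by linarith) hs).mul
      ((h.smooth_density.isSmoothFamily_ds h.lt).continuousOn hs'))) h.integrable 1 fun z hz => ?_
  rw [abs_mul, one_mul, abs_of_nonneg (Real.rpow_nonneg (norm_nonneg _) _)]
  exact (h.growth_bounds hs hs' hz z.2 (abs_nonneg _) (h.ds_density_growth hs' hz z.2)).2.2.2.2.1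

omit [BorelSpace M] [SecondCountableTopology M]
  [IsContinuousRiemannianBundle (EuclideanSpace ℝ (Fin n)) (fun x : M => TangentSpace (𝓡 n) x)] in
theorem abs_density_mul_pPairing_le {z : ℝ × M} (hz : z.1 ∈ Icc (0 : ℝ) 1) :
    |ρ s' z.1 z.2 * pPairing p (grad n (φ s' z.1) z.2) (grad n (φ s z.1) z.2)| ≤ 2 * G z.2 := by
  obtain ⟨h0, h1⟩ := h.density_growth hs' hz z.2
  rw [abs_mul, abs_of_nonneg h0]
  have h2 := mul_le_mul_of_nonneg_left (abs_pPairing_le_add h.one_lt (grad n (φ s' z.1) z.2)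
    (grad n (φ s z.1) z.2)) h0
  have h3 := (h.growth_bounds hs hs' hz z.2 h0 h1).2.2.2.2.1
  have h4 := (h.growth_bounds hs' hs' hz z.2 h0 h1).2.2.2.2.1
  linarith

theorem integrable_density_mul_pPairing :
    Integrable (fun z : ℝ × M => ρ s' z.1 z.2 *
      pPairing p (grad n (φ s' z.1) z.2) (grad n (φ s z.1) z.2))
    (spaceTime (riemannianVolume n M)) :=
  integrable_spaceTime_of_le
    ((aestronglyMeasurable_spaceTime (h.smooth_density.continuousOn hs')).mul
      (h.smooth_potential.aestronglyMeasurable_pPairing h.lt h.smooth_potential hs' hs))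
    h.integrable 2 fun _ hz => h.abs_density_mul_pPairing_le hs hs' hz

theorem integrable_density_mul_pPairing_ds :
    Integrable (fun z : ℝ × M => ρ s' z.1 z.2 *
      pPairing p (grad n (φ s' z.1) z.2) (grad n (ds (Icc a b) φ s z.1) z.2))
    (spaceTime (riemannianVolume n M)) := by
  refine integrable_spaceTime_of_le
    ((aestronglyMeasurable_spaceTime (h.smooth_density.continuousOn hs')).mul
      (h.smooth_potential.aestronglyMeasurable_pPairing h.lt
        (h.smooth_potential.isSmoothFamily_ds h.lt) hs' hs))
    h.integrable 2 fun z hz => ?_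
  obtain ⟨h0, h1⟩ := h.density_growth hs' hz z.2
  rw [abs_mul, abs_of_nonneg h0]
  have h2 := mul_le_mul_of_nonneg_left (abs_pPairing_le_add h.one_lt (grad n (φ s' z.1) z.2)
    (grad n (ds (Icc a b) φ s z.1) z.2)) h0
  have h3 := (h.growth_bounds hs hs' hz z.2 h0 h1).2.2.2.2.2.1
  have h4 := (h.growth_bounds hs' hs' hz z.2 h0 h1).2.2.2.2.1
  linarith

variable {t : ℝ} (ht : t ∈ Icc (0 : ℝ) 1)

include ht

omit [SecondCountableTopology M]
  [IsContinuousRiemannianBundle (EuclideanSpace ℝ (Fin n)) (fun x : M => TangentSpace (𝓡 n) x)] in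
theorem integrable_slice_potential_mul_density :
    Integrable (fun x => φ s t x * ρ s' t x) (riemannianVolume n M) := by
  refine integrable_slice_of_le ((h.smooth_potential.continuousOn hs).mul
    (h.smooth_density.continuousOn hs')) ht h.integrable fun x => ?_
  change |φ s t x * ρ s' t x| ≤ G x
  obtain ⟨h0, h1⟩ := h.density_growth hs' ht x
  rw [abs_mul, abs_of_nonneg h0]
  exact (h.growth_bounds hs hs' ht x h0 h1).2.1

omit [SecondCountableTopology M]
  [IsContinuousRiemannianBundle (EuclideanSpace ℝ (Fin n)) (fun x : M => TangentSpace (𝓡 n) x)] in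
theorem integrable_slice_potential_mul_ds_density :
    Integrable (fun x => φ s t x * ds (Icc a b) ρ s' t x) (riemannianVolume n M) := by
  refine integrable_slice_of_le ((h.smooth_potential.continuousOn hs).mul
    ((h.smooth_density.isSmoothFamily_ds h.lt).continuousOn hs')) ht h.integrable fun x => ?_
  change |φ s t x * ds (Icc a b) ρ s' t x| ≤ G x
  rw [abs_mul]
  exact (h.growth_bounds hs hs' ht x (abs_nonneg _) (h.ds_density_growth hs' ht x)).2.1

end Integrability

end IsTransportFamily

end FirstVariation

/-! ### The transport equation tested with a potential -/

section TransportPairing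

open Topology Filter

variable {n : ℕ} {M : Type*} [MetricSpace M] [SigmaCompactSpace M]
  [ChartedSpace (EuclideanSpace ℝ (Fin n)) M] [IsManifold (𝓡 n) ∞ M]
  [RiemannianBundle (fun x : M => TangentSpace (𝓡 n) x)] [MeasurableSpace M]
  [BorelSpace M] [SecondCountableTopology M]
  [IsContinuousRiemannianBundle (EuclideanSpace ℝ (Fin n)) (fun x : M => TangentSpace (𝓡 n) x)]

namespace IsTransportFamily

variable {p a b : ℝ} {ρ φ : ℝ → ℝ → M → ℝ} {G : M → ℝ}
  (h : IsTransportFamily n p a b ρ φ G) {s s' : ℝ} (hs : s ∈ Icc a b) (hs' : s' ∈ Icc a b)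

include h hs hs'

omit [BorelSpace M] [SecondCountableTopology M]
  [IsContinuousRiemannianBundle (EuclideanSpace ℝ (Fin n)) (fun x : M => TangentSpace (𝓡 n) x)] in
/-- The error made by a cutoff function of gradient at most `c`. -/
theorem abs_cutoff_error_le {χ : M → ℝ} {c : ℝ} (hc : ∀ x, ‖grad n χ x‖ ≤ c) {z : ℝ × M}
    (hz : z.1 ∈ Icc (0 : ℝ) 1) :
    |φ s z.1 z.2 * ρ s' z.1 z.2 * pPairing p (grad n (φ s' z.1) z.2) (grad n χ z.2)| ≤
      2 * c * G z.2 := by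
  obtain ⟨h0, h1⟩ := h.density_growth hs' hz z.2
  have hc0 : 0 ≤ c := (norm_nonneg _).trans (hc z.2)
  have h2 : ‖grad n (φ s' z.1) z.2‖ ^ (p - 1) * |φ s z.1 z.2| ≤
      ‖grad n (φ s' z.1) z.2‖ ^ p + |φ s z.1 z.2| ^ p :=
    rpow_sub_one_mul_le h.one_lt (norm_nonneg _) (abs_nonneg _)
  have h3 := (h.growth_bounds hs hs' hz z.2 h0 h1).2.2.1
  have h4 := (h.growth_bounds hs' hs' hz z.2 h0 h1).2.2.2.2.1
  have h5 : |pPairing p (grad n (φ s' z.1) z.2) (grad n χ z.2)| ≤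
      ‖grad n (φ s' z.1) z.2‖ ^ (p - 1) * c :=
    (abs_pPairing_le h.one_lt _ _).trans
      (mul_le_mul_of_nonneg_left (hc z.2) (Real.rpow_nonneg (norm_nonneg _) _))
  rw [abs_mul, abs_mul, abs_of_nonneg h0]
  calc |φ s z.1 z.2| * ρ s' z.1 z.2 * |pPairing p (grad n (φ s' z.1) z.2) (grad n χ z.2)|
      ≤ |φ s z.1 z.2| * ρ s' z.1 z.2 * (‖grad n (φ s' z.1) z.2‖ ^ (p - 1) * c) :=
        mul_le_mul_of_nonneg_left h5 (mul_nonneg (abs_nonneg _) h0)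
    _ = c * (‖grad n (φ s' z.1) z.2‖ ^ (p - 1) * |φ s z.1 z.2| * ρ s' z.1 z.2) := by ring
    _ ≤ c * ((‖grad n (φ s' z.1) z.2‖ ^ p + |φ s z.1 z.2| ^ p) * ρ s' z.1 z.2) :=
        mul_le_mul_of_nonneg_left (mul_le_mul_of_nonneg_right h2 h0) hc0
    _ ≤ c * (G z.2 + G z.2) := by
        refine mul_le_mul_of_nonneg_left ?_ hc0
        linarith
    _ = 2 * c * G z.2 := by ring

/-- The weak transport equation tested with a cutoff of the potential and integrated in time. -/
theorem integral_cutoff_eq {χ : M → ℝ} (hχ : ContMDiff (𝓡 n) 𝓘(ℝ, ℝ) ∞ χ)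
    (hχc : HasCompactSupport χ) {c : ℝ} (hχ2 : ∀ x, |χ x| ≤ 2) (hc : ∀ x, ‖grad n χ x‖ ≤ c) :
    (∫ z, χ z.2 * (ρ s' z.1 z.2 * pPairing p (grad n (φ s' z.1) z.2) (grad n (φ s z.1) z.2))
        ∂(spaceTime (riemannianVolume n M))) +
      (∫ z, φ s z.1 z.2 * ρ s' z.1 z.2 * pPairing p (grad n (φ s' z.1) z.2) (grad n χ z.2)
        ∂(spaceTime (riemannianVolume n M))) =
      (∫ x, χ x * (φ s 1 x * ρ s' 1 x - φ s 0 x * ρ s' 0 x) ∂(riemannianVolume n M)) -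
        ∫ z, χ z.2 * (dt (φ s) z.1 z.2 * ρ s' z.1 z.2) ∂(spaceTime (riemannianVolume n M)) := by
  have hdφ := (h.smooth_potential.isSmoothFamily_dt h.lt).continuousOn hs
  have hdρ := (h.smooth_density.isSmoothFamily_dt h.lt).continuousOn hs'
  have hcφ := h.smooth_potential.continuousOn hs
  have hcρ := h.smooth_density.continuousOn hs'
  have hi1 : Integrable (fun z : ℝ × M => χ z.2 * (ρ s' z.1 z.2 *
      pPairing p (grad n (φ s' z.1) z.2) (grad n (φ s z.1) z.2)))
      (spaceTime (riemannianVolume n M)) :=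
    (h.integrable_density_mul_pPairing hs hs').bdd_mul (c := 2)
      (hχ.continuous.comp continuous_snd).aestronglyMeasurable
      (Eventually.of_forall fun z => hχ2 z.2)
  have hi2 : Integrable (fun z : ℝ × M => φ s z.1 z.2 * ρ s' z.1 z.2 *
      pPairing p (grad n (φ s' z.1) z.2) (grad n χ z.2)) (spaceTime (riemannianVolume n M)) :=
    integrable_spaceTime_of_le ((aestronglyMeasurable_spaceTime (hcφ.mul hcρ)).mul
      (h.smooth_potential.aestronglyMeasurable_pPairing h.lt
        (isSmoothFamily_const n (Icc a b) hχ) hs' hs)) h.integrable (2 * c)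
      fun z hz => h.abs_cutoff_error_le hs hs' hc hz
  have hi3 : Integrable (fun z : ℝ × M => χ z.2 * (φ s z.1 z.2 * dt (ρ s') z.1 z.2))
      (spaceTime (riemannianVolume n M)) :=
    integrable_spaceTime_of_hasCompactSupport hχ.continuous hχc (hcφ.mul hdρ)
  have hi4 : Integrable (fun z : ℝ × M => χ z.2 * (dt (φ s) z.1 z.2 * ρ s' z.1 z.2))
      (spaceTime (riemannianVolume n M)) :=
    integrable_spaceTime_of_hasCompactSupport hχ.continuous hχc (hdφ.mul hcρ)
  have htime := integral_mul_deriv_eq (μ := riemannianVolume n M) hχ.continuous hχc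
    (f := fun z => φ s z.1 z.2 * ρ s' z.1 z.2)
    (f' := fun z => dt (φ s) z.1 z.2 * ρ s' z.1 z.2 + φ s z.1 z.2 * dt (ρ s') z.1 z.2)
    ((hdφ.mul hcρ).add (hcφ.mul hdρ))
    fun t ht x => (h.smooth_potential.hasDerivWithinAt_dt hs ht x).mul
      (h.smooth_density.hasDerivWithinAt_dt hs' ht x)
  have hsplit : ∫ z, χ z.2 * (dt (φ s) z.1 z.2 * ρ s' z.1 z.2 +
        φ s z.1 z.2 * dt (ρ s') z.1 z.2) ∂(spaceTime (riemannianVolume n M)) =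
      (∫ z, χ z.2 * (dt (φ s) z.1 z.2 * ρ s' z.1 z.2) ∂(spaceTime (riemannianVolume n M))) +
        ∫ z, χ z.2 * (φ s z.1 z.2 * dt (ρ s') z.1 z.2) ∂(spaceTime (riemannianVolume n M)) := by
    simp only [mul_add]
    exact integral_add hi4 hi3
  have hspace : ∫ z, χ z.2 * (φ s z.1 z.2 * dt (ρ s') z.1 z.2)
        ∂(spaceTime (riemannianVolume n M)) =
      ∫ z, (χ z.2 * (ρ s' z.1 z.2 * pPairing p (grad n (φ s' z.1) z.2) (grad n (φ s z.1) z.2)) +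
        φ s z.1 z.2 * ρ s' z.1 z.2 * pPairing p (grad n (φ s' z.1) z.2) (grad n χ z.2))
        ∂(spaceTime (riemannianVolume n M)) := by
    refine (integral_prod _ hi3).trans (Eq.trans ?_ (integral_prod _ (hi1.add hi2)).symm)
    refine setIntegral_congr_fun measurableSet_Icc fun t ht => ?_
    have hsl := h.smooth_potential.contMDiff_slice hs ht
    have hd := h.transport s' hs' t ht (χ * φ s t) (hχ.mul hsl) hχc.mul_right
    simp only [mul_neg, integral_neg, neg_inj] at hd
    calc ∫ x, χ x * (φ s t x * dt (ρ s') t x) ∂(riemannianVolume n M)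
        = ∫ x, (χ * φ s t) x * dt (ρ s') t x ∂(riemannianVolume n M) := by
          simp only [Pi.mul_apply, mul_assoc]
      _ = _ := hd
      _ = _ := integral_congr_ae (Eventually.of_forall fun x => ?_)
    have hg : grad n (χ * φ s t) x = χ x • grad n (φ s t) x + φ s t x • grad n χ x :=
      grad_mul n (hχ.mdifferentiableAt (x := x) (by simp))
      (h.smooth_potential.mdifferentiableAt hs ht x)
    simp only [Pi.add_apply, pPairing]
    rw [hg, inner_add_right, real_inner_smul_left, real_inner_smul_left, real_inner_smul_right,
      real_inner_smul_right]
    ring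
  rw [← integral_add hi1 hi2, ← hspace, ← htime, hsplit]
  ring

variable [CompleteSpace M] [Nonempty M] [IsRiemannianManifold (𝓡 n) M]

/-- The transport equation tested with the potential of another member of the family. The potential
is not compactly supported: it is multiplied by cutoff functions whose gradients tend to zero
uniformly. -/
theorem integral_density_mul_pPairing :
    ∫ z, ρ s' z.1 z.2 * pPairing p (grad n (φ s' z.1) z.2) (grad n (φ s z.1) z.2)
        ∂(spaceTime (riemannianVolume n M)) =
      ((∫ x, φ s 1 x * ρ s' 1 x ∂(riemannianVolume n M)) -
        ∫ x, φ s 0 x * ρ s' 0 x ∂(riemannianVolume n M)) -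
        ∫ z, dt (φ s) z.1 z.2 * ρ s' z.1 z.2 ∂(spaceTime (riemannianVolume n M)) := by
  obtain ⟨χ, hχ, hlim⟩ := exists_cutoff_seq (M := M) n
  have h0 := h.integrable_slice_potential_mul_density hs hs' (t := 0) (by simp)
  have h1 := h.integrable_slice_potential_mul_density hs hs' (t := 1) (by simp)
  have hm : ∀ k, AEStronglyMeasurable (fun z : ℝ × M => χ k z.2)
      (spaceTime (riemannianVolume n M)) := fun k =>
    ((hχ k).1.continuous.comp continuous_snd).aestronglyMeasurable
  have hl1 := tendsto_integral_mul_of_tendsto_one (h.integrable_density_mul_pPairing hs hs') hm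
    (fun k z => ((hχ k).2.2 z.2).1) fun z => hlim z.2
  have hl2 := tendsto_integral_mul_of_tendsto_one (h.integrable_dt_mul_density hs hs') hm
    (fun k z => ((hχ k).2.2 z.2).1) fun z => hlim z.2
  have hl3 := tendsto_integral_mul_of_tendsto_one (h1.sub h0)
    (fun k => (hχ k).1.continuous.aestronglyMeasurable) (fun k x => ((hχ k).2.2 x).1) hlim
  have hl4 : Tendsto (fun k => ∫ z, φ s z.1 z.2 * ρ s' z.1 z.2 *
      pPairing p (grad n (φ s' z.1) z.2) (grad n (χ k) z.2) ∂(spaceTime (riemannianVolume n M)))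
      atTop (𝓝 0) := by
    have hG : Integrable (fun z : ℝ × M => G z.2) (spaceTime (riemannianVolume n M)) :=
      h.integrable.comp_snd _
    refine squeeze_zero_norm (a := fun k : ℕ => 2 * (3 / ((k : ℝ) + 1)) *
      ∫ z : ℝ × M, G z.2 ∂(spaceTime (riemannianVolume n M))) (fun k => ?_) ?_
    · rw [← integral_const_mul]
      refine norm_integral_le_of_norm_le (hG.const_mul _) ?_
      filter_upwards [ae_spaceTime_mem] with z hz
      exact h.abs_cutoff_error_le hs hs' (fun x => ((hχ k).2.2 x).2) hz
    · have := (tendsto_one_div_add_atTop_nhds_zero_nat (𝕜 := ℝ)).const_mul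
        (6 * ∫ z : ℝ × M, G z.2 ∂(spaceTime (riemannianVolume n M)))
      rw [mul_zero] at this
      refine this.congr fun k => ?_
      ring
  have heq := fun k => h.integral_cutoff_eq hs hs' (hχ k).1 (hχ k).2.1
    (fun x => ((hχ k).2.2 x).1) (fun x => ((hχ k).2.2 x).2)
  have hlim' := tendsto_nhds_unique (hl1.add hl4)
    ((hl3.sub hl2).congr fun k => (heq k).symm)
  rw [add_zero] at hlim'
  rw [hlim', ← integral_sub h1 h0]
  rfl

end IsTransportFamily

end TransportPairing

/-! ### The derivative of the energy -/

section EnergyDerivative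

open Topology Filter

variable {n : ℕ} {M : Type*} [MetricSpace M] [SigmaCompactSpace M]
  [ChartedSpace (EuclideanSpace ℝ (Fin n)) M] [IsManifold (𝓡 n) ∞ M]
  [RiemannianBundle (fun x : M => TangentSpace (𝓡 n) x)] [MeasurableSpace M]
  [BorelSpace M] [SecondCountableTopology M]
  [IsContinuousRiemannianBundle (EuclideanSpace ℝ (Fin n)) (fun x : M => TangentSpace (𝓡 n) x)]

namespace IsTransportFamily

variable {p a b : ℝ} {ρ φ : ℝ → ℝ → M → ℝ} {G : M → ℝ}
  (h : IsTransportFamily n p a b ρ φ G) {s s' : ℝ} (hs : s ∈ Icc a b) (hs' : s' ∈ Icc a b)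

include h hs

/-- Differentiation of the integral of `|∇φ|^p ρ` under the integral sign. -/
theorem hasDerivWithinAt_integral_norm_grad_mul_density :
    HasDerivWithinAt (fun s => ∫ z, ‖grad n (φ s z.1) z.2‖ ^ p * ρ s z.1 z.2
        ∂(spaceTime (riemannianVolume n M)))
      (p * (∫ z, ρ s z.1 z.2 *
          pPairing p (grad n (φ s z.1) z.2) (grad n (ds (Icc a b) φ s z.1) z.2)
          ∂(spaceTime (riemannianVolume n M))) +
        ∫ z, ‖grad n (φ s z.1) z.2‖ ^ p * ds (Icc a b) ρ s z.1 z.2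
          ∂(spaceTime (riemannianVolume n M))) (Icc a b) s := by
  have hG : Integrable (fun z : ℝ × M => G z.2) (spaceTime (riemannianVolume n M)) :=
    h.integrable.comp_snd _
  have hp := h.one_lt
  refine (hasDerivWithinAt_integral_of_dominated
    (f := fun s (z : ℝ × M) => ‖grad n (φ s z.1) z.2‖ ^ p * ρ s z.1 z.2)
    (f' := fun s (z : ℝ × M) => p * (ρ s z.1 z.2 *
      pPairing p (grad n (φ s z.1) z.2) (grad n (ds (Icc a b) φ s z.1) z.2)) +
      ‖grad n (φ s z.1) z.2‖ ^ p * ds (Icc a b) ρ s z.1 z.2)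
    (fun s hs => h.integrable_norm_grad_mul_density hs hs) (hG.const_mul (2 * p + 1)) ?_ ?_
    hs).congr_deriv ?_
  · filter_upwards [ae_spaceTime_mem] with z hz s hs
    refine ((hasDerivWithinAt_norm_rpow hp (h.smooth_potential.hasDerivWithinAt_grad h.lt hs hz
      z.2)).mul (h.smooth_density.hasDerivWithinAt_ds hs hz z.2)).congr_deriv ?_
    ring
  · filter_upwards [ae_spaceTime_mem] with z hz s hs
    obtain ⟨h0, h1⟩ := h.density_growth hs hz z.2
    have h2 := h.growth_bounds hs hs hz z.2 h0 h1
    have h3 := h.growth_bounds hs hs hz z.2 (abs_nonneg _) (h.ds_density_growth hs hz z.2)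
    have h4 := mul_le_mul_of_nonneg_left (abs_pPairing_le_add hp (grad n (φ s z.1) z.2)
      (grad n (ds (Icc a b) φ s z.1) z.2)) h0
    have h5 : ρ s z.1 z.2 * |pPairing p (grad n (φ s z.1) z.2)
        (grad n (ds (Icc a b) φ s z.1) z.2)| ≤ 2 * G z.2 := by
      linarith [h2.2.2.2.2.1, h2.2.2.2.2.2.1]
    refine (abs_add_le _ _).trans ?_
    rw [abs_mul, abs_mul, abs_mul, abs_of_nonneg h0, abs_of_pos (by linarith : 0 < p),
      abs_of_nonneg (Real.rpow_nonneg (norm_nonneg _) _)]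
    linarith [h3.2.2.2.2.1, mul_le_mul_of_nonneg_left h5 (by linarith : 0 ≤ p)]
  · rw [integral_add ((h.integrable_density_mul_pPairing_ds hs hs).const_mul p)
      (h.integrable_norm_grad_mul_ds_density hs hs), integral_const_mul]

omit [SecondCountableTopology M]
  [IsContinuousRiemannianBundle (EuclideanSpace ℝ (Fin n)) (fun x : M => TangentSpace (𝓡 n) x)] in
/-- Differentiation in the density alone of the integral of `φ ρ` at a fixed time. -/
theorem hasDerivWithinAt_integral_potential_mul_density {t : ℝ} (ht : t ∈ Icc (0 : ℝ) 1) :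
    HasDerivWithinAt (fun s' => ∫ x, φ s t x * ρ s' t x ∂(riemannianVolume n M))
      (∫ x, φ s t x * ds (Icc a b) ρ s t x ∂(riemannianVolume n M)) (Icc a b) s := by
  refine hasDerivWithinAt_integral_of_dominated
    (f' := fun s' x => φ s t x * ds (Icc a b) ρ s' t x)
    (fun s' hs' => h.integrable_slice_potential_mul_density hs hs' ht) h.integrable
    (Eventually.of_forall fun x s' hs' =>
      (h.smooth_density.hasDerivWithinAt_ds hs' ht x).const_mul _)
    (Eventually.of_forall fun x s' hs' => ?_) hs
  rw [abs_mul]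
  exact (h.growth_bounds hs hs' ht x (abs_nonneg _) (h.ds_density_growth hs' ht x)).2.1

/-- Differentiation in the density alone of the integral of `(∂φ/∂t) ρ`. -/
theorem hasDerivWithinAt_integral_dt_mul_density :
    HasDerivWithinAt
      (fun s' => ∫ z, dt (φ s) z.1 z.2 * ρ s' z.1 z.2 ∂(spaceTime (riemannianVolume n M)))
      (∫ z, dt (φ s) z.1 z.2 * ds (Icc a b) ρ s z.1 z.2 ∂(spaceTime (riemannianVolume n M)))
      (Icc a b) s := by
  have hG : Integrable (fun z : ℝ × M => G z.2) (spaceTime (riemannianVolume n M)) :=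
    h.integrable.comp_snd _
  refine hasDerivWithinAt_integral_of_dominated
    (f' := fun s' (z : ℝ × M) => dt (φ s) z.1 z.2 * ds (Icc a b) ρ s' z.1 z.2)
    (fun s' hs' => h.integrable_dt_mul_density hs hs') hG ?_ ?_ hs
  · filter_upwards [ae_spaceTime_mem] with z hz s' hs'
    exact (h.smooth_density.hasDerivWithinAt_ds hs' hz z.2).const_mul _
  · filter_upwards [ae_spaceTime_mem] with z hz s' hs'
    rw [abs_mul]
    exact (h.growth_bounds hs hs' hz z.2 (abs_nonneg _)
      (h.ds_density_growth hs' hz z.2)).2.2.2.1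

include hs' in
omit [BorelSpace M] [SecondCountableTopology M]
  [IsContinuousRiemannianBundle (EuclideanSpace ℝ (Fin n)) (fun x : M => TangentSpace (𝓡 n) x)] in
/-- The difference quotient of `∇φ` in `s`, raised to the power `p`, is controlled by the growth
condition: the mean value inequality is applied with the constant `(G / ρ)^{1/p}`. -/
theorem norm_slope_grad_rpow_mul_le {z : ℝ × M} (hz : z.1 ∈ Icc (0 : ℝ) 1) (hne : s' ≠ s) :
    ‖slope (fun σ => grad n (φ σ z.1) z.2) s s'‖ ^ p * ρ s' z.1 z.2 ≤ G z.2 := by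
  have hρ := h.pos s' hs' z.1 hz z.2
  have hp : 0 < p := by linarith [h.one_lt]
  have hle : ∀ σ ∈ Icc a b, ‖grad n (ds (Icc a b) φ σ z.1) z.2‖ ^ p ≤ G z.2 / ρ s' z.1 z.2 :=
    fun σ hσ => by
      obtain ⟨h0, h1⟩ := h.density_growth hs' hz z.2
      rw [le_div_iff₀ hρ]
      exact (h.growth_bounds hσ hs' hz z.2 h0 h1).2.2.2.2.2.1
  have hnonneg : 0 ≤ G z.2 / ρ s' z.1 z.2 :=
    (Real.rpow_nonneg (norm_nonneg _) p).trans (hle s hs)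
  have hmv := (convex_Icc a b).norm_image_sub_le_of_norm_hasDerivWithin_le
    (C := (G z.2 / ρ s' z.1 z.2) ^ p⁻¹)
    (fun σ hσ => h.smooth_potential.hasDerivWithinAt_grad h.lt hσ hz z.2)
    (fun σ hσ => (Real.le_rpow_inv_iff_of_pos (norm_nonneg _) hnonneg hp).2 (hle σ hσ)) hs hs'
  have hslope : ‖slope (fun σ => grad n (φ σ z.1) z.2) s s'‖ ≤ (G z.2 / ρ s' z.1 z.2) ^ p⁻¹ := by
    rw [slope, norm_smul, norm_inv, vsub_eq_sub,
      inv_mul_le_iff₀ (norm_pos_iff.2 (sub_ne_zero.2 hne)), mul_comm]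
    exact hmv
  rw [← le_div_iff₀ hρ]
  exact (Real.le_rpow_inv_iff_of_pos (norm_nonneg _) hnonneg hp).1 hslope

/-- Differentiation of the integral of `ρ ⟨|∇φ|^{p-2}∇φ, ∇φ - ∇φ_s⟩` at the parameter `s`, where the
second factor vanishes. -/
theorem hasDerivWithinAt_integral_sub :
    HasDerivWithinAt (fun s' =>
      (∫ z, ‖grad n (φ s' z.1) z.2‖ ^ p * ρ s' z.1 z.2 ∂(spaceTime (riemannianVolume n M))) -
        ∫ z, ρ s' z.1 z.2 * pPairing p (grad n (φ s' z.1) z.2) (grad n (φ s z.1) z.2)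
          ∂(spaceTime (riemannianVolume n M)))
      (∫ z, ρ s z.1 z.2 *
          pPairing p (grad n (φ s z.1) z.2) (grad n (ds (Icc a b) φ s z.1) z.2)
          ∂(spaceTime (riemannianVolume n M))) (Icc a b) s := by
  have hG : Integrable (fun z : ℝ × M => G z.2) (spaceTime (riemannianVolume n M)) :=
    h.integrable.comp_snd _
  have hp := h.one_lt
  have hmem : ∀ᶠ s' in 𝓝[Icc a b \ {s}] s, s' ∈ Icc a b \ {s} := self_mem_nhdsWithin
  have hself : ∀ s' : ℝ, ∀ z : ℝ × M, ‖grad n (φ s' z.1) z.2‖ ^ p * ρ s' z.1 z.2 =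
      ρ s' z.1 z.2 * pPairing p (grad n (φ s' z.1) z.2) (grad n (φ s' z.1) z.2) := fun s' z => by
    rw [pPairing_self hp, mul_comm]
  have hquot : ∀ s' : ℝ, ∀ z : ℝ × M, (s' - s)⁻¹ * (‖grad n (φ s' z.1) z.2‖ ^ p * ρ s' z.1 z.2 -
        ρ s' z.1 z.2 * pPairing p (grad n (φ s' z.1) z.2) (grad n (φ s z.1) z.2)) =
      ρ s' z.1 z.2 * pPairing p (grad n (φ s' z.1) z.2)
        (slope (fun σ => grad n (φ σ z.1) z.2) s s') := fun s' z => by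
    rw [slope, vsub_eq_sub, pPairing_smul, pPairing_sub, hself]
    ring
  rw [hasDerivWithinAt_iff_tendsto_slope]
  have heq : (fun s' => ∫ z, ρ s' z.1 z.2 * pPairing p (grad n (φ s' z.1) z.2)
        (slope (fun σ => grad n (φ σ z.1) z.2) s s') ∂(spaceTime (riemannianVolume n M)))
      =ᶠ[𝓝[Icc a b \ {s}] s] slope (fun s' =>
      (∫ z, ‖grad n (φ s' z.1) z.2‖ ^ p * ρ s' z.1 z.2 ∂(spaceTime (riemannianVolume n M))) -
        ∫ z, ρ s' z.1 z.2 * pPairing p (grad n (φ s' z.1) z.2) (grad n (φ s z.1) z.2)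
          ∂(spaceTime (riemannianVolume n M))) s := by
    filter_upwards [hmem] with s' hs'
    simp only [← hquot]
    rw [integral_const_mul, integral_sub (h.integrable_norm_grad_mul_density hs'.1 hs'.1)
      (h.integrable_density_mul_pPairing hs hs'.1), slope, vsub_eq_sub, smul_eq_mul]
    simp only [hself s, sub_self, sub_zero]
  refine Tendsto.congr' heq (tendsto_integral_filter_of_dominated_convergence
    (fun z => 2 * G z.2) ?_ ?_ (hG.const_mul 2) ?_)
  · filter_upwards [hmem] with s' hs'
    simp only [← hquot]
    exact (((h.integrable_norm_grad_mul_density hs'.1 hs'.1).sub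
      (h.integrable_density_mul_pPairing hs hs'.1)).const_mul _).aestronglyMeasurable
  · filter_upwards [hmem] with s' hs'
    filter_upwards [ae_spaceTime_mem] with z hz
    obtain ⟨h0, h1⟩ := h.density_growth hs'.1 hz z.2
    rw [norm_mul, Real.norm_of_nonneg h0, Real.norm_eq_abs]
    have h2 := mul_le_mul_of_nonneg_left (abs_pPairing_le_add hp (grad n (φ s' z.1) z.2)
      (slope (fun σ => grad n (φ σ z.1) z.2) s s')) h0
    have h3 := (h.growth_bounds hs'.1 hs'.1 hz z.2 h0 h1).2.2.2.2.1
    have h4 := h.norm_slope_grad_rpow_mul_le hs hs'.1 hz hs'.2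
    linarith
  · filter_upwards [ae_spaceTime_mem] with z hz
    have hg := h.smooth_potential.hasDerivWithinAt_grad h.lt hs hz z.2
    refine Tendsto.mul ?_ (tendsto_pPairing hp ?_ (hasDerivWithinAt_iff_tendsto_slope.1 hg))
    · exact (h.smooth_density.hasDerivWithinAt_ds hs hz z.2).continuousWithinAt.mono_left
        (nhdsWithin_mono s sdiff_subset)
    · exact hg.continuousWithinAt.mono_left (nhdsWithin_mono s sdiff_subset)

variable [CompleteSpace M] [Nonempty M] [IsRiemannianManifold (𝓡 n) M]

/-- The first variation of the energy. The derivative of the integral of `|∇φ|^p ρ` is computed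
twice, under the integral sign and through the transport equation tested with the potential at the
parameter `s`; comparing the two results eliminates the term that contains `∂φ/∂s`. -/
theorem hasDerivWithinAt_energy :
    HasDerivWithinAt (fun s => energy n p (ρ s) (φ s))
      (firstVariation n p (φ s) (ds (Icc a b) ρ s)) (Icc a b) s := by
  have hp := h.one_lt
  have hF := h.hasDerivWithinAt_integral_norm_grad_mul_density hs
  have hQ : HasDerivWithinAt (fun s' => ∫ z, ρ s' z.1 z.2 *
      pPairing p (grad n (φ s' z.1) z.2) (grad n (φ s z.1) z.2)
      ∂(spaceTime (riemannianVolume n M))) _ (Icc a b) s :=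
    (((h.hasDerivWithinAt_integral_potential_mul_density hs (t := 1) (by simp)).sub
      (h.hasDerivWithinAt_integral_potential_mul_density hs (t := 0) (by simp))).sub
      (h.hasDerivWithinAt_integral_dt_mul_density hs)).congr_of_mem
      (fun s' hs' => h.integral_density_mul_pPairing hs hs') hs
  have hF' := (hQ.add (h.hasDerivWithinAt_integral_sub hs)).congr_of_mem
    (f₁ := fun s' => ∫ z, ‖grad n (φ s' z.1) z.2‖ ^ p * ρ s' z.1 z.2
      ∂(spaceTime (riemannianVolume n M))) (fun s' _ => by simp) hs
  have huniq := (uniqueDiffOn_Icc h.lt s hs).eq_deriv _ hF hF'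
  have hE : HasDerivWithinAt (fun s => energy n p (ρ s) (φ s)) _ (Icc a b) s :=
    (hF'.const_mul (1 / p)).congr_of_mem (fun s' hs' => by
      rw [energy, intervalIntegral_integral_eq (f := fun t x => ‖grad n (φ s' t) x‖ ^ p * ρ s' t x)
        (h.integrable_norm_grad_mul_density hs' hs')]) hs
  have hHJ : ∫ t in (0 : ℝ)..1, ∫ x, hamiltonJacobi n p (φ s) t x * ds (Icc a b) ρ s t x
        ∂(riemannianVolume n M) =
      (∫ z, dt (φ s) z.1 z.2 * ds (Icc a b) ρ s z.1 z.2 ∂(spaceTime (riemannianVolume n M))) +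
        1 / p * ∫ z, ‖grad n (φ s z.1) z.2‖ ^ p * ds (Icc a b) ρ s z.1 z.2
          ∂(spaceTime (riemannianVolume n M)) := by
    have hi := (h.integrable_dt_mul_ds_density hs hs).add
      ((h.integrable_norm_grad_mul_ds_density hs hs).const_mul (1 / p))
    have hfun : ∀ z : ℝ × M, hamiltonJacobi n p (φ s) z.1 z.2 * ds (Icc a b) ρ s z.1 z.2 =
        dt (φ s) z.1 z.2 * ds (Icc a b) ρ s z.1 z.2 +
          1 / p * (‖grad n (φ s z.1) z.2‖ ^ p * ds (Icc a b) ρ s z.1 z.2) := fun z => by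
      rw [hamiltonJacobi]; ring
    rw [intervalIntegral_integral_eq
      (f := fun t x => hamiltonJacobi n p (φ s) t x * ds (Icc a b) ρ s t x)
      (hi.congr (Eventually.of_forall fun z => (hfun z).symm))]
    simp only [hfun]
    rw [integral_add (h.integrable_dt_mul_ds_density hs hs)
      ((h.integrable_norm_grad_mul_ds_density hs hs).const_mul (1 / p)), integral_const_mul]
  refine hE.congr_deriv ?_
  rw [firstVariation, hHJ]
  have hp1 : p - 1 ≠ 0 := by linarith
  have hp0 : p ≠ 0 := by linarith
  field_simp
  linear_combination huniq

end IsTransportFamily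

end EnergyDerivative

/-! ### Test densities and the fundamental lemma of the calculus of variations -/

section TestDensities

open Topology Filter

variable {n : ℕ} {M : Type*} [MetricSpace M] [ChartedSpace (EuclideanSpace ℝ (Fin n)) M]

theorem isTestDensity_mul {a : ℝ → ℝ} {b : M → ℝ} (ha : ContDiff ℝ ∞ a)
    (hac : HasCompactSupport a) (ha01 : tsupport a ⊆ Ioo 0 1)
    (hb : ContMDiff (𝓡 n) 𝓘(ℝ, ℝ) ∞ b) (hbc : HasCompactSupport b) :
    IsTestDensity n fun t x => a t * b x := by
  have hsub : tsupport (fun z : ℝ × M => a z.1 * b z.2) ⊆ tsupport a ×ˢ tsupport b := by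
    refine closure_minimal (fun z hz => ?_) ((isClosed_tsupport a).prod (isClosed_tsupport b))
    exact ⟨subset_tsupport a (left_ne_zero_of_mul hz), subset_tsupport b (right_ne_zero_of_mul hz)⟩
  refine ⟨(ha.contMDiff.comp contMDiff_fst).mul (hb.comp contMDiff_snd),
    (hac.isCompact.prod hbc.isCompact).of_isClosed_subset (isClosed_tsupport _) hsub,
    hsub.trans (prod_mono ha01 (subset_univ _))⟩

theorem IsTestDensity.eq_zero {σ : ℝ → M → ℝ} (hσ : IsTestDensity n σ) {t : ℝ}
    (ht : t ∉ Ioo (0 : ℝ) 1) (x : M) : σ t x = 0 := by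
  by_contra hne
  exact ht (hσ.2.2 (subset_tsupport (fun z : ℝ × M => σ z.1 z.2) (a := (t, x)) hne)).1

variable [MeasurableSpace M] [BorelSpace M] [SigmaCompactSpace M] [IsManifold (𝓡 n) ∞ M]
  {μ : Measure M} [IsLocallyFiniteMeasure μ] [μ.IsOpenPosMeasure]

/-- The fundamental lemma of the calculus of variations for continuous functions on a manifold. -/
theorem eq_zero_of_forall_integral_mul_eq_zero {f : M → ℝ} (hf : Continuous f)
    (h : ∀ b : M → ℝ, ContMDiff (𝓡 n) 𝓘(ℝ, ℝ) ∞ b → HasCompactSupport b →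
      ∫ x, b x * f x ∂μ = 0) (x : M) : f x = 0 := by
  have : LocallyCompactSpace M := Manifold.locallyCompact_of_finiteDimensional (𝓡 n)
  have hae := ae_eq_zero_of_integral_contMDiff_smul_eq_zero (𝓡 n) (μ := μ)
    hf.locallyIntegrable fun b hb hbc => by simpa using h b hb hbc
  exact congrFun ((Continuous.ae_eq_iff_eq μ hf continuous_const).1 hae) x

/-- If every test function had integral zero, the constant `1` would vanish. -/
theorem exists_integral_eq_one [Nonempty M] : ∃ b : M → ℝ, ContMDiff (𝓡 n) 𝓘(ℝ, ℝ) ∞ b ∧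
    HasCompactSupport b ∧ ∫ x, b x ∂μ = 1 := by
  have hex : ∃ b : M → ℝ, ContMDiff (𝓡 n) 𝓘(ℝ, ℝ) ∞ b ∧ HasCompactSupport b ∧
      ∫ x, b x ∂μ ≠ 0 := by
    by_contra! hcon
    exact one_ne_zero (eq_zero_of_forall_integral_mul_eq_zero (n := n) (μ := μ)
      (f := fun _ : M => (1 : ℝ)) continuous_const
      (fun b hb hbc => by simpa using hcon b hb hbc) (Classical.arbitrary M))
  obtain ⟨b, hb, hbc, hne⟩ := hex
  refine ⟨fun x => (∫ x, b x ∂μ)⁻¹ * b x, contMDiff_const.mul hb, hbc.mul_left, ?_⟩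
  rw [integral_const_mul, inv_mul_cancel₀ hne]

variable {H : ℝ → M → ℝ}
  (hH : ContinuousOn (fun z : ℝ × M => H z.1 z.2) (Icc (0 : ℝ) 1 ×ˢ (univ : Set M)))

include hH

omit [μ.IsOpenPosMeasure] in
theorem continuousOn_integral_mul {b : M → ℝ} (hb : Continuous b) (hbc : HasCompactSupport b) :
    ContinuousOn (fun t => ∫ x, b x * H t x ∂μ) (Icc 0 1) := by
  refine continuousOn_integral_of_compact_support hbc.isCompact
    (((hb.comp continuous_snd).continuousOn).mul hH) fun t x _ hx => ?_
  rw [image_eq_zero_of_notMem_tsupport hx, zero_mul]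

omit [μ.IsOpenPosMeasure] in
/-- Localisation in time of an integral identity on `[0,1] × M`. -/
theorem integral_mul_eq_zero_of_forall_time {b : M → ℝ} (hb : Continuous b)
    (hbc : HasCompactSupport b)
    (h : ∀ a : ℝ → ℝ, ContDiff ℝ ∞ a → HasCompactSupport a → tsupport a ⊆ Ioo 0 1 →
      ∫ t in (0 : ℝ)..1, ∫ x, H t x * (a t * b x) ∂μ = 0) {t : ℝ} (ht : t ∈ Icc (0 : ℝ) 1) :
    ∫ x, b x * H t x ∂μ = 0 := by
  have hcont := continuousOn_integral_mul (μ := μ) hH hb hbc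
  have hae := isOpen_Ioo.ae_eq_zero_of_integral_contDiff_smul_eq_zero
    (f := fun t => ∫ x, b x * H t x ∂μ) (μ := volume) (U := Ioo 0 1)
    ((hcont.mono Ioo_subset_Icc_self).locallyIntegrableOn measurableSet_Ioo)
    fun a ha hac ha01 => by
      rw [← h a ha hac ha01, intervalIntegral.integral_of_le zero_le_one,
        ← setIntegral_eq_integral_of_forall_compl_eq_zero (s := Ioc 0 1)]
      · refine setIntegral_congr_fun measurableSet_Ioc fun t _ => ?_
        simp only [smul_eq_mul, ← integral_const_mul]
        congr 1
        ext x
        ring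
      · intro t ht
        rw [image_eq_zero_of_notMem_tsupport fun hmem => ht (Ioo_subset_Ioc_self (ha01 hmem)),
          zero_smul]
  refine Measure.eqOn_Icc_of_ae_eq volume zero_ne_one ?_ hcont continuousOn_const ht
  rw [← Measure.restrict_congr_set Ioo_ae_eq_Icc]
  exact (ae_restrict_iff' measurableSet_Ioo).2 hae

theorem eq_zero_of_forall_isTestDensity
    (h : ∀ σ : ℝ → M → ℝ, IsTestDensity n σ →
      ∫ t in (0 : ℝ)..1, ∫ x, H t x * σ t x ∂μ = 0) {t : ℝ} (ht : t ∈ Icc (0 : ℝ) 1) (x : M) :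
    H t x = 0 :=
  eq_zero_of_forall_integral_mul_eq_zero (n := n) (μ := μ)
    (hH.comp_continuous (f := fun x => (t, x)) (by fun_prop) fun x => ⟨ht, mem_univ x⟩)
    (fun _ hb hbc => integral_mul_eq_zero_of_forall_time hH hb.continuous hbc
      (fun _ ha hac ha01 => h _ (isTestDensity_mul ha hac ha01 hb hbc)) ht) x

/-- A continuous function orthogonal to the mass-preserving test densities depends on time only. Its
value at time `t` is its integral against a fixed bump function of mass one. -/
theorem exists_eq_of_forall_isTestDensity [Nonempty M]
    (h : ∀ σ : ℝ → M → ℝ, IsTestDensity n σ → (∀ t, ∫ x, σ t x ∂μ = 0) →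
      ∫ t in (0 : ℝ)..1, ∫ x, H t x * σ t x ∂μ = 0) :
    ∃ e : ℝ → ℝ, ContinuousOn e (Icc 0 1) ∧ ∀ t ∈ Icc (0 : ℝ) 1, ∀ x, H t x = e t := by
  obtain ⟨b₀, hb₀, hbc₀, hone⟩ := exists_integral_eq_one (n := n) (M := M) (μ := μ)
  refine ⟨fun t => ∫ x, b₀ x * H t x ∂μ, continuousOn_integral_mul hH hb₀.continuous hbc₀,
    fun t ht x => ?_⟩
  have hcont : Continuous (H t) :=
    hH.comp_continuous (f := fun x => (t, x)) (by fun_prop) fun x => ⟨ht, mem_univ x⟩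
  rw [← sub_eq_zero]
  refine eq_zero_of_forall_integral_mul_eq_zero (n := n) (μ := μ)
    (f := fun x => H t x - ∫ x, b₀ x * H t x ∂μ) (hcont.sub continuous_const)
    (fun b hb hbc => ?_) x
  have hi : ∀ {b : M → ℝ}, Continuous b → HasCompactSupport b → Integrable b μ :=
    fun hb hbc => hb.integrable_of_hasCompactSupport hbc
  have hi' : ∀ {b : M → ℝ}, Continuous b → HasCompactSupport b →
      Integrable (fun x => b x * H t x) μ := fun hb hbc => hi (hb.mul hcont) hbc.mul_right
  have hzero := integral_mul_eq_zero_of_forall_time (μ := μ) hH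
    (b := fun x => b x - (∫ x, b x ∂μ) * b₀ x)
    (hb.continuous.sub (continuous_const.mul hb₀.continuous)) (hbc.sub hbc₀.mul_left)
    (fun a ha hac ha01 => h _ (isTestDensity_mul ha hac ha01 (hb.sub (contMDiff_const.mul hb₀))
      (hbc.sub hbc₀.mul_left)) fun t => by
        rw [integral_const_mul, integral_sub (hi hb.continuous hbc)
          ((hi hb₀.continuous hbc₀).const_mul _), integral_const_mul, hone, mul_one, sub_self,
          mul_zero]) ht
  simp only [sub_mul, mul_sub, mul_assoc] at hzero ⊢
  rw [integral_sub (hi' hb.continuous hbc) ((hi' hb₀.continuous hbc₀).const_mul _),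
    integral_const_mul] at hzero
  rw [integral_sub (hi' hb.continuous hbc) ((hi hb.continuous hbc).mul_const _),
    integral_mul_const, hzero]

end TestDensities

section EulerLagrange

open Topology Filter

variable {n : ℕ} {M : Type*} [MetricSpace M] [ChartedSpace (EuclideanSpace ℝ (Fin n)) M]

/-- A continuous function on `[0,1]` is the derivative of a `C¹` function. -/
theorem exists_contDiffOn_derivWithin_eq {e : ℝ → ℝ} (he : ContinuousOn e (Icc 0 1)) :
    ∃ c : ℝ → ℝ, ContDiffOn ℝ 1 c (Icc 0 1) ∧
      ∀ t ∈ Icc (0 : ℝ) 1, derivWithin c (Icc 0 1) t = e t := by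
  have hcont : Continuous (IccExtend zero_le_one ((Icc (0 : ℝ) 1).domRestrict e)) :=
    (continuousOn_iff_continuous_domRestrict.1 he).Icc_extend'
  set e' := IccExtend zero_le_one ((Icc (0 : ℝ) 1).domRestrict e) with he'
  have hderiv : ∀ t, HasDerivAt (fun t => ∫ τ in (0 : ℝ)..t, e' τ) (e' t) t := fun t =>
    hcont.integral_hasStrictDerivAt 0 t |>.hasDerivAt
  refine ⟨fun t => ∫ τ in (0 : ℝ)..t, e' τ, ContDiff.contDiffOn ?_, fun t ht => ?_⟩
  · rw [contDiff_one_iff_deriv]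
    refine ⟨fun t => (hderiv t).differentiableAt, ?_⟩
    rw [show deriv (fun t => ∫ τ in (0 : ℝ)..t, e' τ) = e' from funext fun t => (hderiv t).deriv]
    exact hcont
  · rw [((hderiv t).hasDerivWithinAt).derivWithin (uniqueDiffOn_Icc zero_lt_one t ht), he',
      IccExtend_of_mem _ _ ht]
    rfl

theorem IsSmoothFamily.continuousOn_hamiltonJacobi [IsManifold (𝓡 n) ∞ M]
    [RiemannianBundle (fun x : M => TangentSpace (𝓡 n) x)]
    [SigmaCompactSpace M] [MeasurableSpace M]
    [IsContinuousRiemannianBundle (EuclideanSpace ℝ (Fin n)) (fun x : M => TangentSpace (𝓡 n) x)]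
    {a b p : ℝ} (hab : a < b) (hp : 0 ≤ p) {φ : ℝ → ℝ → M → ℝ}
    (hφ : IsSmoothFamily n (Icc a b) φ) {s : ℝ} (hs : s ∈ Icc a b) :
    ContinuousOn (fun z : ℝ × M => hamiltonJacobi n p (φ s) z.1 z.2)
      (Icc (0 : ℝ) 1 ×ˢ (univ : Set M)) :=
  ((hφ.isSmoothFamily_dt hab).continuousOn hs).add
    (continuousOn_const.mul (hφ.continuousOn_norm_grad_rpow hab hp hs))

theorem IsSmoothFamily.hamiltonJacobi_sub [IsManifold (𝓡 n) ∞ M]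
    [RiemannianBundle (fun x : M => TangentSpace (𝓡 n) x)]
    {a b p : ℝ} {φ : ℝ → ℝ → M → ℝ}
    (hφ : IsSmoothFamily n (Icc a b) φ) {s t : ℝ} (hs : s ∈ Icc a b) (ht : t ∈ Icc (0 : ℝ) 1)
    {c : ℝ → ℝ} (hc : ContDiffOn ℝ 1 c (Icc 0 1)) (x : M) :
    hamiltonJacobi n p (fun t x => φ s t x - c t) t x =
      hamiltonJacobi n p (φ s) t x - derivWithin c (Icc 0 1) t := by
  have h1 : dt (fun t x => φ s t x - c t) t x = dt (φ s) t x - derivWithin c (Icc 0 1) t :=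
    ((hφ.hasDerivWithinAt_dt hs ht x).sub
      ((hc.differentiableOn (by simp)) t ht).hasDerivWithinAt).derivWithin
        (uniqueDiffOn_Icc zero_lt_one t ht)
  rw [hamiltonJacobi, hamiltonJacobi, h1, grad_sub_const n (hφ.mdifferentiableAt hs ht x)]
  ring

end EulerLagrange

/-! ### The Euler–Lagrange equation -/

section CriticalPoints

variable {n : ℕ} {M : Type*} [MetricSpace M] [SigmaCompactSpace M]
  [ChartedSpace (EuclideanSpace ℝ (Fin n)) M] [IsManifold (𝓡 n) ∞ M]
  [RiemannianBundle (fun x : M => TangentSpace (𝓡 n) x)] [MeasurableSpace M]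

/-- The boundary terms of the first variation vanish for test densities. -/
theorem IsTestDensity.firstVariation_eq_zero_iff {p : ℝ} (hp : 1 < p) {φ σ : ℝ → M → ℝ}
    (hσ : IsTestDensity n σ) : firstVariation n p φ σ = 0 ↔
      ∫ t in (0 : ℝ)..1, ∫ x, hamiltonJacobi n p φ t x * σ t x ∂(riemannianVolume n M) = 0 := by
  have h0 : ∀ x, σ 0 x = 0 := hσ.eq_zero (by simp)
  have h1 : ∀ x, σ 1 x = 0 := hσ.eq_zero (by simp)
  have hp' : p - 1 ≠ 0 := by linarith
  simp [firstVariation, h0, h1, hp']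

/-- If `∂φ/∂t + |∇φ|^p / p` depends on time only, its integral against a density of zero mass
vanishes. -/
theorem integral_hamiltonJacobi_mul_eq_zero {p : ℝ} {φ σ : ℝ → M → ℝ} {e : ℝ → ℝ}
    (he : ∀ t ∈ Icc (0 : ℝ) 1, ∀ x, hamiltonJacobi n p φ t x = e t)
    (hσ : ∀ t ∈ Icc (0 : ℝ) 1, ∫ x, σ t x ∂(riemannianVolume n M) = 0) :
    ∫ t in (0 : ℝ)..1, ∫ x, hamiltonJacobi n p φ t x * σ t x ∂(riemannianVolume n M) = 0 := by
  rw [intervalIntegral.integral_congr (g := fun _ => (0 : ℝ)) fun t ht => ?_]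
  · simp
  · rw [uIcc_of_le zero_le_one] at ht
    simp only [he t ht, integral_const_mul, hσ t ht, mul_zero]

namespace IsTransportFamily

variable {p a b : ℝ} {ρ φ : ℝ → ℝ → M → ℝ} {G : M → ℝ}
  (h : IsTransportFamily n p a b ρ φ G) {s : ℝ} (hs : s ∈ Icc a b)

include h hs

/-- `φ - c(t)` solves the equation exactly when `∂φ/∂t + |∇φ|^p / p = c'(t)`, so `c` is a primitive
of `e`. -/
theorem exists_solvesHamiltonJacobi_sub_iff :
    (∃ c : ℝ → ℝ, ContDiffOn ℝ 1 c (Icc 0 1) ∧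
      SolvesHamiltonJacobi n p fun t x => φ s t x - c t) ↔
    ∃ e : ℝ → ℝ, ContinuousOn e (Icc 0 1) ∧
      ∀ t ∈ Icc (0 : ℝ) 1, ∀ x, hamiltonJacobi n p (φ s) t x = e t := by
  constructor
  · rintro ⟨c, hc, hsol⟩
    refine ⟨derivWithin c (Icc 0 1),
      hc.continuousOn_derivWithin (uniqueDiffOn_Icc zero_lt_one) le_rfl, fun t ht x => ?_⟩
    have := hsol t ht x
    rwa [h.smooth_potential.hamiltonJacobi_sub hs ht hc, sub_eq_zero] at this
  · rintro ⟨e, he, heq⟩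
    obtain ⟨c, hc, hce⟩ := exists_contDiffOn_derivWithin_eq he
    refine ⟨c, hc, fun t ht x => ?_⟩
    rw [h.smooth_potential.hamiltonJacobi_sub hs ht hc, hce t ht, heq t ht, sub_self]

variable [BorelSpace M] [SecondCountableTopology M]
  [IsContinuousRiemannianBundle (EuclideanSpace ℝ (Fin n)) (fun x : M => TangentSpace (𝓡 n) x)]

omit [SecondCountableTopology M] in
theorem integrable_slice_norm_grad_mul_density {t : ℝ} (ht : t ∈ Icc (0 : ℝ) 1) :
    Integrable (fun x => ‖grad n (φ s t) x‖ ^ p * ρ s t x) (riemannianVolume n M) := by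
  have hp := h.one_lt
  refine integrable_slice_of_le
    ((h.smooth_potential.continuousOn_norm_grad_rpow (p := p) h.lt (by linarith) hs).mul
      (h.smooth_density.continuousOn hs)) ht h.integrable fun x => ?_
  change |‖grad n (φ s t) x‖ ^ p * ρ s t x| ≤ G x
  obtain ⟨h0, h1⟩ := h.density_growth hs ht x
  rw [abs_of_nonneg (mul_nonneg (Real.rpow_nonneg (norm_nonneg _) _) h0)]
  exact (h.growth_bounds hs hs ht x h0 h1).2.2.2.2.1

omit [BorelSpace M] [SecondCountableTopology M]
  [IsContinuousRiemannianBundle (EuclideanSpace ℝ (Fin n)) (fun x : M => TangentSpace (𝓡 n) x)] in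
theorem abs_hamiltonJacobi_mul_ds_density_le {t : ℝ} (ht : t ∈ Icc (0 : ℝ) 1) (x : M) :
    |hamiltonJacobi n p (φ s) t x * ds (Icc a b) ρ s t x| ≤ G x := by
  rw [abs_mul]
  exact (h.growth_bounds hs hs ht x (abs_nonneg _)
    (h.ds_density_growth hs ht x)).2.2.2.2.2.2

omit [BorelSpace M] [SecondCountableTopology M] in
theorem continuousOn_hamiltonJacobi_mul_ds_density :
    ContinuousOn (fun z : ℝ × M => hamiltonJacobi n p (φ s) z.1 z.2 * ds (Icc a b) ρ s z.1 z.2)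
      (Icc (0 : ℝ) 1 ×ˢ (univ : Set M)) :=
  (h.smooth_potential.continuousOn_hamiltonJacobi h.lt (by linarith [h.one_lt]) hs).mul
    ((h.smooth_density.isSmoothFamily_ds h.lt).continuousOn hs)

omit [SecondCountableTopology M] in
theorem integrable_slice_hamiltonJacobi_mul_ds_density {t : ℝ} (ht : t ∈ Icc (0 : ℝ) 1) :
    Integrable (fun x => hamiltonJacobi n p (φ s) t x * ds (Icc a b) ρ s t x)
      (riemannianVolume n M) :=
  integrable_slice_of_le (h.continuousOn_hamiltonJacobi_mul_ds_density hs) ht h.integrable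
    (h.abs_hamiltonJacobi_mul_ds_density_le hs ht)

theorem integrable_hamiltonJacobi_mul_ds_density :
    Integrable (fun z : ℝ × M => hamiltonJacobi n p (φ s) z.1 z.2 * ds (Icc a b) ρ s z.1 z.2)
      (spaceTime (riemannianVolume n M)) :=
  integrable_spaceTime_of_le
    (aestronglyMeasurable_spaceTime (h.continuousOn_hamiltonJacobi_mul_ds_density hs))
    h.integrable 1 fun z hz => by
      rw [one_mul]
      exact h.abs_hamiltonJacobi_mul_ds_density_le hs hz z.2

omit [BorelSpace M] [SecondCountableTopology M]
  [IsContinuousRiemannianBundle (EuclideanSpace ℝ (Fin n)) (fun x : M => TangentSpace (𝓡 n) x)] in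
/-- The mass is conserved along the family. -/
theorem integral_ds_density_eq_zero {t : ℝ} (ht : t ∈ Icc (0 : ℝ) 1)
    (hint : ∀ s ∈ Icc a b, Integrable (ρ s t) (riemannianVolume n M))
    (hone : ∀ s ∈ Icc a b, ∫ x, ρ s t x ∂(riemannianVolume n M) = 1) :
    ∫ x, ds (Icc a b) ρ s t x ∂(riemannianVolume n M) = 0 := by
  have hd := hasDerivWithinAt_integral_of_dominated (μ := riemannianVolume n M)
    (f := fun s x => ρ s t x) (f' := fun s x => ds (Icc a b) ρ s t x) hint h.integrable
    (Filter.Eventually.of_forall fun x s hs => h.smooth_density.hasDerivWithinAt_ds hs ht x)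
    (Filter.Eventually.of_forall fun x s hs =>
      (h.growth_bounds hs hs ht x (abs_nonneg _) (h.ds_density_growth hs ht x)).1) hs
  exact (uniqueDiffOn_Icc h.lt s hs).eq_deriv _ hd
    ((hasDerivWithinAt_const s (Icc a b) (1 : ℝ)).congr_of_mem hone hs)

omit [SecondCountableTopology M] in
theorem forall_firstVariation_eq_zero_iff :
    (∀ σ : ℝ → M → ℝ, IsTestDensity n σ → firstVariation n p (φ s) σ = 0) ↔
      SolvesHamiltonJacobi n p (φ s) := by
  constructor
  · intro hσ t ht x
    exact eq_zero_of_forall_isTestDensity (n := n) (μ := riemannianVolume n M)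
      (h.smooth_potential.continuousOn_hamiltonJacobi h.lt (by linarith [h.one_lt]) hs)
      (fun σ hT => (hT.firstVariation_eq_zero_iff h.one_lt).1 (hσ σ hT)) ht x
  · intro hsol σ hT
    rw [hT.firstVariation_eq_zero_iff h.one_lt,
      intervalIntegral.integral_congr (g := fun _ => (0 : ℝ)) fun t ht => ?_]
    · simp
    · rw [uIcc_of_le zero_le_one] at ht
      simp [hsol t ht]

omit [SecondCountableTopology M] in
theorem forall_firstVariation_eq_zero_iff_of_mass_zero [Nonempty M] :
    (∀ σ : ℝ → M → ℝ, IsTestDensity n σ → (∀ t, ∫ x, σ t x ∂(riemannianVolume n M) = 0) →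
        firstVariation n p (φ s) σ = 0) ↔
      ∃ c : ℝ → ℝ, ContDiffOn ℝ 1 c (Icc 0 1) ∧
        SolvesHamiltonJacobi n p fun t x => φ s t x - c t := by
  rw [h.exists_solvesHamiltonJacobi_sub_iff hs]
  constructor
  · intro hσ
    exact exists_eq_of_forall_isTestDensity (n := n) (μ := riemannianVolume n M)
      (h.smooth_potential.continuousOn_hamiltonJacobi h.lt (by linarith [h.one_lt]) hs)
      fun σ hT hm => (hT.firstVariation_eq_zero_iff h.one_lt).1 (hσ σ hT hm)
  · rintro ⟨e, -, he⟩ σ hT hm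
    exact (hT.firstVariation_eq_zero_iff h.one_lt).2
      (integral_hamiltonJacobi_mul_eq_zero he fun t _ => hm t)

end IsTransportFamily

end CriticalPoints

end PWasserstein

theorem proposition3p1 (n : ℕ) {M : Type*} [MetricSpace M] [CompleteSpace M]
    [SigmaCompactSpace M] [ChartedSpace (EuclideanSpace ℝ (Fin n)) M] [IsManifold (𝓡 n) ∞ M]
    [RiemannianBundle (fun x : M => TangentSpace (𝓡 n) x)]
    [IsContMDiffRiemannianBundle (𝓡 n) ∞ (EuclideanSpace ℝ (Fin n))
      (fun x : M => TangentSpace (𝓡 n) x)]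
    [IsRiemannianManifold (𝓡 n) M] [MeasurableSpace M] [BorelSpace M]
    (p : ℝ) (hp : 1 < p) (s₀ ε : ℝ) (hε : 0 < ε) (S : Set ℝ) (hS : S = Icc (s₀ - ε) (s₀ + ε))
    (ρ φ : ℝ → ℝ → M → ℝ)
    (hρ : PWasserstein.IsSmoothFamily n S ρ) (hφ : PWasserstein.IsSmoothFamily n S φ)
    (hpos : ∀ s ∈ S, ∀ t ∈ Icc (0 : ℝ) 1, ∀ x, 0 < ρ s t x)
    (hprob : ∀ s ∈ S, ∀ t ∈ Icc (0 : ℝ) 1,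
      PWasserstein.IsWassersteinDensity n (p / (p - 1)) (ρ s t))
    (htransport : ∀ s ∈ S, PWasserstein.SolvesTransport n p (ρ s) (φ s))
    (hgrowth : PWasserstein.SuitableGrowth n p S ρ φ) :
    -- the integrals in the energy and in its first variation converge
    (∀ s ∈ S,
      (∀ t ∈ Icc (0 : ℝ) 1,
        Integrable (fun x => ‖PWasserstein.grad n (φ s t) x‖ ^ p * ρ s t x)
            (PWasserstein.riemannianVolume n M) ∧
        Integrable (fun x => φ s t x * PWasserstein.ds S ρ s t x)
            (PWasserstein.riemannianVolume n M) ∧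
        Integrable (fun x => PWasserstein.hamiltonJacobi n p (φ s) t x *
            PWasserstein.ds S ρ s t x) (PWasserstein.riemannianVolume n M)) ∧
      Integrable (fun z : ℝ × M => ‖PWasserstein.grad n (φ s z.1) z.2‖ ^ p * ρ s z.1 z.2)
        ((volume.restrict (Icc (0 : ℝ) 1)).prod (PWasserstein.riemannianVolume n M)) ∧
      Integrable (fun z : ℝ × M => PWasserstein.hamiltonJacobi n p (φ s) z.1 z.2 *
          PWasserstein.ds S ρ s z.1 z.2)
        ((volume.restrict (Icc (0 : ℝ) 1)).prod (PWasserstein.riemannianVolume n M))) ∧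
    -- the first variation formula
    (∀ s ∈ S,
      HasDerivWithinAt (fun s' => PWasserstein.energy n p (ρ s') (φ s'))
        (1 / (p - 1) *
            ((∫ x, φ s 1 x * PWasserstein.ds S ρ s 1 x ∂(PWasserstein.riemannianVolume n M)) -
              ∫ x, φ s 0 x * PWasserstein.ds S ρ s 0 x ∂(PWasserstein.riemannianVolume n M)) -
          1 / (p - 1) * ∫ t in (0 : ℝ)..1, ∫ x,
            (PWasserstein.dt (φ s) t x + 1 / p * ‖PWasserstein.grad n (φ s t) x‖ ^ p) *
              PWasserstein.ds S ρ s t x ∂(PWasserstein.riemannianVolume n M)) S s) ∧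
    -- Euler–Lagrange equation, all density perturbations
    (∀ s ∈ S,
      (∀ σ : ℝ → M → ℝ, PWasserstein.IsTestDensity n σ →
          PWasserstein.firstVariation n p (φ s) σ = 0) ↔
        PWasserstein.SolvesHamiltonJacobi n p (φ s)) ∧
    -- Euler–Lagrange equation, mass-preserving density perturbations
    (∀ s ∈ S,
      (∀ σ : ℝ → M → ℝ, PWasserstein.IsTestDensity n σ →
          (∀ t, ∫ x, σ t x ∂(PWasserstein.riemannianVolume n M) = 0) →
          PWasserstein.firstVariation n p (φ s) σ = 0) ↔
        ∃ c : ℝ → ℝ, ContDiffOn ℝ 1 c (Icc 0 1) ∧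
          PWasserstein.SolvesHamiltonJacobi n p (fun t x => φ s t x - c t)) ∧
    -- solutions are critical for variations with fixed end points
    (∀ s ∈ S,
      (∃ c : ℝ → ℝ, ContDiffOn ℝ 1 c (Icc 0 1) ∧
        PWasserstein.SolvesHamiltonJacobi n p (fun t x => φ s t x - c t)) →
      (∀ x, PWasserstein.ds S ρ s 0 x = 0 ∧ PWasserstein.ds S ρ s 1 x = 0) →
      HasDerivWithinAt (fun s' => PWasserstein.energy n p (ρ s') (φ s')) 0 S s) := by
  subst hS
  have : IsContinuousRiemannianBundle (EuclideanSpace ℝ (Fin n))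
      (fun x : M => TangentSpace (𝓡 n) x) := PWasserstein.isContinuousRiemannianBundle n
  have : SecondCountableTopology M :=
    ChartedSpace.secondCountable_of_sigmaCompact (EuclideanSpace ℝ (Fin n)) M
  have hlt : s₀ - ε < s₀ + ε := by linarith
  have : Nonempty M := by
    by_contra hM
    have : IsEmpty M := not_nonempty_iff.1 hM
    have hone := (hprob (s₀ - ε) (left_mem_Icc.2 hlt.le) 0 (by simp)).integral_eq_one
    rw [Measure.eq_zero_of_isEmpty (PWasserstein.riemannianVolume n M),
      integral_zero_measure] at hone
    exact zero_ne_one hone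
  obtain ⟨G, hG, hgr⟩ := hgrowth
  have h : PWasserstein.IsTransportFamily n p (s₀ - ε) (s₀ + ε) ρ φ G :=
    ⟨hlt, hp, hρ, hφ, hpos, htransport, hG, hgr⟩
  refine ⟨fun s hs => ⟨fun t ht => ⟨h.integrable_slice_norm_grad_mul_density hs ht,
      h.integrable_slice_potential_mul_ds_density hs hs ht,
      h.integrable_slice_hamiltonJacobi_mul_ds_density hs ht⟩,
      h.integrable_norm_grad_mul_density hs hs, h.integrable_hamiltonJacobi_mul_ds_density hs⟩,
    fun s hs => h.hasDerivWithinAt_energy hs,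
    fun s hs => h.forall_firstVariation_eq_zero_iff hs,
    fun s hs => h.forall_firstVariation_eq_zero_iff_of_mass_zero hs, fun s hs hc hend => ?_⟩
  obtain ⟨e, -, he⟩ := (h.exists_solvesHamiltonJacobi_sub_iff hs).1 hc
  have hHJ := PWasserstein.integral_hamiltonJacobi_mul_eq_zero he fun t ht =>
    h.integral_ds_density_eq_zero hs ht (fun s hs => (hprob s hs t ht).integrable)
      fun s hs => (hprob s hs t ht).integral_eq_one
  refine (h.hasDerivWithinAt_energy hs).congr_deriv ?_
  simp only [PWasserstein.firstVariation, hHJ, (hend _).1, (hend _).2, mul_zero, integral_zero,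
    sub_zero]
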